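/- **Setting.** All curves lie on the round sphere $S^2\subset\mathbb R^3$. A multicurve is a finite union of pairwise disjoint smooth simple closed curves. A collection $((a_i,b_i))_{i=1}^k$ of pairs of multicurves is *triangular* if all curves are distinct and meet transversely, they fill $S^2$ (every component of the complement of their union is an open disk), and $$I(a_i,b_j)=I(a_i,a_j)=I(b_i,b_j)=0\quad (j>i),\qquad I(a_i,b_i)>0\quad(1\le i\le k),$$ where $I$ is the number of intersection points (parallel curves and bigon regions are allowed). The collection is *orientable* if the curves can be oriented so that all intersection points have the same sign. A *region* is a component of the complement of $\bigcup_i (a_i\cup b_i)$; an *$m$-prong region* ($m\ge 1$) is a region that is a polygon with $2m$ sides, and it is *odd* if $m$ is odd. The *signature* of the collection is the pair $(R,s)$, where $R$ is the unordered list of the prong numbers of all regions with the $2$'s omitted, and $s=+$ if the collection is orientable, $s=-$ otherwise. With $n_{\mathrm{odd}}$ the number of odd regions, a triangular collection on $S^2$ is *optimal* if $k=n_{\mathrm{odd}}/2-1$ and it is nonorientable, or $k=n_{\mathrm{odd}}/2$ and it is orientable. **Theorem (genus 0).** Let $R=(m_1,\dots,m_N)$ be an unordered list of integers $m_j\ge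 1$, $m_j\ne 2$, with $$\sum_{j=1}^N\frac{2-m_j}{2}=2,$$ and let $s\in\{+,-\}$ be such that $s=-$ if some $m_j$ is odd (under the displayed condition some $m_j$ equals $1$, so $s=-$). Then there are a $k$ and an optimal triangular collection of $k$ pairs of multicurves on $S^2$ whose signature is $(R,s)$. -/

import Mathlib

open scoped ContDiff

/-- Euclidean three-space; the closed oriented surface of genus `0` is its unit sphere. -/
abbrev E3 : Type := EuclideanSpace ℝ (Fin 3)

/-- The two-dimensional sphere. -/
def twoSphere : Set E3 := Metric.sphere 0 1

/-- A smooth simple closed curve on the sphere: a smooth, regular, `1`-periodic parametrization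
with values in the sphere that is injective on one period. The parametrization also orients the
curve. -/
structure SimpleClosedCurve where
  toFun : ℝ → E3
  smooth : ContDiff ℝ ∞ toFun
  periodic : Function.Periodic toFun 1
  mem_sphere : ∀ t, toFun t ∈ twoSphere
  regular : ∀ t, deriv toFun t ≠ 0
  injOn : Set.InjOn toFun (Set.Ico 0 1)

namespace SimpleClosedCurve

/-- The underlying point set of a curve. -/
def image (c : SimpleClosedCurve) : Set E3 := Set.range c.toFun

/-- Two curves are transverse: at each common point the tangent vectors are linearly
independent, i.e. they span the tangent plane of the sphere. -/
def Transverse (c d : SimpleClosedCurve) : Prop :=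
  ∀ s t, c.toFun s = d.toFun t → LinearIndependent ℝ ![deriv c.toFun s, deriv d.toFun t]

/-- The determinant of (outer normal, tangent of `c` at time `s`, tangent of `d` at time `t`).
If `c.toFun s = d.toFun t` is a transverse intersection point, then the sign of this number is the
sign of the intersection point with respect to the orientation of the sphere by the outer normal
and the orientations of `c` and `d` by their parametrizations. -/
noncomputable def crossingDet (c d : SimpleClosedCurve) (s t : ℝ) : ℝ :=
  Matrix.det (Matrix.of
    ![(c.toFun s).ofLp, (deriv c.toFun s).ofLp, (deriv d.toFun t).ofLp])

end SimpleClosedCurve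

/-- A multicurve: finitely many pairwise disjoint simple closed curves. -/
structure Multicurve where
  size : ℕ
  curve : Fin size → SimpleClosedCurve
  disjoint : ∀ i j, i ≠ j → Disjoint (curve i).image (curve j).image

namespace Multicurve

/-- The underlying point set of a multicurve. -/
def support (A : Multicurve) : Set E3 := ⋃ i, (A.curve i).image

/-- The intersection number of two multicurves, as the number of intersection points. -/
noncomputable def I (A B : Multicurve) : ℕ∞ := (A.support ∩ B.support).encard

end Multicurve

/-- An ordered collection `((a i, b i))` of `k` pairs of multicurves on the sphere. -/
structure PairCollection (k : ℕ) where
  a : Fin k → Multicurve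
  b : Fin k → Multicurve

/-- The second entry of a signature: `plus` for orientable, `minus` for nonorientable. -/
inductive SignatureSign
  | plus
  | minus

namespace PairCollection

variable {k : ℕ} (C : PairCollection k)

/-- The union of all the `a`-curves. -/
def unionA : Set E3 := ⋃ i, (C.a i).support

/-- The union of all the `b`-curves. -/
def unionB : Set E3 := ⋃ i, (C.b i).support

/-- The crossings: the intersection points of `a`-curves with `b`-curves. -/
def crossings : Set E3 := C.unionA ∩ C.unionB

/-- The complement in the sphere of all the curves. -/
def complement : Set E3 := twoSphere \ (C.unionA ∪ C.unionB)

/-- The regions: the connected components of the complement. -/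
def regions : Set (Set E3) := (fun x => connectedComponentIn C.complement x) '' C.complement

/-- The curves fill the sphere: every region is an open disk. -/
def Fills : Prop := ∀ R ∈ C.regions, Nonempty (R ≃ₜ Metric.ball (0 : ℂ) 1)

/-- Triangular collections of pairs of multicurves. Transversality is only at stake between
`a`-curves and `b`-curves: any two `a`-curves are disjoint, and so are any two `b`-curves. -/
structure IsTriangular : Prop where
  transverse : ∀ i j s t, ((C.a i).curve s).Transverse ((C.b j).curve t)
  fills : C.Fills
  ab_zero : ∀ i j, i < j → (C.a i).I (C.b j) = 0
  aa_zero : ∀ i j, i < j → (C.a i).I (C.a j) = 0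
  bb_zero : ∀ i j, i < j → (C.b i).I (C.b j) = 0
  ab_pos : ∀ i, 0 < (C.a i).I (C.b i)

/-- The collection is orientable: the curves can be oriented (`εa`, `εb` say whether to keep or to
reverse the given orientations) such that all intersection points have the same sign. The
common sign may be taken positive, since one can reverse all the `a`-curves. -/
def IsOrientable : Prop :=
  ∃ (εa : (i : Fin k) → Fin (C.a i).size → ℤˣ) (εb : (j : Fin k) → Fin (C.b j).size → ℤˣ),
    ∀ i s j t, ∀ x y : ℝ, ((C.a i).curve s).toFun x = ((C.b j).curve t).toFun y →
      0 < ((εa i s : ℤ) : ℝ) * ((εb j t : ℤ) : ℝ) *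
        ((C.a i).curve s).crossingDet ((C.b j).curve t) x y

/-- `R` is an `m`-prong region, i.e. a polygon with `2 * m` sides and `2 * m` corners: there is a
continuous map of the closed disk to the sphere that maps the open disk bijectively to `R` and the
boundary circle into the curves, and exactly `2 * m` points of the circle (the corners of the
polygon) go to crossings. A crossing where `R` has several corners is counted as often. -/
def IsProngRegion (R : Set E3) (m : ℕ) : Prop :=
  1 ≤ m ∧ ∃ f : ℂ → E3,
    ContinuousOn f (Metric.closedBall 0 1) ∧
    Set.InjOn f (Metric.ball 0 1) ∧
    f '' Metric.ball 0 1 = R ∧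
    f '' Metric.sphere 0 1 ⊆ C.unionA ∪ C.unionB ∧
    {z : ℂ | z ∈ Metric.sphere (0 : ℂ) 1 ∧ f z ∈ C.crossings}.encard = ((2 * m : ℕ) : ℕ∞)

/-- There are finitely many regions, and `L` is the unordered list of their numbers of prongs
(with all the `2`s). -/
def HasProngs (L : Multiset ℕ) : Prop :=
  ∃ (F : Finset (Set E3)) (prong : Set E3 → ℕ),
    (F : Set (Set E3)) = C.regions ∧ (∀ R ∈ F, C.IsProngRegion R (prong R)) ∧
      F.val.map prong = L

/-- The signature of the collection is `(R, s)`: `R` is the unordered list of the numbers of prongs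
of the regions with the `2`s omitted, and `s` is `plus` exactly for orientable collections. -/
def HasSignature (R : Multiset ℕ) (s : SignatureSign) : Prop :=
  (∃ L, C.HasProngs L ∧ L.filter (fun m => m ≠ 2) = R) ∧
    (C.IsOrientable ↔ s = SignatureSign.plus)

/-- A triangular collection on the sphere is optimal: with the genus `g = 0` and the number `n_odd`
of odd regions, `k = g - 1 + n_odd / 2` if the collection is nonorientable, and
`k = g + n_odd / 2` if it is orientable. -/
def IsOptimal : Prop :=
  ∃ L, C.HasProngs L ∧
    (¬ C.IsOrientable → (k : ℚ) = 0 - 1 + (L.countP (fun m => Odd m) : ℚ) / 2) ∧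
    (C.IsOrientable → (k : ℚ) = 0 + (L.countP (fun m => Odd m) : ℚ) / 2)

end PairCollection

/-! The collection is an explicit arrangement of round circles. A chain of caps `0, ..., N` runs
along a meridian from the south pole to the north pole, only neighbouring caps overlapping; circles
of latitude pass through the centres of chosen caps, the caps `0` and `N` among them. The lenses,
the southern half of cap `0`, the northern half of cap `N` and the two polar bands are 1-prong
regions, `N + 4` in all. The other pieces of caps are 2-prong. The band between consecutive circles
of latitude whose caps are `d` places apart has `d + 2` prongs. If the entries of `R` other than `1`
are the numbers `d + 2`, the curvature condition says precisely that `R` contains `∑ d + 4` ones, so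
the chain with these `d` as gaps and `N = ∑ d` has prong list `R` up to 2's (`exists_widths`,
`prongs_eq`).

Crossing curves form a tree: a path of caps with one circle of latitude hanging from each chosen
cap. Hence the curves split into types `a` and `b`. The path is cut into groups of one or two
consecutive caps, each circle of latitude joining the group of its cap, such that every group
contains a crossing. Consecutive groups are joined by one pair of neighbouring caps. The index of
the next group can therefore be put above or below that of the previous group, depending on which of
the two caps has type `a`; this gives triangularity (`disjoint_of_height_lt`, `isTriangular_coll`).
There are `∑ ⌈d / 2⌉ + 1` groups, which equals `n_odd / 2 - 1` by `two_mul_sum_half_succ`. All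
circles are symmetric under `y ↦ -y`, and the two points where a pair of circles crosses are
exchanged by this reflection with opposite signs, so the collection is nonorientable
(`not_isOrientable_coll`).

The topological input is that each region is an open disk with a closed disk as closure
(`Ladder.exists_disk_param`). All circles lie in planes perpendicular to the plane `y = 0`, so a
region is given by affine inequalities in the other two coordinates. It meets the great circle `y =
0` in one arc. A projective automorphism of the sphere moves this arc to a half circle; the two
halves `y ≥ 0` and `y ≤ 0` of the region, unfolded along the arc, then form a convex planar set
(`exists_disk_param_standard`). Corners are counted as the crossings at which the signs of all
remaining curves agree with those of the region (`encard_crossings`). -/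

theorem sqrt_one_sub_sq_concave {x y a b : ℝ} (hx : x ^ 2 ≤ 1) (hy : y ^ 2 ≤ 1) (ha : 0 ≤ a)
    (hb : 0 ≤ b) (hab : a + b = 1) :
    a * √(1 - x ^ 2) + b * √(1 - y ^ 2) ≤ √(1 - (a * x + b * y) ^ 2) := by
  apply Real.le_sqrt_of_sq_le
  have h1 : √(1 - x ^ 2) ^ 2 = 1 - x ^ 2 := Real.sq_sqrt (by linarith)
  have h2 : √(1 - y ^ 2) ^ 2 = 1 - y ^ 2 := Real.sq_sqrt (by linarith)
  have hb' : b = 1 - a := by linarith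
  -- Cauchy–Schwarz for the unit vectors `(x, √(1 - x ^ 2))` and `(y, √(1 - y ^ 2))`.
  have h3 : √(1 - x ^ 2) * √(1 - y ^ 2) + x * y ≤ 1 := by
    nlinarith [sq_nonneg (√(1 - x ^ 2) - √(1 - y ^ 2)), sq_nonneg (x - y)]
  have h4 := mul_le_mul_of_nonneg_left h3 (mul_nonneg ha hb)
  have h5 : (a + b) ^ 2 = 1 := by rw [hab]; norm_num
  have e : (a * √(1 - x ^ 2) + b * √(1 - y ^ 2)) ^ 2
      = a ^ 2 * √(1 - x ^ 2) ^ 2 + b ^ 2 * √(1 - y ^ 2) ^ 2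
        + 2 * (a * b * (√(1 - x ^ 2) * √(1 - y ^ 2))) := by ring
  rw [e, h1, h2]
  nlinarith

/-! ### Cells in standard position, unfolded to convex planar sets -/

section StandardCell

variable {ι : Type*} (α β γ : ι → ℝ)

/-- The functional `α σ + β M + γ` at the point of the unit disk that lies `|z.im|` below the
upper half circle, over `σ = z.re`. -/
noncomputable def depthFun (j : ι) (z : ℂ) : ℝ :=
  α j * z.re + β j * (√(1 - z.re ^ 2) - |z.im|) + γ j

/-- The planar model of a closed cell. -/
def closedModel : Set ℂ :=
  {z | z.re ^ 2 ≤ 1 ∧ |z.im| ≤ 2 * √(1 - z.re ^ 2) ∧ ∀ j, 0 ≤ depthFun α β γ j z}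

/-- The planar model of an open cell. -/
def openModel : Set ℂ :=
  {z | z.re ^ 2 < 1 ∧ |z.im| < 2 * √(1 - z.re ^ 2) ∧ ∀ j, 0 < depthFun α β γ j z}

theorem continuous_depthFun (j : ι) : Continuous (depthFun α β γ j) := by
  unfold depthFun
  fun_prop

theorem isClosed_closedModel : IsClosed (closedModel α β γ) := by
  have h : closedModel α β γ = {z : ℂ | z.re ^ 2 ≤ 1} ∩ ({z : ℂ | |z.im| ≤ 2 * √(1 - z.re ^ 2)} ∩
      ⋂ j, {z | 0 ≤ depthFun α β γ j z}) := by
    ext z; simp [closedModel]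
  rw [h]
  refine (isClosed_le (by fun_prop) (by fun_prop)).inter
    ((isClosed_le (by fun_prop) (by fun_prop)).inter (isClosed_iInter fun j => ?_))
  exact isClosed_le continuous_const (continuous_depthFun α β γ j)

theorem isOpen_openModel [Finite ι] : IsOpen (openModel α β γ) := by
  have h : openModel α β γ = {z : ℂ | z.re ^ 2 < 1} ∩ ({z : ℂ | |z.im| < 2 * √(1 - z.re ^ 2)} ∩
      ⋂ j, {z | 0 < depthFun α β γ j z}) := by
    ext z; simp [openModel]
  rw [h]
  refine (isOpen_lt (by fun_prop) (by fun_prop)).inter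
    ((isOpen_lt (by fun_prop) (by fun_prop)).inter (isOpen_iInter_of_finite fun j => ?_))
  exact isOpen_lt continuous_const (continuous_depthFun α β γ j)

theorem openModel_subset : openModel α β γ ⊆ closedModel α β γ :=
  fun _ hz => ⟨hz.1.le, hz.2.1.le, fun j => (hz.2.2 j).le⟩

variable {α β γ}

/-- `√(1 - x ^ 2)` and `-|z.im|` are concave, so for `β j ≥ 0` every defining inequality is a lower
bound on a concave function; strictness at one endpoint with positive weight suffices. Convexity and
the computation of the closure both follow. -/
theorem combo_mem_openModel (hβ : ∀ j, 0 ≤ β j) {z w : ℂ} (hz : z ∈ closedModel α β γ)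
    (hw : w ∈ openModel α β γ) {a b : ℝ} (ha : 0 ≤ a) (hb : 0 < b) (hab : a + b = 1) :
    a • z + b • w ∈ openModel α β γ := by
  obtain ⟨z1, z2, z3⟩ := hz
  obtain ⟨w1, w2, w3⟩ := hw
  have hre : (a • z + b • w).re = a * z.re + b * w.re := by simp
  have him : (a • z + b • w).im = a * z.im + b * w.im := by simp
  have hk := sqrt_one_sub_sq_concave z1 w1.le ha hb.le hab
  have hi : |a * z.im + b * w.im| ≤ a * |z.im| + b * |w.im| := by
    refine (abs_add_le _ _).trans ?_
    rw [abs_mul, abs_mul, abs_of_nonneg ha, abs_of_pos hb]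
  refine ⟨?_, ?_, fun j => ?_⟩
  · rw [hre]
    have h1 := (sq_le_one_iff_abs_le_one z.re).1 z1
    have h2 := (sq_lt_one_iff_abs_lt_one w.re).1 w1
    have h3 : |a * z.re + b * w.re| < 1 := by
      refine (abs_add_le _ _).trans_lt ?_
      rw [abs_mul, abs_mul, abs_of_nonneg ha, abs_of_pos hb]
      nlinarith
    exact (sq_lt_one_iff_abs_lt_one _).2 h3
  · rw [hre, him]
    nlinarith [mul_le_mul_of_nonneg_left z2 ha, mul_lt_mul_of_pos_left w2 hb]
  · unfold depthFun
    rw [hre, him]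
    have h1 := mul_le_mul_of_nonneg_left
      (sub_le_sub hk hi) (hβ j)
    have h2 := mul_nonneg ha (z3 j)
    have h3 := mul_pos hb (w3 j)
    unfold depthFun at h2 h3
    have h4 : γ j = a * γ j + b * γ j := by rw [← add_mul, hab, one_mul]
    nlinarith

theorem convex_openModel (hβ : ∀ j, 0 ≤ β j) : Convex ℝ (openModel α β γ) := by
  intro z hz w hw a b ha hb hab
  rcases hb.eq_or_lt with rfl | hb
  · have : a = 1 := by linarith
    simpa [this] using hz
  · exact combo_mem_openModel hβ (openModel_subset _ _ _ hz) hw ha hb hab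

theorem closure_openModel (hβ : ∀ j, 0 ≤ β j) (hne : (openModel α β γ).Nonempty) :
    closure (openModel α β γ) = closedModel α β γ := by
  refine (closure_minimal (openModel_subset _ _ _) (isClosed_closedModel _ _ _)).antisymm ?_
  intro z hz
  obtain ⟨w, hw⟩ := hne
  have h : openSegment ℝ z w ⊆ openModel α β γ := by
    rintro _ ⟨a, b, ha, hb, hab, rfl⟩
    exact combo_mem_openModel hβ hz hw ha.le hb hab
  exact closure_mono h (segment_subset_closure_openSegment (left_mem_segment ℝ z w))

theorem isBounded_closedModel : Bornology.IsBounded (closedModel α β γ) := by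
  refine (Metric.isBounded_closedBall (x := (0 : ℂ)) (r := 3)).subset fun z hz => ?_
  rw [mem_closedBall_zero_iff]
  have h1 := abs_le_one_iff_mul_self_le_one.2 (by nlinarith [hz.1] : z.re * z.re ≤ 1)
  have h2 : √(1 - z.re ^ 2) ≤ 1 := by
    exact Real.sqrt_le_iff.2 ⟨by norm_num, by nlinarith [sq_nonneg z.re]⟩
  have h3 := hz.2.1
  have h4 := Complex.norm_le_abs_re_add_abs_im z
  linarith

/-- The second coordinate of the point of the sphere over a point of the planar model. -/
noncomputable def liftHeight (z : ℂ) : ℝ :=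
  √(max z.im 0 * (2 * √(1 - z.re ^ 2) - z.im)) - √(max (-z.im) 0 * (2 * √(1 - z.re ^ 2) + z.im))

/-- The folding map from the planar model to the sphere. -/
noncomputable def foldMap (z : ℂ) : ℝ × ℝ × ℝ :=
  (z.re, liftHeight z, √(1 - z.re ^ 2) - |z.im|)

theorem continuous_foldMap : Continuous foldMap := by
  unfold foldMap liftHeight
  fun_prop

theorem liftHeight_of_nonneg {z : ℂ} (h : 0 ≤ z.im) :
    liftHeight z = √(|z.im| * (2 * √(1 - z.re ^ 2) - |z.im|)) := by
  simp [liftHeight, h, abs_of_nonneg h]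

theorem liftHeight_of_nonpos {z : ℂ} (h : z.im ≤ 0) :
    liftHeight z = -√(|z.im| * (2 * √(1 - z.re ^ 2) - |z.im|)) := by
  simp [liftHeight, h, abs_of_nonpos h]

/-- With `M = √(1 - σ ^ 2) - |z.im|`, the right side is `1 - σ ^ 2 - M ^ 2`, the square of the
missing coordinate; the sign of `z.im` selects the hemisphere. -/
theorem liftHeight_sq {z : ℂ} (h : |z.im| ≤ 2 * √(1 - z.re ^ 2)) :
    liftHeight z ^ 2 = |z.im| * (2 * √(1 - z.re ^ 2) - |z.im|) := by
  have h0 : 0 ≤ |z.im| * (2 * √(1 - z.re ^ 2) - |z.im|) :=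
    mul_nonneg (abs_nonneg _) (by linarith)
  rcases le_total 0 z.im with h1 | h1
  · rw [liftHeight_of_nonneg h1, Real.sq_sqrt h0]
  · rw [liftHeight_of_nonpos h1, neg_sq, Real.sq_sqrt h0]

theorem foldMap_mem_sphere {z : ℂ} (h1 : z.re ^ 2 ≤ 1) (h : |z.im| ≤ 2 * √(1 - z.re ^ 2)) :
    (foldMap z).1 ^ 2 + (foldMap z).2.1 ^ 2 + (foldMap z).2.2 ^ 2 = 1 := by
  simp only [foldMap]
  rw [liftHeight_sq h]
  have := Real.sq_sqrt (by linarith : 0 ≤ 1 - z.re ^ 2)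
  nlinarith

/-- Every point of the sphere is in the image of the folding map. -/
theorem exists_foldMap_eq {σ y M : ℝ} (h : σ ^ 2 + y ^ 2 + M ^ 2 = 1) :
    ∃ z : ℂ, foldMap z = (σ, y, M) ∧ z.re = σ ∧ |z.im| = √(1 - σ ^ 2) - M ∧
      |z.im| ≤ 2 * √(1 - σ ^ 2) := by
  have hk : |M| ≤ √(1 - σ ^ 2) := Real.abs_le_sqrt (by nlinarith [sq_nonneg y])
  have hk2 := abs_le.1 hk
  have hs := Real.sq_sqrt (by nlinarith [sq_nonneg y, sq_nonneg M] : 0 ≤ 1 - σ ^ 2)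
  have e : (√(1 - σ ^ 2) - M) * (2 * √(1 - σ ^ 2) - (√(1 - σ ^ 2) - M)) = y ^ 2 := by nlinarith
  rcases le_total 0 y with hy | hy
  · have ha : |√(1 - σ ^ 2) - M| = √(1 - σ ^ 2) - M := abs_of_nonneg (by linarith)
    refine ⟨⟨σ, √(1 - σ ^ 2) - M⟩, ?_, rfl, ha, ?_⟩
    · have := liftHeight_of_nonneg (z := ⟨σ, √(1 - σ ^ 2) - M⟩) (by simp; linarith)
      simp only [foldMap, this, ha, e, Real.sqrt_sq hy]
      simp
    · simp only [ha]; linarith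
  · have ha : |-(√(1 - σ ^ 2) - M)| = √(1 - σ ^ 2) - M := by
      rw [abs_neg]; exact abs_of_nonneg (by linarith)
    refine ⟨⟨σ, -(√(1 - σ ^ 2) - M)⟩, ?_, rfl, ha, ?_⟩
    · have := liftHeight_of_nonpos (z := ⟨σ, -(√(1 - σ ^ 2) - M)⟩) (by simp; linarith)
      simp only [foldMap, this, ha, e, Real.sqrt_sq_eq_abs, abs_of_nonpos hy]
      simp
    · simp only [ha]; linarith

/-- On the lower half circle `harc` leaves only the points `σ = ±1`, `M = 0`. There strict
inequalities would persist after a small move along the circle to `M < 0`, against `harc`. -/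
theorem openModel_of_strict [Finite ι]
    (harc : ∀ σ M, σ ^ 2 + M ^ 2 = 1 → (∀ j, 0 ≤ α j * σ + β j * M + γ j) → 0 ≤ M)
    {σ M : ℝ} (h1 : σ ^ 2 ≤ 1) (hM : -√(1 - σ ^ 2) ≤ M)
    (h : ∀ j, 0 < α j * σ + β j * M + γ j) : -√(1 - σ ^ 2) < M := by
  rcases hM.lt_or_eq with h2 | h2
  · exact h2
  exfalso
  have hs := Real.sq_sqrt (by linarith : 0 ≤ 1 - σ ^ 2)
  have h3 : 0 ≤ M := harc σ M (by rw [← h2]; nlinarith) fun j => (h j).le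
  have h4 : M = 0 := by linarith [Real.sqrt_nonneg (1 - σ ^ 2)]
  have h5 : σ ^ 2 = 1 := by
    have : √(1 - σ ^ 2) = 0 := by linarith
    rw [this] at hs; linarith
  subst h4
  have h6 : ∀ᶠ e in nhds (0 : ℝ), ∀ j, 0 < α j * (σ * Real.cos e) + β j * (-Real.sin e) + γ j := by
    rw [Filter.eventually_all]
    intro j
    have hc : Continuous fun e : ℝ => α j * (σ * Real.cos e) + β j * (-Real.sin e) + γ j := by
      fun_prop
    exact hc.continuousAt.eventually (eventually_gt_nhds (by simpa using h j))
  have h7 := (h6.filter_mono (nhdsWithin_le_nhds (s := Set.Ioi 0))).and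
    (Ioo_mem_nhdsGT Real.pi_pos)
  obtain ⟨e, he, he2⟩ := h7.exists
  have h8 := harc (σ * Real.cos e) (-Real.sin e)
    (by nlinarith [Real.sin_sq_add_cos_sq e]) fun j => (he j).le
  have := Real.sin_pos_of_mem_Ioo he2
  linarith

/-- Folding can only lose the sign of `z.im`, and only where the second coordinate vanishes: on the
fold `z.im = 0`, which is harmless, or on the lower half circle, where `harc` forces `√(1 - z.re ^
2) = 0` and hence `z.im = 0`. -/
theorem injOn_foldMap
    (harc : ∀ σ M, σ ^ 2 + M ^ 2 = 1 → (∀ j, 0 ≤ α j * σ + β j * M + γ j) → 0 ≤ M) :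
    Set.InjOn foldMap (closedModel α β γ) := by
  rintro z hz w hw h
  simp only [foldMap, Prod.mk.injEq] at h
  obtain ⟨h1, h2, h3⟩ := h
  rw [← h1] at h3
  have h4 : |z.im| = |w.im| := by linarith
  refine Complex.ext h1 ?_
  by_contra hne
  have h5 : z.im = -w.im := (abs_eq_abs.1 h4).resolve_left hne
  have h6 : |z.im| * (2 * √(1 - z.re ^ 2) - |z.im|) = 0 := by
    have h0 : 0 ≤ |z.im| * (2 * √(1 - z.re ^ 2) - |z.im|) :=
      mul_nonneg (abs_nonneg _) (by linarith [hz.2.1])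
    rcases le_total 0 z.im with hi | hi
    · rw [liftHeight_of_nonneg hi, liftHeight_of_nonpos (by linarith : w.im ≤ 0), ← h1, ← h4] at h2
      exact (Real.sqrt_eq_zero h0).1 (by linarith [Real.sqrt_nonneg (|z.im| * (2 * √(1 - z.re ^ 2) - |z.im|))])
    · rw [liftHeight_of_nonpos hi, liftHeight_of_nonneg (by linarith : 0 ≤ w.im), ← h1, ← h4] at h2
      exact (Real.sqrt_eq_zero h0).1 (by linarith [Real.sqrt_nonneg (|z.im| * (2 * √(1 - z.re ^ 2) - |z.im|))])
  have h7 : |z.im| = 0 := by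
    rcases mul_eq_zero.1 h6 with h7 | h7
    · exact h7
    have hs := Real.sq_sqrt (by linarith [hz.1] : 0 ≤ 1 - z.re ^ 2)
    have := harc z.re (√(1 - z.re ^ 2) - |z.im|) (by nlinarith) hz.2.2
    linarith [abs_nonneg z.im, Real.sqrt_nonneg (1 - z.re ^ 2)]
  have h8 := abs_eq_zero.1 h7
  apply hne
  rw [h8] at h5 ⊢
  linarith

/-- A closed cell of the sphere that meets the great circle `y = 0` only in the upper half circle,
and whose functionals increase in the `M`-direction, is a closed disk. -/
theorem exists_disk_param_standard [Finite ι] (hβ : ∀ j, 0 ≤ β j)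
    (harc : ∀ σ M, σ ^ 2 + M ^ 2 = 1 → (∀ j, 0 ≤ α j * σ + β j * M + γ j) → 0 ≤ M)
    (hne : ∃ σ y M, σ ^ 2 + y ^ 2 + M ^ 2 = 1 ∧ ∀ j, 0 < α j * σ + β j * M + γ j) :
    ∃ f : ℂ → ℝ × ℝ × ℝ, Continuous f ∧ Set.InjOn f (Metric.closedBall 0 1) ∧
      f '' Metric.closedBall 0 1 = {p | p.1 ^ 2 + p.2.1 ^ 2 + p.2.2 ^ 2 = 1 ∧
        ∀ j, 0 ≤ α j * p.1 + β j * p.2.2 + γ j} ∧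
      f '' Metric.ball 0 1 = {p | p.1 ^ 2 + p.2.1 ^ 2 + p.2.2 ^ 2 = 1 ∧
        ∀ j, 0 < α j * p.1 + β j * p.2.2 + γ j} := by
  have himC : foldMap '' closedModel α β γ = {p | p.1 ^ 2 + p.2.1 ^ 2 + p.2.2 ^ 2 = 1 ∧
        ∀ j, 0 ≤ α j * p.1 + β j * p.2.2 + γ j} := by
    ext ⟨σ, y, M⟩
    constructor
    · rintro ⟨z, hz, h⟩
      rw [← h]
      exact ⟨foldMap_mem_sphere hz.1 hz.2.1, hz.2.2⟩
    · rintro ⟨h1, h2⟩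
      obtain ⟨z, hz, rfl, h3, h4⟩ := exists_foldMap_eq h1
      refine ⟨z, ⟨by simp only at h1; nlinarith [sq_nonneg y, sq_nonneg M], h4, fun j => ?_⟩, hz⟩
      have := h2 j
      simp only [depthFun, h3, sub_sub_cancel]
      exact this
  have himO : foldMap '' openModel α β γ = {p | p.1 ^ 2 + p.2.1 ^ 2 + p.2.2 ^ 2 = 1 ∧
        ∀ j, 0 < α j * p.1 + β j * p.2.2 + γ j} := by
    ext ⟨σ, y, M⟩
    constructor
    · rintro ⟨z, hz, h⟩
      rw [← h]
      exact ⟨foldMap_mem_sphere hz.1.le hz.2.1.le, hz.2.2⟩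
    · rintro ⟨h1, h2⟩
      obtain ⟨z, hz, rfl, h3, h4⟩ := exists_foldMap_eq h1
      simp only at h1 h2
      have h5 : z.re ^ 2 ≤ 1 := by nlinarith [sq_nonneg y, sq_nonneg M]
      have h6 := openModel_of_strict harc h5 (by linarith) h2
      refine ⟨z, ⟨?_, by linarith, fun j => ?_⟩, hz⟩
      · refine lt_of_le_of_ne h5 fun h7 => ?_
        rw [h7, sub_self, Real.sqrt_zero] at h6 h3
        linarith [abs_nonneg z.im]
      · simp only [depthFun, h3, sub_sub_cancel]
        exact h2 j
  have hneO : (openModel α β γ).Nonempty := by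
    obtain ⟨σ, y, M, h1, h2⟩ := hne
    have : ((σ, y, M) : ℝ × ℝ × ℝ) ∈ foldMap '' openModel α β γ := by rw [himO]; exact ⟨h1, h2⟩
    exact this.imp fun _ h => h.1
  have hcl := closure_openModel hβ hneO
  have hint := (isOpen_openModel α β γ).interior_eq
  obtain ⟨h, hh1, hh2, -⟩ := exists_homeomorph_image_interior_closure_frontier_eq_unitBall
    (convex_openModel hβ) (by rwa [hint])
    (isBounded_closedModel.subset (openModel_subset α β γ))
  rw [hint] at hh1
  rw [hcl] at hh2
  have e1 : h.symm '' Metric.ball 0 1 = openModel α β γ := by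
    rw [← hh1, ← Set.image_comp]; simp
  have e2 : h.symm '' Metric.closedBall 0 1 = closedModel α β γ := by
    rw [← hh2, ← Set.image_comp]; simp
  refine ⟨foldMap ∘ h.symm, continuous_foldMap.comp h.symm.continuous, ?_, ?_, ?_⟩
  · refine (injOn_foldMap harc).comp h.symm.injective.injOn ?_
    rw [← e2]; exact Set.mapsTo_image _ _
  · rw [Set.image_comp, e2, himC]
  · rw [Set.image_comp, e1, himO]

end StandardCell

/-! ### Moving an arc of the great circle to standard position -/

theorem mem_twoSphere_iff (p : E3) : p ∈ twoSphere ↔ p 0 ^ 2 + p 1 ^ 2 + p 2 ^ 2 = 1 := by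
  unfold twoSphere
  rw [mem_sphere_zero_iff_norm, EuclideanSpace.norm_eq, Real.sqrt_eq_one, Fin.sum_univ_three]
  simp [sq_abs]

theorem E3_ext {p q : E3} (h0 : p 0 = q 0) (h1 : p 1 = q 1) (h2 : p 2 = q 2) : p = q := by
  ext i
  fin_cases i <;> assumption

/-- The map from the standard frame to the frame of the arc with centre `φ` and half-angle `ψ`:
a rotation after a projective automorphism of the sphere. -/
noncomputable def boost (φ ψ : ℝ) (q : ℝ × ℝ × ℝ) : E3 :=
  !₂[((q.2.2 + Real.cos ψ) * Real.sin φ + Real.sin ψ * q.1 * Real.cos φ) /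
      (1 + Real.cos ψ * q.2.2),
    Real.sin ψ * q.2.1 / (1 + Real.cos ψ * q.2.2),
    (-(q.2.2 + Real.cos ψ) * Real.cos φ + Real.sin ψ * q.1 * Real.sin φ) /
      (1 + Real.cos ψ * q.2.2)]

section Boost

variable {φ ψ : ℝ}

theorem abs_cos_lt_one (h0 : 0 < ψ) (h1 : ψ < Real.pi) : |Real.cos ψ| < 1 := by
  have := Real.sin_pos_of_pos_of_lt_pi h0 h1
  rw [← sq_lt_one_iff_abs_lt_one]
  nlinarith [Real.sin_sq_add_cos_sq ψ]

theorem one_add_mul_pos {c M : ℝ} (hc : |c| < 1) (hM : M ^ 2 ≤ 1) : 0 < 1 + c * M := by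
  have h1 := (sq_le_one_iff_abs_le_one M).1 hM
  have h2 : |c * M| < 1 := by
    rw [abs_mul]
    nlinarith [abs_nonneg c, abs_nonneg M]
  linarith [neg_abs_le (c * M)]

/-- Affine functionals in the first and last coordinates pull back to affine functionals divided by
a common denominator, positive on the sphere when `0 < ψ < π`. The new coefficient of `M` is the
homogenized functional at the pole of the arc, so the pole condition turns into monotonicity in `M`.
-/
theorem boost_eval (A B G : ℝ) (q : ℝ × ℝ × ℝ) (hw : 1 + Real.cos ψ * q.2.2 ≠ 0) :
    A * boost φ ψ q 0 + B * boost φ ψ q 2 + G =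
      ((A * Real.cos φ + B * Real.sin φ) * Real.sin ψ * q.1 +
        (A * Real.sin φ - B * Real.cos φ + Real.cos ψ * G) * q.2.2 +
        ((A * Real.sin φ - B * Real.cos φ) * Real.cos ψ + G)) / (1 + Real.cos ψ * q.2.2) := by
  simp only [boost]
  simp
  generalize hwd : 1 + Real.cos ψ * q.2.2 = w at *
  field_simp
  rw [← hwd]
  ring

theorem boost_mem_twoSphere {q : ℝ × ℝ × ℝ} (hw : 1 + Real.cos ψ * q.2.2 ≠ 0)
    (hq : q.1 ^ 2 + q.2.1 ^ 2 + q.2.2 ^ 2 = 1) : boost φ ψ q ∈ twoSphere := by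
  rw [mem_twoSphere_iff]
  simp only [boost]
  simp
  generalize hwd : 1 + Real.cos ψ * q.2.2 = w at *
  field_simp
  rw [← hwd]
  have h1 := Real.sin_sq_add_cos_sq φ
  have h2 := Real.sin_sq_add_cos_sq ψ
  have h3 : q.1 ^ 2 = 1 - q.2.1 ^ 2 - q.2.2 ^ 2 := by linarith
  have h4 : Real.sin φ ^ 2 = 1 - Real.cos φ ^ 2 := by linarith
  have h5 : Real.sin ψ ^ 2 = 1 - Real.cos ψ ^ 2 := by linarith
  ring_nf
  rw [h3, h4, h5]
  ring

theorem boost_injOn (h0 : 0 < ψ) (h1 : ψ < Real.pi) :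
    Set.InjOn (boost φ ψ) {q | q.1 ^ 2 + q.2.1 ^ 2 + q.2.2 ^ 2 = 1} := by
  rintro ⟨σ, y, M⟩ hq ⟨σ', y', M'⟩ hq' h
  simp only [Set.mem_ofPred_eq] at hq hq'
  have hc := abs_cos_lt_one h0 h1
  have hs := Real.sin_pos_of_pos_of_lt_pi h0 h1
  have hw := one_add_mul_pos hc (by nlinarith [sq_nonneg σ, sq_nonneg y] : M ^ 2 ≤ 1)
  have hw' := one_add_mul_pos hc (by nlinarith [sq_nonneg σ', sq_nonneg y'] : M' ^ 2 ≤ 1)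
  have e1 := Real.sin_sq_add_cos_sq φ
  have e2 := Real.sin_sq_add_cos_sq ψ
  -- The coordinate along the centre of the arc is a Möbius function of `M` with determinant `sin ψ
  -- ^ 2`, so it determines `M`.
  have hd : (M + Real.cos ψ) / (1 + Real.cos ψ * M) = (M' + Real.cos ψ) / (1 + Real.cos ψ * M') := by
    have a1 := boost_eval (φ := φ) (ψ := ψ) (Real.sin φ) (-Real.cos φ) 0 (σ, y, M) hw.ne'
    have a2 := boost_eval (φ := φ) (ψ := ψ) (Real.sin φ) (-Real.cos φ) 0 (σ', y', M') hw'.ne'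
    rw [h, a2] at a1
    have e3 : Real.sin φ * Real.sin φ - -Real.cos φ * Real.cos φ = 1 := by linarith
    simp only [e3] at a1
    ring_nf at a1 ⊢
    exact a1.symm
  have he : Real.sin ψ * σ / (1 + Real.cos ψ * M) = Real.sin ψ * σ' / (1 + Real.cos ψ * M') := by
    have a1 := boost_eval (φ := φ) (ψ := ψ) (Real.cos φ) (Real.sin φ) 0 (σ, y, M) hw.ne'
    have a2 := boost_eval (φ := φ) (ψ := ψ) (Real.cos φ) (Real.sin φ) 0 (σ', y', M') hw'.ne'
    rw [h, a2] at a1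
    have e3 : Real.cos φ * Real.cos φ + Real.sin φ * Real.sin φ = 1 := by linarith
    have e4 : Real.cos φ * Real.sin φ - Real.sin φ * Real.cos φ = 0 := by ring
    simp only [e3, e4] at a1
    ring_nf at a1 ⊢
    exact a1.symm
  have hy : Real.sin ψ * y / (1 + Real.cos ψ * M) = Real.sin ψ * y' / (1 + Real.cos ψ * M') := by
    have := congrArg (fun p : E3 => p 1) h
    simpa [boost] using this
  have hM : M = M' := by
    rw [div_eq_div_iff hw.ne' hw'.ne'] at hd
    have : Real.sin ψ ^ 2 * (M - M') = 0 := by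
      have : Real.sin ψ ^ 2 = 1 - Real.cos ψ ^ 2 := by linarith
      rw [this]; linarith
    rcases mul_eq_zero.1 this with h' | h'
    · exact absurd h' (by positivity)
    · linarith
  subst hM
  rw [div_left_inj' hw.ne'] at he hy
  simp only [Prod.mk.injEq, and_true]
  exact ⟨mul_left_cancel₀ hs.ne' he, mul_left_cancel₀ hs.ne' hy⟩

theorem exists_boost_eq (h0 : 0 < ψ) (h1 : ψ < Real.pi) {p : E3} (hp : p ∈ twoSphere) :
    ∃ q : ℝ × ℝ × ℝ, q.1 ^ 2 + q.2.1 ^ 2 + q.2.2 ^ 2 = 1 ∧ boost φ ψ q = p := by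
  rw [mem_twoSphere_iff] at hp
  have hc := abs_cos_lt_one h0 h1
  have hs := Real.sin_pos_of_pos_of_lt_pi h0 h1
  set d := Real.sin φ * p 0 - Real.cos φ * p 2 with hd
  set e := Real.cos φ * p 0 + Real.sin φ * p 2 with he
  have e1 := Real.sin_sq_add_cos_sq φ
  have e2 : Real.sin ψ ^ 2 = 1 - Real.cos ψ ^ 2 := by linarith [Real.sin_sq_add_cos_sq ψ]
  have hde : d ^ 2 + e ^ 2 + p 1 ^ 2 = 1 := by
    rw [hd, he, ← hp]
    have : Real.sin φ ^ 2 = 1 - Real.cos φ ^ 2 := by linarith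
    ring_nf; rw [this]; ring
  have hw : 0 < 1 - Real.cos ψ * d := by
    have := one_add_mul_pos (c := -Real.cos ψ) (by rwa [abs_neg])
      (by nlinarith [sq_nonneg e, sq_nonneg (p 1)] : d ^ 2 ≤ 1)
    linarith
  have hx : p 0 = d * Real.sin φ + e * Real.cos φ := by
    rw [hd, he]
    have : Real.sin φ ^ 2 = 1 - Real.cos φ ^ 2 := by linarith
    ring_nf; rw [this]; ring
  have hz : p 2 = -d * Real.cos φ + e * Real.sin φ := by
    rw [hd, he]
    have : Real.sin φ ^ 2 = 1 - Real.cos φ ^ 2 := by linarith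
    ring_nf; rw [this]; ring
  have hw2 : 1 + Real.cos ψ * ((d - Real.cos ψ) / (1 - Real.cos ψ * d)) =
      Real.sin ψ ^ 2 / (1 - Real.cos ψ * d) := by
    field_simp; rw [e2]; ring
  have hc2 : (d - Real.cos ψ) / (1 - Real.cos ψ * d) + Real.cos ψ =
      d * Real.sin ψ ^ 2 / (1 - Real.cos ψ * d) := by
    rw [eq_div_iff hw.ne', add_mul, div_mul_cancel₀ _ hw.ne', e2]; ring
  -- The inverse boost: rotate back to the frame `(d, e)` of the arc and replace `cos ψ` by `-cos
  -- ψ`.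
  refine ⟨(Real.sin ψ * e / (1 - Real.cos ψ * d), Real.sin ψ * p 1 / (1 - Real.cos ψ * d),
    (d - Real.cos ψ) / (1 - Real.cos ψ * d)), ?_, ?_⟩
  · simp only
    field_simp
    rw [e2]
    have : e ^ 2 = 1 - d ^ 2 - p 1 ^ 2 := by linarith
    rw [this]; ring
  · refine E3_ext ?_ ?_ ?_
    · simp only [boost, hw2, hc2]
      simp
      rw [hx]
      generalize 1 - Real.cos ψ * d = w at *
      field_simp
    · simp only [boost, hw2]
      simp
      field_simp
    · simp only [boost, hw2, hc2]
      simp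
      rw [hz]
      generalize 1 - Real.cos ψ * d = w at *
      field_simp

theorem continuousOn_boost (h0 : 0 < ψ) (h1 : ψ < Real.pi) :
    ContinuousOn (boost φ ψ) {q | q.1 ^ 2 + q.2.1 ^ 2 + q.2.2 ^ 2 = 1} := by
  have hw : ∀ q ∈ {q : ℝ × ℝ × ℝ | q.1 ^ 2 + q.2.1 ^ 2 + q.2.2 ^ 2 = 1},
      1 + Real.cos ψ * q.2.2 ≠ 0 := fun q hq =>
    (one_add_mul_pos (abs_cos_lt_one h0 h1)
      (by nlinarith [sq_nonneg q.1, sq_nonneg q.2.1, Set.mem_ofPred_eq ▸ hq])).ne'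
  refine (PiLp.continuous_toLp 2 _).comp_continuousOn (continuousOn_pi.2 fun i => ?_)
  fin_cases i
  · exact ContinuousOn.div (by fun_prop) (by fun_prop) hw
  · exact ContinuousOn.div (by fun_prop) (by fun_prop) hw
  · exact ContinuousOn.div (by fun_prop) (by fun_prop) hw

end Boost

/-- A closed cell of the sphere, cut out by planes perpendicular to the plane `y = 0`, is a closed
disk, provided that it meets the great circle `y = 0` only in an arc whose pole (the intersection
point of the tangents at the ends) lies in all the half-planes. -/
theorem exists_disk_param {ι : Type*} [Finite ι] (A B G : ι → ℝ) {φ ψ : ℝ} (h0 : 0 < ψ)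
    (h1 : ψ < Real.pi)
    (hpole : ∀ j, 0 ≤ A j * Real.sin φ - B j * Real.cos φ + Real.cos ψ * G j)
    (harc : ∀ p ∈ twoSphere, p 1 = 0 → (∀ j, 0 ≤ A j * p 0 + B j * p 2 + G j) →
      Real.cos ψ ≤ Real.sin φ * p 0 - Real.cos φ * p 2)
    (hne : ∃ p ∈ twoSphere, ∀ j, 0 < A j * p 0 + B j * p 2 + G j) :
    ∃ f : ℂ → E3, ContinuousOn f (Metric.closedBall 0 1) ∧ Set.InjOn f (Metric.closedBall 0 1) ∧
      f '' Metric.closedBall 0 1 = {p | p ∈ twoSphere ∧ ∀ j, 0 ≤ A j * p 0 + B j * p 2 + G j} ∧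
      f '' Metric.ball 0 1 = {p | p ∈ twoSphere ∧ ∀ j, 0 < A j * p 0 + B j * p 2 + G j} := by
  set S : Set (ℝ × ℝ × ℝ) := {q | q.1 ^ 2 + q.2.1 ^ 2 + q.2.2 ^ 2 = 1} with hS
  have hc := abs_cos_lt_one h0 h1
  have hs := Real.sin_pos_of_pos_of_lt_pi h0 h1
  have hw : ∀ q ∈ S, 0 < 1 + Real.cos ψ * q.2.2 := fun q hq =>
    one_add_mul_pos hc (by nlinarith [sq_nonneg q.1, sq_nonneg q.2.1, Set.mem_ofPred_eq ▸ hq])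
  set α : ι → ℝ := fun j => (A j * Real.cos φ + B j * Real.sin φ) * Real.sin ψ with hα
  set β : ι → ℝ := fun j => A j * Real.sin φ - B j * Real.cos φ + Real.cos ψ * G j with hβ
  set γ : ι → ℝ := fun j => (A j * Real.sin φ - B j * Real.cos φ) * Real.cos ψ + G j with hγ
  have hle : ∀ q ∈ S, ∀ j, 0 ≤ A j * boost φ ψ q 0 + B j * boost φ ψ q 2 + G j ↔
      0 ≤ α j * q.1 + β j * q.2.2 + γ j := fun q hq j => by
    rw [boost_eval _ _ _ _ (hw q hq).ne', le_div_iff₀ (hw q hq), zero_mul]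
  have hlt : ∀ q ∈ S, ∀ j, 0 < A j * boost φ ψ q 0 + B j * boost φ ψ q 2 + G j ↔
      0 < α j * q.1 + β j * q.2.2 + γ j := fun q hq j => by
    rw [boost_eval _ _ _ _ (hw q hq).ne', lt_div_iff₀ (hw q hq), zero_mul]
  obtain ⟨f, hf1, hf2, hf3, hf4⟩ := exists_disk_param_standard (α := α) (β := β) (γ := γ) hpole
    (by
      intro σ M hσ hj
      have hq : ((σ, 0, M) : ℝ × ℝ × ℝ) ∈ S := by simp [hS, hσ]
      have h2 := harc (boost φ ψ (σ, 0, M)) (boost_mem_twoSphere (hw _ hq).ne' hq)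
        (by simp [boost]) fun j => (hle _ hq j).2 (hj j)
      have h3 := boost_eval (φ := φ) (ψ := ψ) (Real.sin φ) (-Real.cos φ) 0 _ (hw _ hq).ne'
      have e3 : Real.sin φ * Real.sin φ - -Real.cos φ * Real.cos φ = 1 := by
        linarith [Real.sin_sq_add_cos_sq φ]
      have e4 : Real.sin φ * Real.cos φ + -Real.cos φ * Real.sin φ = 0 := by ring
      simp only [e3, e4, zero_mul, zero_add, mul_zero, add_zero, one_mul] at h3
      have h4 : Real.cos ψ ≤ (M + Real.cos ψ) / (1 + Real.cos ψ * M) := by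
        rw [← h3]; linarith
      rw [le_div_iff₀ (hw _ hq)] at h4
      -- Clearing denominators leaves `M * (1 - cos ψ ^ 2) ≥ 0`: lying in the arc means `M ≥ 0`
      -- after the change of frame.
      have h5 : 0 ≤ Real.sin ψ ^ 2 * M := by
        have : Real.sin ψ ^ 2 = 1 - Real.cos ψ ^ 2 := by linarith [Real.sin_sq_add_cos_sq ψ]
        rw [this]; linarith
      exact nonneg_of_mul_nonneg_right h5 (by positivity))
    (by
      obtain ⟨p, hp, hp2⟩ := hne
      obtain ⟨q, hq, rfl⟩ := exists_boost_eq (φ := φ) h0 h1 hp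
      exact ⟨q.1, q.2.1, q.2.2, hq, fun j => (hlt q hq j).1 (hp2 j)⟩)
  have hmaps : Set.MapsTo f (Metric.closedBall 0 1) S := by
    intro z hz
    have := hf3 ▸ Set.mem_image_of_mem f hz
    exact this.1
  refine ⟨boost φ ψ ∘ f, (continuousOn_boost h0 h1).comp hf1.continuousOn hmaps,
    (boost_injOn h0 h1).comp hf2 hmaps, ?_, ?_⟩
  · rw [Set.image_comp, hf3]
    ext p
    constructor
    · rintro ⟨q, ⟨hq, hq2⟩, rfl⟩
      exact ⟨boost_mem_twoSphere (hw q hq).ne' hq, fun j => (hle q hq j).2 (hq2 j)⟩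
    · rintro ⟨hp, hp2⟩
      obtain ⟨q, hq, rfl⟩ := exists_boost_eq (φ := φ) h0 h1 hp
      exact ⟨q, ⟨hq, fun j => (hle q hq j).1 (hp2 j)⟩, rfl⟩
  · rw [Set.image_comp, hf4]
    ext p
    constructor
    · rintro ⟨q, ⟨hq, hq2⟩, rfl⟩
      exact ⟨boost_mem_twoSphere (hw q hq).ne' hq, fun j => (hlt q hq j).2 (hq2 j)⟩
    · rintro ⟨hp, hp2⟩
      obtain ⟨q, hq, rfl⟩ := exists_boost_eq (φ := φ) h0 h1 hp
      exact ⟨q, ⟨hq, fun j => (hlt q hq j).1 (hp2 j)⟩, rfl⟩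

/-- The image of the open disk under an injective parametrization of a closed disk is
homeomorphic to the open disk. -/
theorem nonempty_homeomorph_ball {f : ℂ → E3} (hf : ContinuousOn f (Metric.closedBall 0 1))
    (hinj : Set.InjOn f (Metric.closedBall 0 1)) :
    Nonempty ((f '' Metric.ball 0 1 : Set E3) ≃ₜ Metric.ball (0 : ℂ) 1) := by
  let g : Metric.closedBall (0 : ℂ) 1 → E3 := (Metric.closedBall (0 : ℂ) 1).domRestrict f
  have hg : Topology.IsEmbedding g :=
    (hf.domRestrict.isClosedEmbedding hinj.injective).isEmbedding
  let i : Metric.ball (0 : ℂ) 1 → Metric.closedBall (0 : ℂ) 1 :=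
    Set.inclusion Metric.ball_subset_closedBall
  have hi : Topology.IsEmbedding i := Topology.IsEmbedding.inclusion _
  have hgi := hg.comp hi
  have hr : Set.range (g ∘ i) = f '' Metric.ball 0 1 := by
    ext p
    constructor
    · rintro ⟨z, rfl⟩
      exact ⟨z, z.2, rfl⟩
    · rintro ⟨z, hz, rfl⟩
      exact ⟨⟨z, hz⟩, rfl⟩
  exact ⟨(hgi.toHomeomorph.trans (Homeomorph.setCongr hr)).symm⟩

/-! ### Caps centred on the great circle -/

/-- The affine functional that is nonnegative on the spherical cap with angular radius `h` whose
centre lies on the great circle `y = 0` at the angle `a` from the south pole. -/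
noncomputable def capF (a h : ℝ) (p : E3) : ℝ :=
  Real.sin a * p 0 - Real.cos a * p 2 - Real.cos h

theorem continuous_capF (a h : ℝ) : Continuous (capF a h) := by
  unfold capF
  fun_prop

/-- The point of the great circle `y = 0` at the angle `θ` from the south pole. -/
noncomputable def meridianPt (θ : ℝ) : E3 := !₂[Real.sin θ, 0, -Real.cos θ]

theorem meridianPt_mem (θ : ℝ) : meridianPt θ ∈ twoSphere := by
  rw [mem_twoSphere_iff]
  simp [meridianPt]

theorem capF_meridianPt (a h θ : ℝ) : capF a h (meridianPt θ) = Real.cos (θ - a) - Real.cos h := by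
  simp [capF, meridianPt, Real.cos_sub]
  ring

theorem exists_angle {c s : ℝ} (h : c ^ 2 + s ^ 2 = 1) :
    ∃ θ ∈ Set.Ioc (-Real.pi) Real.pi, Real.cos θ = c ∧ Real.sin θ = s := by
  have hn : ‖(⟨c, s⟩ : ℂ)‖ = 1 := by
    rw [Complex.norm_def, Complex.normSq_mk, Real.sqrt_eq_one]; linarith
  refine ⟨Complex.arg ⟨c, s⟩, Complex.arg_mem_Ioc _, ?_, ?_⟩
  · simpa [hn] using Complex.norm_mul_cos_arg ⟨c, s⟩
  · simpa [hn] using Complex.norm_mul_sin_arg ⟨c, s⟩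

theorem exists_meridianPt_eq {p : E3} (hp : p ∈ twoSphere) (h1 : p 1 = 0) :
    ∃ θ ∈ Set.Ioc (-Real.pi) Real.pi, p = meridianPt θ := by
  rw [mem_twoSphere_iff, h1] at hp
  obtain ⟨θ, hθ, hc, hs⟩ := exists_angle (c := -p 2) (s := p 0) (by nlinarith)
  exact ⟨θ, hθ, E3_ext (by simp [meridianPt, hs]) (by simp [meridianPt, h1])
    (by simp [meridianPt, hc])⟩

/-- The difference of the two sides, times `sin h`, is `(d - cos h) * sin (D + h) + sin D * (1 - d *
cos h + e * sin h)`, up to `sin ^ 2 + cos ^ 2 = 1`. The last bracket is nonnegative because `(d, e)`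
lies in the unit disk. -/
theorem cos_add_le_of_mem_cap {d e h D : ℝ} (hde : d ^ 2 + e ^ 2 ≤ 1) (hd : Real.cos h ≤ d)
    (h0 : 0 < h) (hD : 0 ≤ D) (hhD : D + h ≤ Real.pi) (hh : h < Real.pi) :
    Real.cos (D + h) ≤ d * Real.cos D + e * Real.sin D := by
  have hs := Real.sin_pos_of_pos_of_lt_pi h0 hh
  have h1 : d * Real.cos h - e * Real.sin h ≤ 1 := by
    nlinarith [sq_nonneg (d - Real.cos h), sq_nonneg (e + Real.sin h), Real.sin_sq_add_cos_sq h]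
  have h2 : 0 ≤ Real.sin (D + h) := Real.sin_nonneg_of_nonneg_of_le_pi (by linarith) hhD
  have h3 : 0 ≤ Real.sin D := Real.sin_nonneg_of_nonneg_of_le_pi hD (by linarith)
  have h4 := mul_nonneg (sub_nonneg.2 hd) h2
  have h5 := mul_nonneg h3 (sub_nonneg.2 h1)
  rw [Real.cos_add]
  rw [Real.sin_add] at h4
  have h6 : 0 ≤ Real.sin h * (d * Real.cos D + e * Real.sin D -
      (Real.cos D * Real.cos h - Real.sin D * Real.sin h)) := by
    nlinarith [Real.sin_sq_add_cos_sq h]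
  linarith [nonneg_of_mul_nonneg_right h6 hs]

/-- A triangle inequality: in the frame with first axis at the angle `a`, a point within `h` of that
centre is within `|a - a'| + h` of the other. -/
theorem cos_le_of_capF_nonneg {a h a' : ℝ} {p : E3} (hp : p 0 ^ 2 + p 2 ^ 2 ≤ 1) (h0 : 0 < h)
    (hh : h < Real.pi) (hle : |a - a'| + h ≤ Real.pi) (hF : 0 ≤ capF a h p) :
    Real.cos (|a - a'| + h) ≤ Real.sin a' * p 0 - Real.cos a' * p 2 := by
  set d := Real.sin a * p 0 - Real.cos a * p 2 with hd
  set e := Real.cos a * p 0 + Real.sin a * p 2 with he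
  have hcap : Real.cos h ≤ d := by unfold capF at hF; linarith
  have hde : d ^ 2 + e ^ 2 ≤ 1 := by
    have : d ^ 2 + e ^ 2 = (Real.sin a ^ 2 + Real.cos a ^ 2) * (p 0 ^ 2 + p 2 ^ 2) := by
      rw [hd, he]; ring
    rw [this, Real.sin_sq_add_cos_sq, one_mul]; exact hp
  have key : Real.sin a' * p 0 - Real.cos a' * p 2 =
      d * Real.cos (a' - a) + e * Real.sin (a' - a) := by
    have h1 : Real.sin a' = Real.sin (a' - a) * Real.cos a + Real.cos (a' - a) * Real.sin a := by
      rw [← Real.sin_add]; ring_nf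
    have h2 : Real.cos a' = Real.cos (a' - a) * Real.cos a - Real.sin (a' - a) * Real.sin a := by
      rw [← Real.cos_add]; ring_nf
    rw [h1, h2, hd, he]; ring
  rw [key]
  rcases le_total a a' with h1 | h1
  · have h2 : |a - a'| = a' - a := by rw [abs_of_nonpos (by linarith)]; ring
    rw [h2] at hle ⊢
    exact cos_add_le_of_mem_cap hde hcap h0 (by linarith) hle hh
  · have h2 : |a - a'| = a - a' := abs_of_nonneg (by linarith)
    rw [h2] at hle ⊢
    have := cos_add_le_of_mem_cap (e := -e) (by rwa [neg_sq]) hcap h0 (by linarith) hle hh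
    rw [← neg_sub a a', Real.cos_neg, Real.sin_neg]
    linarith

/-- A cap whose arc is contained in the interior of the arc of another cap is contained in the
interior of the other cap. -/
theorem capF_pos_of_capF_nonneg {a h a' h' : ℝ} {p : E3} (hp : p 0 ^ 2 + p 2 ^ 2 ≤ 1) (h0 : 0 < h)
    (hh' : h' ≤ Real.pi) (hlt : |a - a'| + h < h') (hF : 0 ≤ capF a h p) : 0 < capF a' h' p := by
  have h1 := abs_nonneg (a - a')
  have := cos_le_of_capF_nonneg (a' := a') hp h0 (by linarith) (by linarith) hF
  have := Real.cos_lt_cos_of_nonneg_of_le_pi (by linarith) hh' hlt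
  unfold capF
  linarith

/-- The complement of a cap is the cap around the antipode with complementary radius. Statements
about disjoint caps become statements about nested ones. -/
theorem capF_opposite (a h : ℝ) (p : E3) : capF (a + Real.pi) (Real.pi - h) p = -capF a h p := by
  simp [capF, Real.sin_add_pi, Real.cos_add_pi, Real.cos_pi_sub]
  ring

theorem capF_opposite' (a h : ℝ) (p : E3) : capF (a - Real.pi) (Real.pi - h) p = -capF a h p := by
  simp [capF, Real.sin_sub_pi, Real.cos_sub_pi, Real.cos_pi_sub]
  ring

/-- Two caps with disjoint arcs are disjoint. -/
theorem capF_neg_of_capF_nonneg {a h a' h' : ℝ} {p : E3} (hp : p 0 ^ 2 + p 2 ^ 2 ≤ 1) (h0 : 0 < h)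
    (hh' : 0 ≤ h') (hlt : h + h' < |a - a'|) (hle : |a - a'| + h + h' < 2 * Real.pi)
    (hF : 0 ≤ capF a h p) : capF a' h' p < 0 := by
  rcases le_total a a' with h1 | h1
  · have h2 : |a - a'| = a' - a := by rw [abs_of_nonpos (by linarith)]; ring
    rw [h2] at hlt hle
    have := capF_pos_of_capF_nonneg (a' := a' - Real.pi) (h' := Real.pi - h') hp h0 (by linarith)
      (by have : |a - (a' - Real.pi)| < Real.pi - h' - h := by
            rw [abs_lt]; constructor <;> linarith
          linarith) hF
    rw [capF_opposite'] at this
    linarith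
  · have h2 : |a - a'| = a - a' := abs_of_nonneg (by linarith)
    rw [h2] at hlt hle
    have := capF_pos_of_capF_nonneg (a' := a' + Real.pi) (h' := Real.pi - h') hp h0 (by linarith)
      (by have : |a - (a' + Real.pi)| < Real.pi - h' - h := by
            rw [abs_lt]; constructor <;> linarith
          linarith) hF
    rw [capF_opposite] at this
    linarith

/-- The pole of an arc that is contained in the arc of a cap lies in the half-plane of the cap. -/
theorem pole_in_cap {a h φ ψ : ℝ} (hψ : 0 ≤ ψ) (hh : h ≤ Real.pi) (hle : |φ - a| + ψ ≤ h) :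
    0 ≤ Real.cos (φ - a) - Real.cos ψ * Real.cos h := by
  have h1 := abs_nonneg (φ - a)
  rw [← Real.cos_abs (φ - a)]
  have h2 := Real.cos_le_cos_of_nonneg_of_le_pi h1 (by linarith) (by linarith : |φ - a| ≤ h - ψ)
  rw [Real.cos_sub] at h2
  have h3 := mul_nonneg (Real.sin_nonneg_of_nonneg_of_le_pi (by linarith : 0 ≤ h) hh)
    (Real.sin_nonneg_of_nonneg_of_le_pi hψ (by linarith))
  linarith

theorem hasDerivAt_E3 {f : ℝ → E3} {f' : E3} {t : ℝ}
    (h : ∀ i, HasDerivAt (fun t => f t i) (f' i) t) : HasDerivAt f f' t := by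
  have g : HasDerivAt (fun t i => f t i) (fun i => f' i) t := hasDerivAt_pi.2 h
  exact (PiLp.hasFDerivAt_toLp (𝕜 := ℝ) 2 (fun i => f t i)).comp_hasDerivAt t g

/-! ### Boundary circles of caps and their intersections -/

section Circle

variable (a h : ℝ)

/-- Parametrization of the boundary circle of a cap. -/
noncomputable def circleFun (t : ℝ) : E3 :=
  !₂[Real.cos h * Real.sin a + Real.sin h * Real.cos (2 * Real.pi * t) * Real.cos a,
    Real.sin h * Real.sin (2 * Real.pi * t),
    -(Real.cos h * Real.cos a) + Real.sin h * Real.cos (2 * Real.pi * t) * Real.sin a]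

/-- The derivative of `circleFun`. -/
noncomputable def circleDeriv (t : ℝ) : E3 :=
  !₂[-(2 * Real.pi * Real.sin h * Real.sin (2 * Real.pi * t) * Real.cos a),
    2 * Real.pi * Real.sin h * Real.cos (2 * Real.pi * t),
    -(2 * Real.pi * Real.sin h * Real.sin (2 * Real.pi * t) * Real.sin a)]

theorem contDiff_circleFun : ContDiff ℝ ∞ (circleFun a h) := by
  rw [contDiff_euclidean]
  intro i
  fin_cases i
  · simp [circleFun]; fun_prop
  · simp [circleFun]; fun_prop
  · simp [circleFun]; fun_prop

theorem hasDerivAt_circleFun (t : ℝ) : HasDerivAt (circleFun a h) (circleDeriv a h t) t := by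
  have hc : HasDerivAt (fun t => Real.cos (2 * Real.pi * t))
      (-Real.sin (2 * Real.pi * t) * (2 * Real.pi)) t := by
    have := (hasDerivAt_id t).const_mul (2 * Real.pi)
    simpa using this.cos
  have hs : HasDerivAt (fun t => Real.sin (2 * Real.pi * t))
      (Real.cos (2 * Real.pi * t) * (2 * Real.pi)) t := by
    have := (hasDerivAt_id t).const_mul (2 * Real.pi)
    simpa using this.sin
  refine hasDerivAt_E3 fun i => ?_
  fin_cases i
  · simp [circleFun, circleDeriv]
    refine ((hc.const_mul (Real.sin h)).mul_const (Real.cos a)).congr_deriv ?_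
    ring
  · simp [circleFun, circleDeriv]
    refine (hs.const_mul (Real.sin h)).congr_deriv ?_
    ring
  · simp [circleFun, circleDeriv]
    refine ((hc.const_mul (Real.sin h)).mul_const (Real.sin a)).congr_deriv ?_
    ring

theorem deriv_circleFun (t : ℝ) : deriv (circleFun a h) t = circleDeriv a h t :=
  (hasDerivAt_circleFun a h t).deriv

theorem circleFun_mem (t : ℝ) : circleFun a h t ∈ twoSphere := by
  rw [mem_twoSphere_iff]
  simp only [circleFun]
  simp
  have h1 : Real.sin a ^ 2 = 1 - Real.cos a ^ 2 := by linarith [Real.sin_sq_add_cos_sq a]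
  have h2 : Real.sin h ^ 2 = 1 - Real.cos h ^ 2 := by linarith [Real.sin_sq_add_cos_sq h]
  have h3 := Real.sin_sq (2 * Real.pi * t)
  ring_nf at h3 ⊢
  rw [h1, h2, h3]
  ring

theorem capF_circleFun (t : ℝ) : capF a h (circleFun a h t) = 0 := by
  simp only [capF, circleFun]
  simp
  have h1 : Real.sin a ^ 2 = 1 - Real.cos a ^ 2 := by linarith [Real.sin_sq_add_cos_sq a]
  ring_nf
  rw [h1]
  ring

variable {a h}

theorem circleFun_eq_iff (hs : Real.sin h ≠ 0) {s t : ℝ} :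
    circleFun a h s = circleFun a h t ↔ Real.cos (2 * Real.pi * s) = Real.cos (2 * Real.pi * t) ∧
      Real.sin (2 * Real.pi * s) = Real.sin (2 * Real.pi * t) := by
  constructor
  · intro e
    have e0 := congrArg (fun p : E3 => p 0) e
    have e1 := congrArg (fun p : E3 => p 1) e
    have e2 := congrArg (fun p : E3 => p 2) e
    simp [circleFun, hs] at e0 e1 e2
    refine ⟨?_, e1⟩
    rcases e0 with e0 | e0
    · exact e0
    rcases e2 with e2 | e2
    · exact e2
    have := Real.sin_sq_add_cos_sq a
    rw [e0, e2] at this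
    norm_num at this
  · rintro ⟨e0, e1⟩
    simp only [circleFun, e0, e1]

theorem range_circleFun (hs : Real.sin h ≠ 0) :
    Set.range (circleFun a h) = {p | p ∈ twoSphere ∧ capF a h p = 0} := by
  ext p
  constructor
  · rintro ⟨t, rfl⟩
    exact ⟨circleFun_mem a h t, capF_circleFun a h t⟩
  · rintro ⟨hp, hF⟩
    rw [mem_twoSphere_iff] at hp
    set e := Real.cos a * p 0 + Real.sin a * p 2 with he
    have hd : Real.sin a * p 0 - Real.cos a * p 2 = Real.cos h := by unfold capF at hF; linarith
    have h1 : Real.sin a ^ 2 = 1 - Real.cos a ^ 2 := by linarith [Real.sin_sq_add_cos_sq a]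
    have h2 : e ^ 2 + p 1 ^ 2 = Real.sin h ^ 2 := by
      rw [Real.sin_sq, ← hd, ← hp, he]
      ring_nf; rw [h1]; ring
    obtain ⟨θ, -, hc, hs'⟩ := exists_angle (c := e / Real.sin h) (s := p 1 / Real.sin h)
      (by field_simp; exact h2)
    have ht : 2 * Real.pi * (θ / (2 * Real.pi)) = θ := by
      have := Real.pi_ne_zero; field_simp
    refine ⟨θ / (2 * Real.pi), E3_ext ?_ ?_ ?_⟩
    · simp only [circleFun, ht, hc]
      simp
      rw [mul_div_cancel₀ _ hs, ← hd, he]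
      ring_nf; rw [h1]; ring
    · simp only [circleFun, ht, hs']
      simp
      rw [mul_div_cancel₀ _ hs]
    · simp only [circleFun, ht, hc]
      simp
      rw [mul_div_cancel₀ _ hs, ← hd, he]
      ring_nf; rw [h1]; ring

/-- The boundary circle of a cap, as a smooth simple closed curve. -/
noncomputable def circleCurve (a h : ℝ) (hs : Real.sin h ≠ 0) : SimpleClosedCurve where
  toFun := circleFun a h
  smooth := contDiff_circleFun a h
  periodic := fun t => by
    have : 2 * Real.pi * (t + 1) = 2 * Real.pi * t + 2 * Real.pi := by ring
    simp only [circleFun, this, Real.cos_add_two_pi, Real.sin_add_two_pi]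
  mem_sphere := circleFun_mem a h
  regular := fun t e => by
    rw [deriv_circleFun] at e
    have e0 := congrArg (fun p : E3 => p 0) e
    have e1 := congrArg (fun p : E3 => p 1) e
    have e2 := congrArg (fun p : E3 => p 2) e
    simp [circleDeriv, hs, Real.pi_ne_zero] at e0 e1 e2
    have h1 := Real.sin_sq_add_cos_sq (2 * Real.pi * t)
    have h2 := Real.sin_sq_add_cos_sq a
    rcases e0 with e0 | e0
    · rw [e0, e1] at h1; norm_num at h1
    rcases e2 with e2 | e2
    · rw [e2, e1] at h1; norm_num at h1
    · rw [e0, e2] at h2; norm_num at h2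
  injOn := by
    intro s hs' t ht e
    obtain ⟨e1, e2⟩ := (circleFun_eq_iff hs).1 e
    have h1 : Real.cos (2 * Real.pi * s - 2 * Real.pi * t) = 1 := by
      rw [Real.cos_sub, e1, e2]; linarith [Real.sin_sq_add_cos_sq (2 * Real.pi * t)]
    obtain ⟨n, hn⟩ := (Real.cos_eq_one_iff _).1 h1
    have h2 : (n : ℝ) = s - t := by
      have h3 : (2 * Real.pi) * (n - (s - t)) = 0 := by linarith
      have := (mul_eq_zero.1 h3).resolve_left (by positivity)
      linarith
    have h3 : (n : ℝ) < 1 := by rw [h2]; linarith [hs'.2, ht.1]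
    have h4 : (-1 : ℝ) < n := by rw [h2]; linarith [hs'.1, ht.2]
    have h5 : n = 0 := by
      have h3' : n < 1 := by exact_mod_cast h3
      have h4' : -1 < n := by exact_mod_cast h4
      omega
    rw [h5] at h2
    push_cast at h2
    linarith

theorem image_circleCurve (hs : Real.sin h ≠ 0) :
    (circleCurve a h hs).image = {p | p ∈ twoSphere ∧ capF a h p = 0} :=
  range_circleFun hs

/-- The boundary arcs of two caps cross: exactly one end of the second arc lies between
the two ends of the first one. -/
def ArcsCross (a h a' h' : ℝ) : Prop :=
  (Real.cos (h + (a' - a)) - Real.cos h') * (Real.cos (h - (a' - a)) - Real.cos h') < 0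

/-- If the sine vanished, the two factors would coincide and their product would be a square. -/
theorem ArcsCross.sin_ne_zero {a' h' : ℝ} (hx : ArcsCross a h a' h') : Real.sin (a' - a) ≠ 0 := by
  intro h0
  unfold ArcsCross at hx
  rw [Real.cos_add h, Real.cos_sub h, h0] at hx
  nlinarith [sq_nonneg (Real.cos h * Real.cos (a' - a) - Real.cos h')]

theorem linear_system_unique {a a' x z x' z' : ℝ} (hs : Real.sin (a' - a) ≠ 0)
    (h1 : Real.sin a * x - Real.cos a * z = Real.sin a * x' - Real.cos a * z')
    (h2 : Real.sin a' * x - Real.cos a' * z = Real.sin a' * x' - Real.cos a' * z') :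
    x = x' ∧ z = z' := by
  rw [Real.sin_sub] at hs
  constructor
  · apply sub_eq_zero.1
    apply (mul_eq_zero.1 (?_ : (Real.sin a' * Real.cos a - Real.cos a' * Real.sin a) * (x - x') = 0)).resolve_left hs
    linear_combination (Real.cos a) * h2 - Real.cos a' * h1
  · apply sub_eq_zero.1
    apply (mul_eq_zero.1 (?_ : (Real.sin a' * Real.cos a - Real.cos a' * Real.sin a) * (z - z') = 0)).resolve_left hs
    linear_combination (Real.sin a) * h2 - Real.sin a' * h1

/-- Two circles whose arcs cross meet in two points, mirror images of each other. -/
theorem ArcsCross.exists_points {a' h' : ℝ} (hx : ArcsCross a h a' h') (hs : Real.sin h ≠ 0) :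
    ∃ x y z : ℝ, 0 < y ∧ x ^ 2 + y ^ 2 + z ^ 2 = 1 ∧ ∀ p : E3,
      (p ∈ twoSphere ∧ capF a h p = 0 ∧ capF a' h' p = 0) ↔ p = !₂[x, y, z] ∨ p = !₂[x, -y, z] := by
  have hΔ := hx.sin_ne_zero
  unfold ArcsCross at hx
  rw [Real.cos_add h, Real.cos_sub h] at hx
  -- Both planes are parallel to the `y`-axis and meet in a line parallel to it. In the plane `y =
  -- 0` that line is a point on the chord of the first circle; `μ` is its position, the ends of the
  -- chord being `±1`. The crossing condition amounts to `μ ^ 2 < 1`, so the line enters the open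
  -- ball.
  set μ := (Real.cos h' - Real.cos h * Real.cos (a' - a)) / (Real.sin h * Real.sin (a' - a)) with hμ
  have hss : Real.sin h * Real.sin (a' - a) ≠ 0 := mul_ne_zero hs hΔ
  have hμ1 : μ ^ 2 < 1 := by
    rw [hμ, div_pow, div_lt_one (by positivity)]
    nlinarith
  have hμ2 : μ * (Real.sin h * Real.sin (a' - a)) =
      Real.cos h' - Real.cos h * Real.cos (a' - a) := div_mul_cancel₀ _ hss
  set e := μ * Real.sin h with he
  have hyy : 0 < 1 - Real.cos h ^ 2 - e ^ 2 := by
    have : 1 - Real.cos h ^ 2 - e ^ 2 = Real.sin h ^ 2 * (1 - μ ^ 2) := by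
      rw [Real.sin_sq, he, mul_pow, Real.sin_sq]; ring
    rw [this]
    have : 0 < Real.sin h ^ 2 := by positivity
    exact mul_pos this (by linarith)
  have e1 : Real.sin a ^ 2 = 1 - Real.cos a ^ 2 := by linarith [Real.sin_sq_add_cos_sq a]
  set x := Real.cos h * Real.sin a + e * Real.cos a with hxdef
  set z := -(Real.cos h * Real.cos a) + e * Real.sin a with hzdef
  have hxz : x ^ 2 + z ^ 2 = Real.cos h ^ 2 + e ^ 2 := by
    rw [hxdef, hzdef]; ring_nf; rw [e1]; ring
  have f1 : Real.sin a * x - Real.cos a * z = Real.cos h := by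
    rw [hxdef, hzdef]; ring_nf; rw [e1]; ring
  have f2 : Real.sin a' * x - Real.cos a' * z = Real.cos h' := by
    have : Real.sin a' * x - Real.cos a' * z =
        Real.cos h * Real.cos (a' - a) + e * Real.sin (a' - a) := by
      rw [Real.cos_sub, Real.sin_sub, hxdef, hzdef]; ring
    rw [this, he, mul_assoc, hμ2]; ring
  have hy2 : √(1 - Real.cos h ^ 2 - e ^ 2) ^ 2 = 1 - Real.cos h ^ 2 - e ^ 2 := Real.sq_sqrt hyy.le
  refine ⟨x, √(1 - Real.cos h ^ 2 - e ^ 2), z, Real.sqrt_pos.2 hyy, by linarith, fun p => ?_⟩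
  constructor
  · rintro ⟨hp, hp1, hp2⟩
    rw [mem_twoSphere_iff] at hp
    unfold capF at hp1 hp2
    obtain ⟨g1, g2⟩ := linear_system_unique (x := p 0) (z := p 2) (x' := x) (z' := z) hΔ
      (by linarith) (by linarith)
    have g3 : p 1 ^ 2 = √(1 - Real.cos h ^ 2 - e ^ 2) ^ 2 := by
      rw [g1, g2] at hp; linarith
    rcases sq_eq_sq_iff_eq_or_eq_neg.1 g3 with g3 | g3
    · left; exact E3_ext (by simpa using g1) (by simpa using g3) (by simpa using g2)
    · right; exact E3_ext (by simpa using g1) (by simpa using g3) (by simpa using g2)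
  · rintro (rfl | rfl)
    · refine ⟨?_, ?_, ?_⟩
      · rw [mem_twoSphere_iff]; simp; linarith
      · simp [capF]; linarith
      · simp [capF]; linarith
    · refine ⟨?_, ?_, ?_⟩
      · rw [mem_twoSphere_iff]; simp; linarith
      · simp [capF]; linarith
      · simp [capF]; linarith

/-- At a point with second coordinate `Y`, the first and last coordinates of the tangent are `-2πY`
times `(cos a, sin a)`. At a crossing `Y ≠ 0`, and the directions for `a` and `a'` are independent
because `sin (a' - a) ≠ 0`. -/
theorem ArcsCross.transverse {a' h' : ℝ} (hx : ArcsCross a h a' h') (hs : Real.sin h ≠ 0)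
    (hs' : Real.sin h' ≠ 0) : (circleCurve a h hs).Transverse (circleCurve a' h' hs') := by
  intro s t hst
  change circleFun a h s = circleFun a' h' t at hst
  obtain ⟨x, y, z, hy, -, hp⟩ := hx.exists_points hs
  have h1 := (hp (circleFun a h s)).1 ⟨circleFun_mem _ _ _, capF_circleFun _ _ _,
    by rw [hst]; exact capF_circleFun _ _ _⟩
  have h2 : circleFun a h s 1 ≠ 0 := by
    rcases h1 with h1 | h1 <;> rw [h1] <;> simp [hy.ne']
  have h3 : circleFun a h s 1 = Real.sin h * Real.sin (2 * Real.pi * s) := by simp [circleFun]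
  have h4 : circleFun a h s 1 = Real.sin h' * Real.sin (2 * Real.pi * t) := by
    rw [hst]; simp [circleFun]
  set Y := circleFun a h s 1
  have hΔ := hx.sin_ne_zero
  change LinearIndependent ℝ ![deriv (circleFun a h) s, deriv (circleFun a' h') t]
  rw [deriv_circleFun, deriv_circleFun, LinearIndependent.pair_iff]
  intro c d hcd
  have e0 := congrArg (fun p : E3 => p 0) hcd
  have e2 := congrArg (fun p : E3 => p 2) hcd
  simp [circleDeriv] at e0 e2
  have hpi := Real.pi_ne_zero
  have k0 : c * Real.cos a + d * Real.cos a' = 0 := by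
    have : (2 * Real.pi * Y) * (c * Real.cos a + d * Real.cos a') = 0 := by
      rw [mul_add]
      nth_rewrite 1 [h3]
      rw [h4]; linarith
    exact (mul_eq_zero.1 this).resolve_left (by simp [hpi, h2])
  have k2 : c * Real.sin a + d * Real.sin a' = 0 := by
    have : (2 * Real.pi * Y) * (c * Real.sin a + d * Real.sin a') = 0 := by
      rw [mul_add]
      nth_rewrite 1 [h3]
      rw [h4]; linarith
    exact (mul_eq_zero.1 this).resolve_left (by simp [hpi, h2])
  rw [Real.sin_sub] at hΔ
  constructor
  · apply (mul_eq_zero.1 (?_ : (Real.sin a' * Real.cos a - Real.cos a' * Real.sin a) * c = 0)).resolve_left hΔ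
    linear_combination Real.sin a' * k0 - Real.cos a' * k2
  · apply (mul_eq_zero.1 (?_ : (Real.sin a' * Real.cos a - Real.cos a' * Real.sin a) * d = 0)).resolve_left hΔ
    linear_combination -Real.sin a * k0 + Real.cos a * k2

/-- Reversing time is the reflection `y ↦ -y` on every one of these circles. -/
theorem circleFun_neg_eq {a' h' s t : ℝ} (hst : circleFun a h s = circleFun a' h' t) :
    circleFun a h (-s) = circleFun a' h' (-t) := by
  have e0 := congrArg (fun p : E3 => p 0) hst
  have e1 := congrArg (fun p : E3 => p 1) hst
  have e2 := congrArg (fun p : E3 => p 2) hst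
  simp only [circleFun] at e0 e1 e2
  simp at e0 e1 e2
  refine E3_ext ?_ ?_ ?_ <;> simp [circleFun, *]

/-- The two intersection points of two circles have opposite signs. -/
theorem crossingDet_neg {a' h' s t : ℝ} (hs : Real.sin h ≠ 0) (hs' : Real.sin h' ≠ 0) :
    (circleCurve a h hs).crossingDet (circleCurve a' h' hs') (-s) (-t) =
      -(circleCurve a h hs).crossingDet (circleCurve a' h' hs') s t := by
  simp only [SimpleClosedCurve.crossingDet, circleCurve, deriv_circleFun, Matrix.det_fin_three]
  simp [circleFun, circleDeriv]
  ring

end Circle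

/-! ### The arrangement of caps and circles of latitude -/

/-- The combinatorial data of a chain of caps along a meridian from the south pole to the north
pole, together with circles of latitude through the centres of the caps with numbers
`rung 0 = 0, ..., rung q`, the last one being the last cap. -/
structure Ladder where
  rung : ℕ → ℕ
  q : ℕ
  strictMono : StrictMono rung
  rung_zero : rung 0 = 0

/-- Names for the regions: the overlaps of consecutive caps, the caps (without the overlaps) that
are not cut by a circle of latitude, the southern and northern parts of those that are, and the
bands between circles of latitude (without the caps). -/
inductive Cell
  | lens (i : ℕ)
  | whole (i : ℕ)
  | low (t : ℕ)
  | up (t : ℕ)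
  | band (t : ℕ)

namespace Ladder

variable (D : Ladder)

/-- The number of the last cap. -/
def N : ℕ := D.rung D.q

/-- The number of angular units in a half circle. -/
def T : ℕ := 6 * D.N + 8

/-- The angular unit. -/
noncomputable def unit : ℝ := Real.pi / D.T

theorem unit_pos : 0 < D.unit := by
  have : (0 : ℝ) < D.T := by unfold T; positivity
  exact div_pos Real.pi_pos this

theorem T_mul_unit : (D.T : ℝ) * D.unit = Real.pi := by
  have : (D.T : ℝ) ≠ 0 := by unfold T; positivity
  unfold unit
  field_simp

theorem rung_le_N {t : ℕ} (h : t ≤ D.q) : D.rung t ≤ D.N := D.strictMono.monotone h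

/-- The functional of a cap, in angular units. -/
noncomputable def cap (k h : ℝ) (p : E3) : ℝ := capF (k * D.unit) (h * D.unit) p

/-- The functional of the cap with number `i` of the chain. -/
noncomputable def capU (i : ℕ) (p : E3) : ℝ := D.cap (4 + 6 * i) 4 p

/-- The functional of the southern cap that is bounded by the circle of latitude with number `t`. -/
noncomputable def capL (t : ℕ) (p : E3) : ℝ := D.cap 0 (4 + 6 * D.rung t) p

variable {D}

theorem abs_mul_unit (k k' : ℝ) : |k * D.unit - k' * D.unit| = |k - k'| * D.unit := by
  rw [← sub_mul, abs_mul, abs_of_pos D.unit_pos]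

theorem mul_unit_le_pi {h : ℝ} (hh : h ≤ D.T) : h * D.unit ≤ Real.pi := by
  rw [← D.T_mul_unit]
  exact mul_le_mul_of_nonneg_right hh D.unit_pos.le

theorem mul_unit_lt_pi {h : ℝ} (hh : h < D.T) : h * D.unit < Real.pi := by
  rw [← D.T_mul_unit]
  exact mul_lt_mul_of_pos_right hh D.unit_pos

theorem sq_add_sq_le {p : E3} (hp : p ∈ twoSphere) : p 0 ^ 2 + p 2 ^ 2 ≤ 1 := by
  rw [mem_twoSphere_iff] at hp
  nlinarith [sq_nonneg (p 1)]

theorem cap_pos {k h k' h' : ℝ} {p : E3} (hp : p ∈ twoSphere) (h0 : 0 < h) (hh' : h' ≤ D.T)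
    (hlt : |k - k'| + h < h') (hF : 0 ≤ D.cap k h p) : 0 < D.cap k' h' p := by
  refine capF_pos_of_capF_nonneg (sq_add_sq_le hp) (mul_pos h0 D.unit_pos) (mul_unit_le_pi hh') ?_ hF
  rw [abs_mul_unit, ← add_mul]
  exact mul_lt_mul_of_pos_right hlt D.unit_pos

theorem cap_neg {k h k' h' : ℝ} {p : E3} (hp : p ∈ twoSphere) (h0 : 0 < h) (hh' : 0 ≤ h')
    (hlt : h + h' < |k - k'|) (hle : |k - k'| + h + h' < 2 * D.T)
    (hF : 0 ≤ D.cap k h p) : D.cap k' h' p < 0 := by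
  refine capF_neg_of_capF_nonneg (sq_add_sq_le hp) (mul_pos h0 D.unit_pos)
    (mul_nonneg hh' D.unit_pos.le) ?_ ?_ hF
  · rw [abs_mul_unit, ← add_mul]
    exact mul_lt_mul_of_pos_right hlt D.unit_pos
  · rw [abs_mul_unit, ← add_mul, ← add_mul, ← D.T_mul_unit, ← mul_assoc]
    exact mul_lt_mul_of_pos_right hle D.unit_pos

variable {p : E3}

theorem cast_T : (D.T : ℝ) = 6 * D.N + 8 := by unfold T; push_cast; ring

/-- In angular units cap `i` covers `6 * i` to `6 * i + 8` on the meridian. Neighbours overlap by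
two units, others are at least four units apart, and the bound by `N` keeps caps from meeting beyond
the north pole. -/
theorem capU_neg_of_lt (hp : p ∈ twoSphere) {i j : ℕ} (hij : i + 1 < j) (hj : j ≤ D.N)
    (h : 0 ≤ D.capU i p) : D.capU j p < 0 := by
  have h1 : (i : ℝ) + 2 ≤ j := by exact_mod_cast hij
  have h2 : (j : ℝ) ≤ D.N := by exact_mod_cast hj
  have h4 : (0 : ℝ) ≤ i := by positivity
  have h3 : |(4 + 6 * (i : ℝ)) - (4 + 6 * j)| = 6 * j - 6 * i := by
    rw [abs_of_nonpos (by linarith)]; ring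
  refine cap_neg hp (by norm_num) (by norm_num) ?_ ?_ h
  · rw [h3]; linarith
  · rw [h3, cast_T]; linarith

theorem capU_neg_of_gt (hp : p ∈ twoSphere) {i j : ℕ} (hij : j + 1 < i) (hi : i ≤ D.N)
    (h : 0 ≤ D.capU i p) : D.capU j p < 0 := by
  by_contra hc
  linarith [capU_neg_of_lt hp hij hi (not_lt.1 hc)]

theorem capL_pos_of_capU (hp : p ∈ twoSphere) {i t : ℕ} (hit : i < D.rung t) (ht : t ≤ D.q)
    (h : 0 ≤ D.capU i p) : 0 < D.capL t p := by
  have h1 : (i : ℝ) + 1 ≤ D.rung t := by exact_mod_cast hit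
  have h2 : (D.rung t : ℝ) ≤ D.N := by exact_mod_cast D.rung_le_N ht
  refine cap_pos hp (by norm_num) ?_ ?_ h
  · rw [cast_T]; linarith
  · rw [sub_zero, abs_of_pos (by positivity)]; linarith

theorem capL_neg_of_capU (hp : p ∈ twoSphere) {i t : ℕ} (hit : D.rung t < i) (hi : i ≤ D.N)
    (h : 0 ≤ D.capU i p) : D.capL t p < 0 := by
  have h1 : (D.rung t : ℝ) + 1 ≤ i := by exact_mod_cast hit
  have h2 : (i : ℝ) ≤ D.N := by exact_mod_cast hi
  refine cap_neg hp (by norm_num) (by positivity) ?_ ?_ h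
  · rw [sub_zero, abs_of_pos (by positivity)]; linarith
  · rw [sub_zero, abs_of_pos (by positivity), cast_T]; linarith

/-- Concentric caps with strictly increasing radii. -/
theorem capL_pos_of_capL (hp : p ∈ twoSphere) {t t' : ℕ} (htt : t < t') (ht' : t' ≤ D.q)
    (h : 0 ≤ D.capL t p) : 0 < D.capL t' p := by
  have h1 : (D.rung t : ℝ) + 1 ≤ D.rung t' := by exact_mod_cast D.strictMono htt
  have h2 : (D.rung t' : ℝ) ≤ D.N := by exact_mod_cast D.rung_le_N ht'
  refine cap_pos hp (by positivity) ?_ ?_ h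
  · rw [cast_T]; linarith
  · rw [sub_self, abs_zero]; linarith

theorem capL_neg_of_capL (hp : p ∈ twoSphere) {t t' : ℕ} (htt : t' < t) (ht : t ≤ D.q)
    (h : D.capL t p ≤ 0) : D.capL t' p < 0 := by
  by_contra hc
  linarith [capL_pos_of_capL hp htt ht (not_lt.1 hc)]

variable (D)

/-- Which names are in use. -/
def Valid : Cell → Prop
  | .lens i => i < D.N
  | .whole i => i ≤ D.N ∧ ∀ t ≤ D.q, D.rung t ≠ i
  | .low t => t ≤ D.q
  | .up t => t ≤ D.q
  | .band t => t ≤ D.q + 1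

/-- Whether a region lies in the cap with number `j` of the chain. -/
def InU : Cell → ℕ → Prop
  | .lens i, j => j = i ∨ j = i + 1
  | .whole i, j => j = i
  | .low t, j => j = D.rung t
  | .up t, j => j = D.rung t
  | .band _, _ => False

/-- Whether a region lies to the south of the circle of latitude with number `t`. -/
def InL : Cell → ℕ → Prop
  | .lens i, t => i < D.rung t
  | .whole i, t => i < D.rung t
  | .low t', t => t' ≤ t
  | .up t', t => t' < t
  | .band t', t => t' ≤ t

/-- The open region with a given name. -/
def openCell (r : Cell) : Set E3 :=
  {p | p ∈ twoSphere ∧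
    (∀ j ≤ D.N, (D.InU r j → 0 < D.capU j p) ∧ (¬ D.InU r j → D.capU j p < 0)) ∧
    ∀ t ≤ D.q, (D.InL r t → 0 < D.capL t p) ∧ (¬ D.InL r t → D.capL t p < 0)}

/-- The closed region with a given name. -/
def closedCell (r : Cell) : Set E3 :=
  {p | p ∈ twoSphere ∧
    (∀ j ≤ D.N, (D.InU r j → 0 ≤ D.capU j p) ∧ (¬ D.InU r j → D.capU j p ≤ 0)) ∧
    ∀ t ≤ D.q, (D.InL r t → 0 ≤ D.capL t p) ∧ (¬ D.InL r t → D.capL t p ≤ 0)}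

variable {D}

theorem rung_inj {t t' : ℕ} (h : D.rung t = D.rung t') : t = t' := D.strictMono.injective h

/-- A region is determined by its sign vector: the caps containing it give its kind and number, the
circles of latitude separate the two halves of a cut cap and tell the bands apart. Differently named
open regions are therefore disjoint. -/
theorem eq_of_signs {r r' : Cell} (hr : D.Valid r) (hr' : D.Valid r')
    (hU : ∀ j ≤ D.N, (D.InU r j ↔ D.InU r' j)) (hL : ∀ t ≤ D.q, (D.InL r t ↔ D.InL r' t)) :
    r = r' := by
  have hN := fun t (h : t ≤ D.q) => D.rung_le_N h
  rcases r with i | i | t | t | t <;> rcases r' with i' | i' | t' | t' | t' <;>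
    simp only [Valid, InU, InL] at hr hr' hU hL
  · have h1 := hU i (by omega)
    have h2 := hU (i + 1) (by omega)
    congr 1; omega
  · have h1 := hU i (by omega)
    have h2 := hU (i + 1) (by omega)
    omega
  · have h1 := hU i (by omega)
    have h2 := hU (i + 1) (by omega)
    omega
  · have h1 := hU i (by omega)
    have h2 := hU (i + 1) (by omega)
    omega
  · have h1 := hU i (by omega)
    simp at h1
  · have h1 := hU i' (by omega)
    have h2 := hU (i' + 1) (by omega)
    omega
  · have h1 := hU i (by omega)
    congr 1; omega
  · have h1 := hU i (by omega)
    exact absurd (h1.1 rfl).symm (hr.2 _ hr')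
  · have h1 := hU i (by omega)
    exact absurd (h1.1 rfl).symm (hr.2 _ hr')
  · have h1 := hU i (by omega)
    simp at h1
  · have h1 := hU i' (by omega)
    have h2 := hU (i' + 1) (by omega)
    omega
  · have h1 := hU i' (by omega)
    exact absurd (h1.2 rfl).symm (hr'.2 _ hr)
  · have h1 := (hU _ (hN _ hr)).1 rfl
    rw [rung_inj h1]
  · have h1 := rung_inj ((hU _ (hN _ hr)).1 rfl)
    have h2 := hL t hr
    omega
  · have h1 := hU _ (hN _ hr)
    simp at h1
  · have h1 := hU i' (by omega)
    have h2 := hU (i' + 1) (by omega)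
    omega
  · have h1 := hU i' (by omega)
    exact absurd (h1.2 rfl).symm (hr'.2 _ hr)
  · have h1 := rung_inj ((hU _ (hN _ hr)).1 rfl)
    have h2 := hL t hr
    omega
  · have h1 := (hU _ (hN _ hr)).1 rfl
    rw [rung_inj h1]
  · have h1 := hU _ (hN _ hr)
    simp at h1
  · have h1 := hU i' (by omega)
    simp at h1
  · have h1 := hU i' (by omega)
    simp at h1
  · have h1 := hU _ (hN _ hr')
    simp at h1
  · have h1 := hU _ (hN _ hr')
    simp at h1
  · rcases lt_trichotomy t t' with h | h | h
    · have := hL t (by omega); omega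
    · rw [h]
    · have := hL t' (by omega); omega

theorem eq_of_mem_openCell {r r' : Cell} (hr : D.Valid r) (hr' : D.Valid r')
    (h : p ∈ D.openCell r) (h' : p ∈ D.openCell r') : r = r' := by
  refine eq_of_signs hr hr' (fun j hj => ?_) fun t ht => ?_
  · have h1 := h.2.1 j hj
    have h2 := h'.2.1 j hj
    constructor
    · intro h3
      by_contra h4
      linarith [h1.1 h3, h2.2 h4]
    · intro h3
      by_contra h4
      linarith [h2.1 h3, h1.2 h4]
  · have h1 := h.2.2 t ht
    have h2 := h'.2.2 t ht
    constructor
    · intro h3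
      by_contra h4
      linarith [h1.1 h3, h2.2 h4]
    · intro h3
      by_contra h4
      linarith [h2.1 h3, h1.2 h4]

/-- The regions cover the complement of the curves. -/
theorem exists_mem_openCell (hp : p ∈ twoSphere) (hU : ∀ j ≤ D.N, D.capU j p ≠ 0)
    (hL : ∀ t ≤ D.q, D.capL t p ≠ 0) : ∃ r, D.Valid r ∧ p ∈ D.openCell r := by
  by_cases h : ∃ i ≤ D.N, 0 < D.capU i p
  · obtain ⟨i, hi, hip⟩ := h
    -- Lying in two neighbouring caps fixes all other signs, since non-neighbouring caps are
    -- disjoint and the circles of latitude avoid the overlaps.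
    have lens : ∀ i, i + 1 ≤ D.N → 0 < D.capU i p → 0 < D.capU (i + 1) p →
        ∃ r, D.Valid r ∧ p ∈ D.openCell r := by
      intro i hi h1 h2
      refine ⟨.lens i, hi, hp, fun j hj => ?_, fun t ht => ?_⟩
      · simp only [InU]
        constructor
        · rintro (rfl | rfl) <;> assumption
        · intro hj2
          rcases lt_trichotomy j i with h3 | h3 | h3
          · exact capU_neg_of_gt hp (by omega) hi h2.le
          · omega
          · exact capU_neg_of_lt hp (by omega) hj h1.le
      · simp only [InL]
        exact ⟨fun h => capL_pos_of_capU hp h ht h1.le,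
          fun h => capL_neg_of_capU hp (by omega) hi h2.le⟩
    by_cases h1 : i + 1 ≤ D.N ∧ 0 < D.capU (i + 1) p
    · exact lens i h1.1 hip h1.2
    by_cases h2 : ∃ k, i = k + 1 ∧ 0 < D.capU k p
    · obtain ⟨k, rfl, hk⟩ := h2
      exact lens k hi hk hip
    have hUi : ∀ j ≤ D.N, (j = i → 0 < D.capU j p) ∧ (¬ j = i → D.capU j p < 0) := by
      intro j hj
      refine ⟨fun h => h ▸ hip, fun h => lt_of_le_of_ne (not_lt.1 fun hj2 => ?_) (hU j hj)⟩
      rcases lt_trichotomy j i with h3 | h3 | h3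
      · rcases (show j + 1 < i ∨ i = j + 1 by omega) with h4 | h4
        · linarith [capU_neg_of_gt hp h4 hi hip.le]
        · exact h2 ⟨j, h4, hj2⟩
      · exact h h3
      · rcases (show i + 1 < j ∨ j = i + 1 by omega) with h4 | h4
        · linarith [capU_neg_of_lt hp h4 hj hip.le]
        · subst h4; exact h1 ⟨hj, hj2⟩
    by_cases h3 : ∃ t ≤ D.q, D.rung t = i
    · obtain ⟨t, ht, rfl⟩ := h3
      rcases lt_or_gt_of_ne (hL t ht) with h4 | h4
      · refine ⟨.up t, ht, hp, hUi, fun t' ht' => ?_⟩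
        simp only [InL]
        refine ⟨fun h => capL_pos_of_capU hp (D.strictMono h) ht' hip.le, fun h => ?_⟩
        rcases (not_lt.1 h).eq_or_lt with h5 | h5
        · rwa [h5]
        · exact capL_neg_of_capL hp h5 ht h4.le
      · refine ⟨.low t, ht, hp, hUi, fun t' ht' => ?_⟩
        simp only [InL]
        refine ⟨fun h => ?_, fun h => capL_neg_of_capU hp (D.strictMono (by omega)) hi hip.le⟩
        rcases h.eq_or_lt with h5 | h5
        · rwa [← h5]
        · exact capL_pos_of_capL hp h5 ht' h4.le
    · refine ⟨.whole i, ⟨hi, fun t ht h => h3 ⟨t, ht, h⟩⟩, hp, hUi, fun t ht => ?_⟩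
      simp only [InL]
      refine ⟨fun h => capL_pos_of_capU hp h ht hip.le, fun h => ?_⟩
      refine capL_neg_of_capU hp (lt_of_le_of_ne (not_lt.1 h) fun h4 => h3 ⟨t, ht, h4⟩) hi hip.le
  · have hUn : ∀ j ≤ D.N, D.capU j p < 0 := fun j hj =>
      lt_of_le_of_ne (not_lt.1 fun h2 => h ⟨j, hj, h2⟩) (hU j hj)
    -- The band is named by the first circle of latitude that has the point to its south; `q + 1`
    -- serves as a sentinel if there is none.
    have hex : ∃ t, t = D.q + 1 ∨ 0 < D.capL t p := ⟨_, Or.inl rfl⟩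
    classical
    have hmin := fun t (h : t < Nat.find hex) => Nat.find_min hex h
    refine ⟨.band (Nat.find hex), Nat.find_min' hex (Or.inl rfl), hp, fun j hj => ?_,
      fun t ht => ?_⟩
    · simp only [InU]
      exact ⟨False.elim, fun _ => hUn j hj⟩
    · simp only [InL]
      constructor
      · intro h1
        have h2 := (Nat.find_spec hex).resolve_left (by omega)
        rcases h1.eq_or_lt with h3 | h3
        · rwa [← h3]
        · exact capL_pos_of_capL hp h3 ht h2.le
      · intro h1
        have h2 := hmin t (not_le.1 h1)
        push Not at h2
        exact lt_of_le_of_ne h2.2 (hL t ht)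

end Ladder

/-! ### Arcs of the regions on the great circle; every region is a disk -/

namespace Ladder

variable (D : Ladder)

/-- The western end of the arc in which a region meets the great circle `y = 0`. -/
def lo : Cell → ℤ
  | .lens i => 6 * i + 6
  | .whole i => 6 * i + 2
  | .low t => if t = 0 then 0 else 6 * D.rung t + 2
  | .up t => 6 * D.rung t + 4
  | .band t => if t = D.q + 1 then -D.T else -(4 + 6 * D.rung t)

/-- The eastern end of the arc in which a region meets the great circle `y = 0`. -/
def hi : Cell → ℤ
  | .lens i => 6 * i + 8
  | .whole i => 6 * i + 6
  | .low t => 6 * D.rung t + 4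
  | .up t => if t = D.q then D.T else 6 * D.rung t + 6
  | .band t => if t = 0 then 0 else -(4 + 6 * D.rung (t - 1))

variable {D} {r : Cell}

theorem rung_le {t t' : ℕ} (h : t ≤ t') : D.rung t ≤ D.rung t' := D.strictMono.monotone h

theorem rung_lt {t t' : ℕ} (h : t < t') : D.rung t < D.rung t' := D.strictMono h

theorem rung_q : D.rung D.q = D.N := rfl

theorem T_eq : (D.T : ℤ) = 6 * D.N + 8 := by unfold T; push_cast; ring

theorem whole_bounds {i : ℕ} (hr : D.Valid (.whole i)) : 0 < i ∧ i < D.N := by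
  have h1 := hr.2 0 (Nat.zero_le _)
  have h2 := hr.2 D.q le_rfl
  rw [D.rung_zero] at h1
  rw [rung_q] at h2
  have := hr.1
  omega

theorem lo_hi_bounds (hr : D.Valid r) : -(D.T : ℤ) ≤ D.lo r ∧ D.lo r < D.hi r ∧ D.hi r ≤ D.T := by
  rw [T_eq]
  rcases r with i | i | t | t | t
  · simp only [Valid, lo, hi] at *; omega
  · have := whole_bounds hr
    simp only [lo, hi] at *; omega
  · have := D.rung_le_N hr
    simp only [lo, hi]
    split_ifs <;> omega
  · simp only [lo, hi]
    split_ifs with h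
    · rw [h, rung_q, T_eq]; omega
    · have := rung_lt (D := D) (lt_of_le_of_ne hr h)
      rw [rung_q] at this
      omega
  · simp only [lo, hi, T_eq]
    split_ifs with h1 h2 h2
    · omega
    · have := D.rung_le_N (show t - 1 ≤ D.q by omega); omega
    · subst h2; rw [D.rung_zero]; omega
    · have h3 := rung_lt (D := D) (show t - 1 < t by omega)
      have h4 : t ≤ D.q + 1 := hr
      have h5 := D.rung_le_N (show t ≤ D.q by omega)
      omega

/-- In integral angular units, the arc never passes over an end of a cap. Positive positions lie on
the side of the chain; bands have their arcs on the other half circle. -/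
theorem arc_capU (hr : D.Valid r) {j : ℕ} (hj : j ≤ D.N) :
    (D.InU r j → 6 * j ≤ D.lo r ∧ D.hi r ≤ 6 * j + 8) ∧
      (¬ D.InU r j → D.hi r ≤ 6 * j ∨ 6 * j + 8 ≤ D.lo r) := by
  rcases r with i | i | t | t | t
  · simp only [InU, lo, hi] at *; omega
  · simp only [InU, lo, hi] at *; omega
  · simp only [InU, lo, hi]
    split_ifs with h
    · subst h; rw [D.rung_zero]; omega
    · omega
  · simp only [InU, lo, hi]
    split_ifs with h
    · rw [h, rung_q, T_eq]; omega
    · omega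
  · refine ⟨False.elim, fun _ => Or.inl ?_⟩
    simp only [hi]
    split_ifs <;> omega

theorem arc_capL (hr : D.Valid r) {t : ℕ} (ht : t ≤ D.q) :
    (D.InL r t → -(4 + 6 * (D.rung t : ℤ)) ≤ D.lo r ∧ D.hi r ≤ 4 + 6 * D.rung t) ∧
      (¬ D.InL r t → 4 + 6 * (D.rung t : ℤ) ≤ D.lo r ∨ D.hi r ≤ -(4 + 6 * (D.rung t : ℤ))) := by
  rcases r with i | i | t' | t' | t'
  · simp only [InL, lo, hi] at *; omega
  · have := hr.2 t ht
    simp only [InL, lo, hi] at *; omega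
  · simp only [InL, lo, hi]
    rcases le_or_gt t' t with h1 | h1
    · have := rung_le (D := D) h1
      split_ifs <;> omega
    · have := rung_lt (D := D) h1
      split_ifs <;> omega
  · simp only [InL, lo, hi]
    rcases lt_or_ge t' t with h1 | h1
    · have := rung_lt (D := D) h1
      split_ifs <;> omega
    · have := rung_le (D := D) h1
      split_ifs <;> omega
  · simp only [InL, lo, hi]
    rcases le_or_gt t' t with h1 | h1
    · have := rung_le (D := D) h1
      split_ifs <;> omega
    · have := rung_le (D := D) (show t ≤ t' - 1 by omega)
      split_ifs <;> omega

/-- Every point of the open right half circle lies in a cap of the chain. -/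
theorem exists_capU_arc {x : ℝ} (h0 : 0 < x) (hT : x < D.T) :
    ∃ j ≤ D.N, 6 * (j : ℝ) < x ∧ x < 6 * j + 8 := by
  rw [cast_T] at hT
  rcases lt_or_ge (6 * (D.N : ℝ)) x with h | h
  · exact ⟨D.N, le_rfl, h, hT⟩
  obtain ⟨j, hj1, hj2⟩ : ∃ j : ℕ, 6 * (j : ℝ) < x ∧ x ≤ 6 * j + 6 := by
    have h1 : 0 < ⌈x / 6⌉₊ := Nat.ceil_pos.2 (by positivity)
    have h2 := Nat.ceil_lt_add_one (show 0 ≤ x / 6 by positivity)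
    have h3 := Nat.le_ceil (x / 6)
    obtain ⟨k, hk⟩ := Nat.exists_eq_succ_of_ne_zero h1.ne'
    rw [hk] at h2 h3
    push_cast at h2 h3
    exact ⟨k, by linarith, by linarith⟩
  refine ⟨j, ?_, hj1, by linarith⟩
  have : (j : ℝ) ≤ D.N := by linarith
  exact_mod_cast this

/-- A point of the great circle `y = 0` in a closed region lies in the arc of the region. -/
theorem mem_arc_of_signs (hr : D.Valid r) {x : ℝ} (h1 : -(D.T : ℝ) < x) (h2 : x ≤ D.T)
    (hU : ∀ j ≤ D.N, (D.InU r j → 6 * (j : ℝ) ≤ x ∧ x ≤ 6 * j + 8) ∧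
      (¬ D.InU r j → ¬ (6 * (j : ℝ) < x ∧ x < 6 * j + 8)))
    (hL : ∀ t ≤ D.q, (D.InL r t → -(4 + 6 * (D.rung t : ℝ)) ≤ x ∧ x ≤ 4 + 6 * D.rung t) ∧
      (¬ D.InL r t → ¬ (-(4 + 6 * (D.rung t : ℝ)) < x ∧ x < 4 + 6 * D.rung t))) :
    ((D.lo r : ℝ) ≤ x ∧ x ≤ D.hi r) ∨ ((D.lo r : ℝ) = -D.T ∧ x = D.T) := by
  rcases r with i | i | t | t | t
  · simp only [Valid] at hr
    have a1 := (hU i (by omega)).1 (Or.inl rfl)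
    have a2 := (hU (i + 1) (by omega)).1 (Or.inr rfl)
    left
    simp only [lo, hi]
    push_cast at a2 ⊢
    constructor <;> linarith
  · obtain ⟨b1, b2⟩ := whole_bounds hr
    have a1 := (hU i (by omega)).1 rfl
    have a2 := (hU (i + 1) (by omega)).2 (by simp [InU])
    obtain ⟨k, rfl⟩ := Nat.exists_eq_succ_of_ne_zero b1.ne'
    have a3 := (hU k (by omega)).2 (by simp [InU])
    left
    simp only [lo, hi]
    push_cast at a1 a2 a3 ⊢
    constructor
    · by_contra h; exact a3 ⟨by linarith, by linarith⟩
    · by_contra h; exact a2 ⟨by linarith, by linarith⟩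
  · have a1 := (hU _ (D.rung_le_N hr)).1 rfl
    have a2 := (hL t hr).1 le_rfl
    left
    simp only [lo, hi]
    split_ifs with h
    · subst h
      simp only [D.rung_zero] at a1 a2 ⊢
      push_cast at a1 a2 ⊢
      constructor <;> linarith
    · have b := rung_lt (D := D) (Nat.pos_of_ne_zero h)
      rw [D.rung_zero] at b
      have b2 := D.rung_le_N hr
      obtain ⟨k, hk⟩ := Nat.exists_eq_succ_of_ne_zero b.ne'
      have a3 := (hU k (by omega)).2 (by simp only [InU]; omega)
      rw [hk] at a1 a2 ⊢
      push_cast at a1 a2 a3 ⊢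
      refine ⟨?_, by linarith⟩
      by_contra h; exact a3 ⟨by linarith, by linarith⟩
  · have a1 := (hU _ (D.rung_le_N hr)).1 rfl
    have a2 := (hL t hr).2 (by simp [InL])
    have a4 : (0 : ℝ) ≤ D.rung t := by positivity
    left
    simp only [lo, hi]
    constructor
    · push_cast
      by_contra h; exact a2 ⟨by linarith, by linarith⟩
    split_ifs with h
    · exact_mod_cast h2
    · have b := rung_lt (D := D) (lt_of_le_of_ne hr h)
      rw [rung_q] at b
      have a3 := (hU (D.rung t + 1) (by omega)).2 (by simp [InU])
      push_cast at a3 ⊢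
      by_contra h; exact a3 ⟨by linarith, by linarith⟩
  · have hx : x ≤ 0 ∨ x = D.T := by
      by_contra hc
      push Not at hc
      obtain ⟨j, hj, h3⟩ := exists_capU_arc hc.1 (lt_of_le_of_ne h2 hc.2)
      exact (hU j hj).2 (by simp [InU]) h3
    have hhi : x ≤ 0 → x ≤ (D.hi (.band t) : ℝ) := by
      intro hx0
      simp only [hi]
      split_ifs with h
      · simpa using hx0
      · have ht : t - 1 ≤ D.q := by simp only [Valid] at hr; omega
        have a1 := (hL (t - 1) ht).2 (by simp only [InL]; omega)
        have a4 : (0 : ℝ) ≤ D.rung (t - 1) := by positivity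
        push_cast
        by_contra h; exact a1 ⟨by linarith, by linarith⟩
    by_cases ht : t = D.q + 1
    · have e : D.lo (.band t) = -D.T := by simp only [lo, if_pos ht]
      rw [e]
      push_cast
      rcases hx with hx | hx
      · exact Or.inl ⟨h1.le, hhi hx⟩
      · exact Or.inr ⟨rfl, hx⟩
    · have e : D.lo (.band t) = -(4 + 6 * D.rung t) := by simp only [lo, if_neg ht]
      have ht' : t ≤ D.q := by simp only [Valid] at hr; omega
      have a1 := (hL t ht').1 le_rfl
      rcases hx with hx | hx
      · left; rw [e]; push_cast; exact ⟨a1.1, hhi hx⟩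
      · exfalso
        have : (D.rung t : ℝ) ≤ D.N := by exact_mod_cast D.rung_le_N ht'
        rw [hx, cast_T] at a1
        linarith [a1.2]

section Angles

variable {k h x lo hi : ℝ}

theorem sub_mul_unit (x k : ℝ) : x * D.unit - k * D.unit = (x - k) * D.unit := by ring

theorem cos_mul_unit_lt {x y : ℝ} (hx : |x| < y) (hy : y ≤ D.T) :
    Real.cos (y * D.unit) < Real.cos (x * D.unit) := by
  rw [← Real.cos_abs (x * D.unit), abs_mul, abs_of_pos D.unit_pos]
  exact Real.cos_lt_cos_of_nonneg_of_le_pi (mul_nonneg (abs_nonneg _) D.unit_pos.le)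
    (mul_unit_le_pi hy) (mul_lt_mul_of_pos_right hx D.unit_pos)

theorem cos_mul_unit_le {x y : ℝ} (hx : |x| ≤ y) (hy : y ≤ D.T) :
    Real.cos (y * D.unit) ≤ Real.cos (x * D.unit) := by
  rcases hx.eq_or_lt with h | h
  · rw [← h, ← Real.cos_abs (x * D.unit), abs_mul, abs_of_pos D.unit_pos]
  · exact (cos_mul_unit_lt h hy).le

theorem cos_add_two_T (x : ℝ) : Real.cos ((x + 2 * D.T) * D.unit) = Real.cos (x * D.unit) := by
  have : (x + 2 * D.T) * D.unit = x * D.unit + 2 * Real.pi := by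
    rw [← D.T_mul_unit]; ring
  rw [this, Real.cos_add_two_pi]

theorem cos_add_T (x : ℝ) : Real.cos ((x + D.T) * D.unit) = -Real.cos (x * D.unit) := by
  rw [add_mul, D.T_mul_unit, Real.cos_add_pi]

theorem cos_sub_T (x : ℝ) : Real.cos ((x - D.T) * D.unit) = -Real.cos (x * D.unit) := by
  rw [sub_mul, D.T_mul_unit, Real.cos_sub_pi]

theorem cos_T_sub (x : ℝ) : Real.cos ((D.T - x) * D.unit) = -Real.cos (x * D.unit) := by
  rw [sub_mul, D.T_mul_unit, Real.cos_pi_sub]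

/-- The cosine fixes the position relative to the centre only up to full turns. If `|x - k|` exceeds
half a turn, adding `2 * T` brings `x - k` to an angle still larger than `h` and at most `T`. -/
theorem mem_arc_of_cos (hk : 0 ≤ k) (hh : 0 < h) (hkh : k + h ≤ D.T) (h1 : -(D.T : ℝ) < x)
    (h2 : x ≤ D.T) (hc : 0 ≤ Real.cos ((x - k) * D.unit) - Real.cos (h * D.unit)) :
    k - h ≤ x ∧ x ≤ k + h := by
  suffices |x - k| ≤ h by
    rw [abs_le] at this
    constructor <;> linarith
  by_contra hlt
  rw [not_le] at hlt
  rcases le_or_gt |x - k| D.T with h3 | h3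
  · have := cos_mul_unit_lt (D := D) (x := h) (y := |x - k|) (by rwa [abs_of_pos hh]) h3
    have h4 : Real.cos (|x - k| * D.unit) = Real.cos ((x - k) * D.unit) := by
      rw [← Real.cos_abs ((x - k) * D.unit), abs_mul, abs_of_pos D.unit_pos]
    linarith
  · have h4 : x - k < -D.T := by
      rcases lt_abs.1 h3 with h5 | h5 <;> linarith
    have := cos_mul_unit_lt (D := D) (x := h) (y := x - k + 2 * D.T)
      (by rw [abs_of_pos hh]; linarith) (by linarith)
    rw [cos_add_two_T] at this
    linarith

theorem not_mem_arc_of_cos (hhT : h ≤ D.T)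
    (hc : Real.cos ((x - k) * D.unit) - Real.cos (h * D.unit) ≤ 0) :
    ¬ (k - h < x ∧ x < k + h) := by
  rintro ⟨h1, h2⟩
  have := cos_mul_unit_lt (D := D) (x := x - k) (y := h) (by rw [abs_lt]; constructor <;> linarith) hhT
  linarith

/-- The point of the arc from `lo` to `hi` in the middle, and the pole of the arc, are on the
inner side of a circle such that the arc is inside. -/
theorem inner_side (hlt : lo < hi) (hh : h ≤ D.T) (h1 : k - h ≤ lo) (h2 : hi ≤ k + h) :
    0 < Real.cos (((lo + hi) / 2 - k) * D.unit) - Real.cos (h * D.unit) ∧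
    0 ≤ Real.cos (((lo + hi) / 2 - k) * D.unit) -
      Real.cos ((hi - lo) / 2 * D.unit) * Real.cos (h * D.unit) := by
  have habs : |(lo + hi) / 2 - k| ≤ h - (hi - lo) / 2 := by
    rw [abs_le]; constructor <;> linarith
  constructor
  · have := cos_mul_unit_lt (D := D) (lt_of_le_of_lt habs (by linarith)) hh
    linarith
  · have := pole_in_cap (a := k * D.unit) (φ := (lo + hi) / 2 * D.unit) (h := h * D.unit)
      (ψ := (hi - lo) / 2 * D.unit) (mul_nonneg (by linarith) D.unit_pos.le) (mul_unit_le_pi hh)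
      (by
        rw [abs_mul_unit, ← add_mul]
        exact mul_le_mul_of_nonneg_right (by linarith) D.unit_pos.le)
    rwa [sub_mul_unit] at this

theorem outer_side (hlt : lo < hi) (hh : 0 ≤ h) (hkh : k + h ≤ D.T) (hkh' : -(D.T : ℝ) ≤ k - h)
    (hlo : -(D.T : ℝ) ≤ lo) (hhi : hi ≤ D.T) (h1 : hi ≤ k - h ∨ k + h ≤ lo) :
    Real.cos (((lo + hi) / 2 - k) * D.unit) - Real.cos (h * D.unit) < 0 ∧
    Real.cos (((lo + hi) / 2 - k) * D.unit) -
      Real.cos ((hi - lo) / 2 * D.unit) * Real.cos (h * D.unit) ≤ 0 := by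
  rcases h1 with h1 | h1
  · obtain ⟨a1, a2⟩ := inner_side (D := D) (k := k - D.T) (h := D.T - h) hlt (by linarith)
      (by linarith) (by linarith)
    have e : (lo + hi) / 2 - (k - D.T) = (lo + hi) / 2 - k + D.T := by ring
    rw [e, cos_add_T, cos_T_sub] at a1 a2
    constructor <;> linarith
  · obtain ⟨a1, a2⟩ := inner_side (D := D) (k := k + D.T) (h := D.T - h) hlt (by linarith)
      (by linarith) (by linarith)
    have e : (lo + hi) / 2 - (k + D.T) = (lo + hi) / 2 - k - D.T := by ring
    rw [e, cos_sub_T, cos_T_sub] at a1 a2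
    constructor <;> linarith

end Angles

theorem capU_meridianPt (j : ℕ) (x : ℝ) : D.capU j (meridianPt (x * D.unit)) =
    Real.cos ((x - (4 + 6 * j)) * D.unit) - Real.cos (4 * D.unit) := by
  unfold capU cap
  rw [capF_meridianPt, sub_mul_unit]

theorem capL_meridianPt (t : ℕ) (x : ℝ) : D.capL t (meridianPt (x * D.unit)) =
    Real.cos ((x - 0) * D.unit) - Real.cos ((4 + 6 * D.rung t) * D.unit) := by
  unfold capL cap
  rw [capF_meridianPt, sub_mul_unit]

theorem midpoint_mem_openCell (hr : D.Valid r) :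
    meridianPt (((D.lo r : ℝ) + D.hi r) / 2 * D.unit) ∈ D.openCell r := by
  obtain ⟨b1, b2, b3⟩ := lo_hi_bounds hr
  have b1' : -(D.T : ℝ) ≤ D.lo r := by exact_mod_cast b1
  have b2' : (D.lo r : ℝ) < D.hi r := by exact_mod_cast b2
  have b3' : (D.hi r : ℝ) ≤ D.T := by exact_mod_cast b3
  refine ⟨meridianPt_mem _, fun j hj => ?_, fun t ht => ?_⟩
  · have hjN : (j : ℝ) ≤ D.N := by exact_mod_cast hj
    have hj0 : (0 : ℝ) ≤ j := by positivity
    have hT := cast_T (D := D)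
    rw [capU_meridianPt]
    constructor
    · intro h
      obtain ⟨c1, c2⟩ := (arc_capU hr hj).1 h
      have c1' : 6 * (j : ℝ) ≤ D.lo r := by exact_mod_cast c1
      have c2' : (D.hi r : ℝ) ≤ 6 * j + 8 := by exact_mod_cast c2
      exact (inner_side b2' (by linarith) (by linarith) (by linarith)).1
    · intro h
      refine (outer_side b2' (by norm_num) (by linarith) (by linarith) b1' b3' ?_).1
      rcases (arc_capU hr hj).2 h with c | c
      · have c' : (D.hi r : ℝ) ≤ 6 * j := by exact_mod_cast c
        left; linarith
      · have c' : 6 * (j : ℝ) + 8 ≤ D.lo r := by exact_mod_cast c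
        right; linarith
  · have htN : (D.rung t : ℝ) ≤ D.N := by exact_mod_cast D.rung_le_N ht
    have ht0 : (0 : ℝ) ≤ D.rung t := by positivity
    have hT := cast_T (D := D)
    rw [capL_meridianPt]
    constructor
    · intro h
      obtain ⟨c1, c2⟩ := (arc_capL hr ht).1 h
      have c1' : -(4 + 6 * (D.rung t : ℝ)) ≤ D.lo r := by exact_mod_cast c1
      have c2' : (D.hi r : ℝ) ≤ 4 + 6 * D.rung t := by exact_mod_cast c2
      exact (inner_side b2' (by linarith) (by linarith) (by linarith)).1
    · intro h
      refine (outer_side b2' (by positivity) (by linarith) (by linarith) b1' b3' ?_).1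
      rcases (arc_capL hr ht).2 h with c | c
      · have c' : 4 + 6 * (D.rung t : ℝ) ≤ D.lo r := by exact_mod_cast c
        right; linarith
      · have c' : (D.hi r : ℝ) ≤ -(4 + 6 * (D.rung t : ℝ)) := by exact_mod_cast c
        left; linarith

/-- The arc hypothesis of the disk criterion: the right side is the cosine of the angle from `p` to
the midpoint of the arc, the left side that of half its length. -/
theorem arc_of_mem_closedCell (hr : D.Valid r) {p : E3} (hp : p ∈ D.closedCell r) (h1 : p 1 = 0) :
    Real.cos (((D.hi r : ℝ) - D.lo r) / 2 * D.unit) ≤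
      Real.sin (((D.lo r : ℝ) + D.hi r) / 2 * D.unit) * p 0 -
        Real.cos (((D.lo r : ℝ) + D.hi r) / 2 * D.unit) * p 2 := by
  obtain ⟨b1, b2, b3⟩ := lo_hi_bounds hr
  have b1' : -(D.T : ℝ) ≤ D.lo r := by exact_mod_cast b1
  have b2' : (D.lo r : ℝ) < D.hi r := by exact_mod_cast b2
  have b3' : (D.hi r : ℝ) ≤ D.T := by exact_mod_cast b3
  obtain ⟨hp0, hpU, hpL⟩ := hp
  obtain ⟨θ, ⟨hθ1, hθ2⟩, rfl⟩ := exists_meridianPt_eq hp0 h1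
  obtain ⟨x, rfl⟩ : ∃ x, θ = x * D.unit := ⟨θ / D.unit, by have := D.unit_pos; field_simp⟩
  have hu := D.unit_pos
  have hT := cast_T (D := D)
  have hx1 : -(D.T : ℝ) < x := by
    rw [← D.T_mul_unit, ← neg_mul] at hθ1
    exact lt_of_mul_lt_mul_right hθ1 hu.le
  have hx2 : x ≤ D.T := by
    rw [← D.T_mul_unit] at hθ2
    exact le_of_mul_le_mul_right hθ2 hu
  have key : ((D.lo r : ℝ) ≤ x ∧ x ≤ D.hi r) ∨ ((D.lo r : ℝ) = -D.T ∧ x = D.T) := by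
    refine mem_arc_of_signs hr hx1 hx2 (fun j hj => ?_) fun t ht => ?_
    · have hjN : (j : ℝ) ≤ D.N := by exact_mod_cast hj
      have hj0 : (0 : ℝ) ≤ j := by positivity
      have := hpU j hj
      rw [capU_meridianPt] at this
      refine ⟨fun h => ?_, fun h hx => ?_⟩
      · obtain ⟨c1, c2⟩ := mem_arc_of_cos (by positivity) (by norm_num) (by linarith) hx1 hx2
          (this.1 h)
        constructor <;> linarith
      · exact not_mem_arc_of_cos (by linarith) (this.2 h) ⟨by linarith, by linarith⟩
    · have htN : (D.rung t : ℝ) ≤ D.N := by exact_mod_cast D.rung_le_N ht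
      have ht0 : (0 : ℝ) ≤ D.rung t := by positivity
      have := hpL t ht
      rw [capL_meridianPt] at this
      refine ⟨fun h => ?_, fun h hx => ?_⟩
      · obtain ⟨c1, c2⟩ := mem_arc_of_cos le_rfl (by positivity) (by linarith) hx1 hx2 (this.1 h)
        constructor <;> linarith
      · exact not_mem_arc_of_cos (by linarith) (this.2 h) ⟨by linarith, by linarith⟩
  have e := capF_meridianPt (((D.lo r : ℝ) + D.hi r) / 2 * D.unit) 0 (x * D.unit)
  rw [sub_mul_unit] at e
  unfold capF at e
  have e2 : Real.cos (((D.hi r : ℝ) - D.lo r) / 2 * D.unit) ≤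
      Real.cos ((x - ((D.lo r : ℝ) + D.hi r) / 2) * D.unit) := by
    rcases key with ⟨k1, k2⟩ | ⟨k1, k2⟩
    · exact cos_mul_unit_le (by rw [abs_le]; constructor <;> linarith) (by linarith)
    · rw [show x - ((D.lo r : ℝ) + D.hi r) / 2 =
        -((D.hi r : ℝ) - D.lo r) / 2 + 2 * D.T by rw [k2, k1]; ring, cos_add_two_T]
      refine cos_mul_unit_le ?_ (by linarith)
      rw [neg_div, abs_neg, abs_of_pos (by linarith)]
  linarith

open Classical in
/-- The sign of a region with respect to a curve. -/
noncomputable def sgn (P : Prop) : ℝ := if P then 1 else -1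

theorem sgn_mul_nonneg {P : Prop} {y : ℝ} :
    0 ≤ sgn P * y ↔ (P → 0 ≤ y) ∧ (¬ P → y ≤ 0) := by
  unfold sgn
  by_cases h : P <;> simp [h]

theorem sgn_mul_pos {P : Prop} {y : ℝ} :
    0 < sgn P * y ↔ (P → 0 < y) ∧ (¬ P → y < 0) := by
  unfold sgn
  by_cases h : P <;> simp [h]

variable (D) in
/-- The sign, the centre and the angular radius for each curve. -/
noncomputable def signData (r : Cell) : Fin (D.N + 1) ⊕ Fin (D.q + 1) → ℝ × ℝ × ℝ
  | .inl j => (sgn (D.InU r j), (4 + 6 * (j : ℕ)) * D.unit, 4 * D.unit)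
  | .inr t => (sgn (D.InL r t), 0 * D.unit, (4 + 6 * D.rung t) * D.unit)

theorem mem_closedCell_iff {p : E3} : p ∈ D.closedCell r ↔ p ∈ twoSphere ∧
    ∀ c, 0 ≤ (D.signData r c).1 * capF (D.signData r c).2.1 (D.signData r c).2.2 p := by
  refine and_congr_right fun _ => ?_
  rw [Sum.forall]
  simp only [signData, sgn_mul_nonneg]
  refine and_congr ⟨fun h j => h j (by omega), fun h j hj => h ⟨j, by omega⟩⟩
    ⟨fun h t => h t (by omega), fun h t ht => h ⟨t, by omega⟩⟩

theorem mem_openCell_iff {p : E3} : p ∈ D.openCell r ↔ p ∈ twoSphere ∧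
    ∀ c, 0 < (D.signData r c).1 * capF (D.signData r c).2.1 (D.signData r c).2.2 p := by
  refine and_congr_right fun _ => ?_
  rw [Sum.forall]
  simp only [signData, sgn_mul_pos]
  refine and_congr ⟨fun h j => h j (by omega), fun h j hj => h ⟨j, by omega⟩⟩
    ⟨fun h t => h t (by omega), fun h t ht => h ⟨t, by omega⟩⟩

theorem pole_nonneg (hr : D.Valid r) (c : Fin (D.N + 1) ⊕ Fin (D.q + 1)) :
    0 ≤ (D.signData r c).1 *
      (Real.cos (((D.lo r : ℝ) + D.hi r) / 2 * D.unit - (D.signData r c).2.1) -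
      Real.cos (((D.hi r : ℝ) - D.lo r) / 2 * D.unit) * Real.cos (D.signData r c).2.2) := by
  obtain ⟨b1, b2, b3⟩ := lo_hi_bounds hr
  have b1' : -(D.T : ℝ) ≤ D.lo r := by exact_mod_cast b1
  have b2' : (D.lo r : ℝ) < D.hi r := by exact_mod_cast b2
  have b3' : (D.hi r : ℝ) ≤ D.T := by exact_mod_cast b3
  have hT := cast_T (D := D)
  rcases c with ⟨j, hj⟩ | ⟨t, ht⟩
  · simp only [signData]
    rw [sgn_mul_nonneg, sub_mul_unit]
    have hj : j ≤ D.N := by omega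
    have hjN : (j : ℝ) ≤ D.N := by exact_mod_cast hj
    have hj0 : (0 : ℝ) ≤ j := by positivity
    constructor
    · intro h
      obtain ⟨c1, c2⟩ := (arc_capU hr hj).1 h
      have c1' : 6 * (j : ℝ) ≤ D.lo r := by exact_mod_cast c1
      have c2' : (D.hi r : ℝ) ≤ 6 * j + 8 := by exact_mod_cast c2
      exact (inner_side b2' (by linarith) (by linarith) (by linarith)).2
    · intro h
      refine (outer_side b2' (by norm_num) (by linarith) (by linarith) b1' b3' ?_).2
      rcases (arc_capU hr hj).2 h with c | c
      · have c' : (D.hi r : ℝ) ≤ 6 * j := by exact_mod_cast c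
        left; linarith
      · have c' : 6 * (j : ℝ) + 8 ≤ D.lo r := by exact_mod_cast c
        right; linarith
  · simp only [signData]
    rw [sgn_mul_nonneg, sub_mul_unit]
    have ht : t ≤ D.q := by omega
    have htN : (D.rung t : ℝ) ≤ D.N := by exact_mod_cast D.rung_le_N ht
    have ht0 : (0 : ℝ) ≤ D.rung t := by positivity
    constructor
    · intro h
      obtain ⟨c1, c2⟩ := (arc_capL hr ht).1 h
      have c1' : -(4 + 6 * (D.rung t : ℝ)) ≤ D.lo r := by exact_mod_cast c1
      have c2' : (D.hi r : ℝ) ≤ 4 + 6 * D.rung t := by exact_mod_cast c2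
      exact (inner_side b2' (by linarith) (by linarith) (by linarith)).2
    · intro h
      refine (outer_side b2' (by positivity) (by linarith) (by linarith) b1' b3' ?_).2
      rcases (arc_capL hr ht).2 h with c | c
      · have c' : 4 + 6 * (D.rung t : ℝ) ≤ D.lo r := by exact_mod_cast c
        right; linarith
      · have c' : (D.hi r : ℝ) ≤ -(4 + 6 * (D.rung t : ℝ)) := by exact_mod_cast c
        left; linarith

/-- Every region is an open disk, and its closure is a closed disk. -/
theorem exists_disk_param (hr : D.Valid r) :
    ∃ f : ℂ → E3, ContinuousOn f (Metric.closedBall 0 1) ∧ Set.InjOn f (Metric.closedBall 0 1) ∧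
      f '' Metric.closedBall 0 1 = D.closedCell r ∧ f '' Metric.ball 0 1 = D.openCell r := by
  obtain ⟨b1, b2, b3⟩ := lo_hi_bounds hr
  have b1' : -(D.T : ℝ) ≤ D.lo r := by exact_mod_cast b1
  have b2' : (D.lo r : ℝ) < D.hi r := by exact_mod_cast b2
  have b3' : (D.hi r : ℝ) ≤ D.T := by exact_mod_cast b3
  -- The arc is not the whole great circle, because it lies on one side of cap `0`.
  have hnarrow : ((D.hi r : ℝ) - D.lo r) / 2 < D.T := by
    have h1 : (D.hi r : ℝ) - D.lo r < 2 * D.T := by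
      by_contra hc
      have e1 : (D.lo r : ℝ) = -D.T := by linarith
      have e2 : (D.hi r : ℝ) = D.T := by linarith
      have e1' : D.lo r = -D.T := by exact_mod_cast e1
      have e2' : D.hi r = D.T := by exact_mod_cast e2
      have := arc_capU hr (Nat.zero_le D.N)
      rw [e1', e2', T_eq] at this
      by_cases h : D.InU r 0
      · have := this.1 h; omega
      · have := this.2 h; omega
    linarith
  have hform : ∀ (p : E3) c, (D.signData r c).1 * Real.sin (D.signData r c).2.1 * p 0 +
      -((D.signData r c).1 * Real.cos (D.signData r c).2.1) * p 2 +
        -((D.signData r c).1 * Real.cos (D.signData r c).2.2) =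
      (D.signData r c).1 * capF (D.signData r c).2.1 (D.signData r c).2.2 p := by
    intro p c; unfold capF; ring
  obtain ⟨f, h1, h2, h3, h4⟩ := _root_.exists_disk_param
    (fun c => (D.signData r c).1 * Real.sin (D.signData r c).2.1)
    (fun c => -((D.signData r c).1 * Real.cos (D.signData r c).2.1))
    (fun c => -((D.signData r c).1 * Real.cos (D.signData r c).2.2))
    (φ := ((D.lo r : ℝ) + D.hi r) / 2 * D.unit) (ψ := ((D.hi r : ℝ) - D.lo r) / 2 * D.unit)
    (mul_pos (by linarith) D.unit_pos) (mul_unit_lt_pi hnarrow)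
    (fun c => by
      have := pole_nonneg hr c
      rw [Real.cos_sub] at this
      linarith)
    (fun p hp hp1 hc => by
      refine arc_of_mem_closedCell hr (mem_closedCell_iff.2 ⟨hp, fun c => ?_⟩) hp1
      rw [← hform]; exact hc c)
    ⟨_, meridianPt_mem _, fun c => by
      rw [hform]; exact (mem_openCell_iff.1 (midpoint_mem_openCell hr)).2 c⟩
  refine ⟨f, h1, h2, ?_, ?_⟩
  · rw [h3]; ext p; rw [mem_closedCell_iff]
    exact and_congr_right fun _ => forall_congr' fun c => by rw [hform]
  · rw [h4]; ext p; rw [mem_openCell_iff]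
    exact and_congr_right fun _ => forall_congr' fun c => by rw [hform]

end Ladder

/-! ### Crossings and prong numbers -/

namespace Ladder

variable (D : Ladder)

/-- The crossings come in mirror pairs. The pair `inl i` lies on the caps `i` and `i + 1`, and the
pair `inr t` on the circle of latitude with number `t` and the cap with its centre there. -/
def PairValid : ℕ ⊕ ℕ → Prop
  | .inl i => i < D.N
  | .inr t => t ≤ D.q

/-- Whether a point of the sphere belongs to a given pair of crossings. -/
def OnPair : ℕ ⊕ ℕ → E3 → Prop
  | .inl i, p => D.capU i p = 0 ∧ D.capU (i + 1) p = 0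
  | .inr t, p => D.capU (D.rung t) p = 0 ∧ D.capL t p = 0

/-- The pairs of crossings in the closure of a region. -/
def cellPairs : Cell → Finset (ℕ ⊕ ℕ)
  | .lens i => Finset.disjSum {i} ∅
  | .whole i => Finset.disjSum {i - 1, i} ∅
  | .low t => Finset.disjSum (Finset.Ico (D.rung t - 1) (D.rung t)) {t}
  | .up t => Finset.disjSum (Finset.Ico (D.rung t) (min (D.rung t + 1) D.N)) {t}
  | .band t => Finset.disjSum (Finset.Ico (D.rung (t - 1)) (min (D.rung t) D.N))
      (Finset.Icc (t - 1) (min t D.q))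

variable {D} {r : Cell} {p : E3}

theorem arcsCross_capU {i : ℕ} (hi : i < D.N) :
    ArcsCross ((4 + 6 * i) * D.unit) (4 * D.unit) ((4 + 6 * (i + 1 : ℕ)) * D.unit)
      (4 * D.unit) := by
  have hN : (1 : ℝ) ≤ D.N := by exact_mod_cast (by omega : 1 ≤ D.N)
  have hT := cast_T (D := D)
  unfold ArcsCross
  rw [show 4 * D.unit + ((4 + 6 * (i + 1 : ℕ)) * D.unit - (4 + 6 * i) * D.unit) = 10 * D.unit by
      push_cast; ring,
    show 4 * D.unit - ((4 + 6 * (i + 1 : ℕ)) * D.unit - (4 + 6 * i) * D.unit) = -2 * D.unit by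
      push_cast; ring]
  -- The ends of the arc of cap `i` are `10` and `2` units from the centre of cap `i + 1`, whose
  -- radius is `4`. Here `10 ≤ T` needs `N ≥ 1`.
  have h1 := cos_mul_unit_lt (D := D) (x := 4) (y := 10) (by norm_num) (by linarith)
  have h2 := cos_mul_unit_lt (D := D) (x := -2) (y := 4) (by norm_num) (by linarith)
  exact mul_neg_of_neg_of_pos (by linarith) (by linarith)

theorem arcsCross_capL {t : ℕ} (ht : t ≤ D.q) :
    ArcsCross ((4 + 6 * D.rung t) * D.unit) (4 * D.unit) (0 * D.unit)
      ((4 + 6 * D.rung t) * D.unit) := by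
  have htN : (D.rung t : ℝ) ≤ D.N := by exact_mod_cast D.rung_le_N ht
  have ht0 : (0 : ℝ) ≤ D.rung t := by positivity
  have hT := cast_T (D := D)
  unfold ArcsCross
  rw [show 4 * D.unit + (0 * D.unit - (4 + 6 * D.rung t) * D.unit) = (-(6 * D.rung t)) * D.unit by
      ring,
    show 4 * D.unit - (0 * D.unit - (4 + 6 * D.rung t) * D.unit) = (8 + 6 * D.rung t) * D.unit by
      ring]
  have h1 := cos_mul_unit_lt (D := D) (x := -(6 * D.rung t)) (y := 4 + 6 * D.rung t)
    (by rw [abs_neg, abs_of_nonneg (by positivity)]; linarith) (by linarith)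
  have h2 := cos_mul_unit_lt (D := D) (x := 4 + 6 * D.rung t) (y := 8 + 6 * D.rung t)
    (by rw [abs_of_nonneg (by positivity)]; linarith) (by linarith)
  exact mul_neg_of_pos_of_neg (by linarith) (by linarith)

theorem sin_mul_unit_ne_zero {h : ℝ} (h0 : 0 < h) (hT : h < D.T) : Real.sin (h * D.unit) ≠ 0 :=
  (Real.sin_pos_of_pos_of_lt_pi (mul_pos h0 D.unit_pos) (mul_unit_lt_pi hT)).ne'

theorem sin_four_ne_zero : Real.sin (4 * D.unit) ≠ 0 := by
  refine sin_mul_unit_ne_zero (by norm_num) ?_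
  rw [cast_T]
  have : (0 : ℝ) ≤ D.N := by positivity
  linarith

theorem sin_rung_ne_zero {t : ℕ} (ht : t ≤ D.q) :
    Real.sin ((4 + 6 * D.rung t) * D.unit) ≠ 0 := by
  have htN : (D.rung t : ℝ) ≤ D.N := by exact_mod_cast D.rung_le_N ht
  refine sin_mul_unit_ne_zero (by positivity) ?_
  rw [cast_T]
  linarith

theorem exists_pair_points {v : ℕ ⊕ ℕ} (hv : D.PairValid v) :
    ∃ s : Finset E3, s.card = 2 ∧ ∀ p, p ∈ s ↔ p ∈ twoSphere ∧ D.OnPair v p := by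
  classical
  have aux : ∀ a h a' h' : ℝ, Real.sin h ≠ 0 → ArcsCross a h a' h' →
      ∃ s : Finset E3, s.card = 2 ∧
        ∀ p, p ∈ s ↔ p ∈ twoSphere ∧ capF a h p = 0 ∧ capF a' h' p = 0 := by
    intro a h a' h' hs hx
    obtain ⟨x, y, z, hy, -, hp⟩ := hx.exists_points hs
    refine ⟨{!₂[x, y, z], !₂[x, -y, z]}, Finset.card_pair fun e => ?_, fun p => ?_⟩
    · have := congrArg (fun p : E3 => p 1) e
      simp at this
      linarith
    · rw [hp, Finset.mem_insert, Finset.mem_singleton]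
  rcases v with i | t
  · exact aux _ _ _ _ sin_four_ne_zero (arcsCross_capU hv)
  · exact aux _ _ _ _ sin_four_ne_zero (arcsCross_capL hv)

/-- At a crossing all curves except the two through it have definite nonzero signs. This separates
the pairs of crossings and decides which closed regions contain them. -/
theorem signs_inl (hp : p ∈ twoSphere) {i : ℕ} (hi : i < D.N) (h : D.OnPair (.inl i) p) :
    (∀ j ≤ D.N, j ≠ i → j ≠ i + 1 → D.capU j p < 0) ∧
      (∀ t ≤ D.q, i < D.rung t → 0 < D.capL t p) ∧
      ∀ t ≤ D.q, D.rung t ≤ i → D.capL t p < 0 := by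
  obtain ⟨h1, h2⟩ := h
  refine ⟨fun j hj hji hji' => ?_, fun t ht hit => capL_pos_of_capU hp hit ht h1.ge,
    fun t ht hit => capL_neg_of_capU hp (by omega) hi h2.ge⟩
  rcases lt_or_gt_of_ne hji with h3 | h3
  · exact capU_neg_of_gt hp (by omega) hi h2.ge
  · exact capU_neg_of_lt hp (by omega) hj h1.ge

theorem signs_inr (hp : p ∈ twoSphere) {t : ℕ} (ht : t ≤ D.q) (h : D.OnPair (.inr t) p) :
    (∀ j ≤ D.N, j ≠ D.rung t → D.capU j p < 0) ∧
      (∀ t' ≤ D.q, t < t' → 0 < D.capL t' p) ∧ ∀ t' ≤ D.q, t' < t → D.capL t' p < 0 := by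
  obtain ⟨h1, h2⟩ := h
  refine ⟨fun j hj hji => ?_, fun t' ht' h3 => capL_pos_of_capL hp h3 ht' h2.ge,
    fun t' _ h3 => capL_neg_of_capL hp h3 ht h2.le⟩
  by_contra hc
  rcases lt_or_gt_of_ne hji with h3 | h3
  · linarith [capL_pos_of_capU hp h3 ht (not_lt.1 hc)]
  · linarith [capL_neg_of_capU hp h3 hj (not_lt.1 hc)]

theorem eq_of_onPair (hp : p ∈ twoSphere) {v w : ℕ ⊕ ℕ} (hv : D.PairValid v) (hw : D.PairValid w)
    (h : D.OnPair v p) (h' : D.OnPair w p) : v = w := by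
  have mixed : ∀ i t, i < D.N → t ≤ D.q → D.OnPair (.inl i) p → D.OnPair (.inr t) p → False := by
    intro i t hi ht h h'
    obtain ⟨-, h1, h2⟩ := signs_inl hp hi h
    rcases lt_or_ge i (D.rung t) with h3 | h3
    · linarith [h1 t ht h3, h'.2]
    · linarith [h2 t ht h3, h'.2]
  rcases v with i | t <;> rcases w with i' | t'
  · obtain ⟨h1, -⟩ := signs_inl hp hv h
    simp only [PairValid] at hv hw
    congr 1
    by_contra hne
    by_cases h2 : i' = i + 1
    · linarith [h1 (i' + 1) (by omega) (by omega) (by omega), h'.2]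
    · linarith [h1 i' (by omega) (by omega) (by omega), h'.1]
  · exact (mixed _ _ hv hw h h').elim
  · exact (mixed _ _ hw hv h' h).elim
  · obtain ⟨-, h1, h2⟩ := signs_inr hp hv h
    congr 1
    by_contra hne
    rcases lt_or_gt_of_ne hne with h3 | h3
    · linarith [h1 t' hw h3, h'.2]
    · linarith [h2 t' hw h3, h'.2]

/-- The two vanishing functionals impose no condition, so membership is agreement of all the other
signs. All other caps are negative there, and no circle of latitude passes through. -/
theorem mem_closedCell_iff_inl (hp : p ∈ twoSphere) {i : ℕ} (hi : i < D.N)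
    (h : D.OnPair (.inl i) p) : p ∈ D.closedCell r ↔
      (∀ j ≤ D.N, D.InU r j → j = i ∨ j = i + 1) ∧ ∀ t ≤ D.q, (D.InL r t ↔ i < D.rung t) := by
  obtain ⟨s1, s2, s3⟩ := signs_inl hp hi h
  constructor
  · rintro ⟨-, hU, hL⟩
    refine ⟨fun j hj hj2 => ?_, fun t ht => ⟨fun h2 => ?_, fun h2 => ?_⟩⟩
    · by_contra hc
      linarith [(hU j hj).1 hj2, s1 j hj (by tauto) (by tauto)]
    · by_contra hc
      linarith [(hL t ht).1 h2, s3 t ht (not_lt.1 hc)]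
    · by_contra hc
      linarith [(hL t ht).2 hc, s2 t ht h2]
  · rintro ⟨hU, hL⟩
    refine ⟨hp, fun j hj => ⟨fun h2 => ?_, fun h2 => ?_⟩, fun t ht => ⟨fun h2 => ?_, fun h2 => ?_⟩⟩
    · rcases hU j hj h2 with rfl | rfl
      · exact h.1.ge
      · exact h.2.ge
    · by_cases h3 : j = i
      · rw [h3]; exact h.1.le
      by_cases h4 : j = i + 1
      · rw [h4]; exact h.2.le
      exact (s1 j hj h3 h4).le
    · exact (s2 t ht ((hL t ht).1 h2)).le
    · exact (s3 t ht (not_lt.1 fun h3 => h2 ((hL t ht).2 h3))).le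

theorem mem_closedCell_iff_inr (hp : p ∈ twoSphere) {t : ℕ} (ht : t ≤ D.q)
    (h : D.OnPair (.inr t) p) : p ∈ D.closedCell r ↔
      (∀ j ≤ D.N, D.InU r j → j = D.rung t) ∧
        ∀ t' ≤ D.q, (D.InL r t' → t ≤ t') ∧ (¬ D.InL r t' → t' ≤ t) := by
  obtain ⟨s1, s2, s3⟩ := signs_inr hp ht h
  constructor
  · rintro ⟨-, hU, hL⟩
    refine ⟨fun j hj hj2 => ?_, fun t' ht' => ⟨fun h2 => ?_, fun h2 => ?_⟩⟩
    · by_contra hc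
      linarith [(hU j hj).1 hj2, s1 j hj hc]
    · by_contra hc
      linarith [(hL t' ht').1 h2, s3 t' ht' (not_le.1 hc)]
    · by_contra hc
      linarith [(hL t' ht').2 h2, s2 t' ht' (not_le.1 hc)]
  · rintro ⟨hU, hL⟩
    refine ⟨hp, fun j hj => ⟨fun h2 => ?_, fun h2 => ?_⟩, fun t' ht' => ⟨fun h2 => ?_, fun h2 => ?_⟩⟩
    · rw [hU j hj h2]; exact h.1.ge
    · by_cases h3 : j = D.rung t
      · rw [h3]; exact h.1.le
      exact (s1 j hj h3).le
    · rcases ((hL t' ht').1 h2).eq_or_lt with h3 | h3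
      · rw [← h3]; exact h.2.ge
      · exact (s2 t' ht' h3).le
    · rcases ((hL t' ht').2 h2).eq_or_lt with h3 | h3
      · rw [h3]; exact h.2.le
      · exact (s3 t' ht' h3).le

/-- The purely combinatorial half of the corner count: the explicit finite sets solve the sign
conditions. -/
theorem mem_cellPairs_inl (hr : D.Valid r) {i : ℕ} (hi : i < D.N) :
    .inl i ∈ D.cellPairs r ↔
      (∀ j ≤ D.N, D.InU r j → j = i ∨ j = i + 1) ∧ ∀ t ≤ D.q, (D.InL r t ↔ i < D.rung t) := by
  rcases r with i' | i' | t' | t' | t' <;>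
    simp only [cellPairs, Finset.inl_mem_disjSum, Finset.mem_singleton, Finset.mem_insert,
      Finset.mem_Ico, lt_min_iff, InU, InL, Valid] at hr ⊢
  · constructor
    · rintro rfl
      exact ⟨fun j _ h => h, fun t _ => Iff.rfl⟩
    · rintro ⟨h, -⟩
      have h1 := h i' (by omega) (Or.inl rfl)
      have h2 := h (i' + 1) (by omega) (Or.inr rfl)
      omega
  · have hb := whole_bounds hr
    constructor
    · rintro (h | h)
      · refine ⟨fun j _ hj => by omega, fun t ht => ?_⟩
        have := hr.2 t ht
        omega
      · subst h
        exact ⟨fun j _ hj => by omega, fun t _ => Iff.rfl⟩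
    · rintro ⟨h, -⟩
      have h1 := h i' hr.1 rfl
      omega
  · constructor
    · rintro ⟨h1, h2⟩
      refine ⟨fun j _ hj => by omega, fun t ht => ?_⟩
      rcases le_or_gt t' t with h3 | h3
      · have := rung_le (D := D) h3
        exact iff_of_true h3 (by omega)
      · have := rung_lt (D := D) h3
        exact iff_of_false (by omega) (by omega)
    · rintro ⟨h1, h2⟩
      have h3 := h1 _ (D.rung_le_N hr) rfl
      have h4 := (h2 t' hr).1 le_rfl
      omega
  · constructor
    · rintro ⟨h1, h2⟩
      refine ⟨fun j _ hj => by omega, fun t ht => ?_⟩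
      rcases lt_or_ge t' t with h3 | h3
      · have := rung_lt (D := D) h3
        exact iff_of_true h3 (by omega)
      · have := rung_le (D := D) h3
        exact iff_of_false (by omega) (by omega)
    · rintro ⟨h1, h2⟩
      have h3 := h1 _ (D.rung_le_N hr) rfl
      have h4 := h2 t' hr
      have h5 : ¬ i < D.rung t' := fun h => lt_irrefl _ (h4.2 h)
      omega
  · constructor
    · rintro ⟨h1, h2, h3⟩
      refine ⟨fun j _ hj => hj.elim, fun t ht => ?_⟩
      rcases le_or_gt t' t with h3 | h3
      · have := rung_le (D := D) h3
        exact iff_of_true h3 (by omega)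
      · have := rung_le (D := D) (show t ≤ t' - 1 by omega)
        exact iff_of_false (by omega) (by omega)
    · rintro ⟨-, h2⟩
      refine ⟨?_, ?_, hi⟩
      · by_cases h0 : t' = 0
        · subst h0; simp [D.rung_zero]
        · have := h2 (t' - 1) (by omega)
          have h5 : ¬ i < D.rung (t' - 1) := fun h => by have := this.2 h; omega
          omega
      · by_cases h0 : t' ≤ D.q
        · exact (h2 t' h0).1 le_rfl
        · have := rung_lt (D := D) (not_le.1 h0)
          rw [rung_q] at this
          omega

theorem mem_cellPairs_inr (hr : D.Valid r) {t : ℕ} (ht : t ≤ D.q) :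
    .inr t ∈ D.cellPairs r ↔
      (∀ j ≤ D.N, D.InU r j → j = D.rung t) ∧
        ∀ t' ≤ D.q, (D.InL r t' → t ≤ t') ∧ (¬ D.InL r t' → t' ≤ t) := by
  rcases r with i' | i' | t' | t' | t' <;>
    simp only [cellPairs, Finset.inr_mem_disjSum, Finset.mem_singleton,
      Finset.notMem_empty, false_iff, Finset.mem_Icc, le_min_iff, InU, InL, Valid] at hr ⊢
  · rintro ⟨h, -⟩
    have h1 := h i' (by omega) (Or.inl rfl)
    have h2 := h (i' + 1) (by omega) (Or.inr rfl)
    omega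
  · rintro ⟨h, -⟩
    exact hr.2 t ht (h i' hr.1 rfl).symm
  · constructor
    · rintro rfl
      exact ⟨fun j _ h => h, fun t' _ => ⟨fun h => h, fun h => by omega⟩⟩
    · rintro ⟨h, -⟩
      exact (rung_inj (h _ (D.rung_le_N hr) rfl)).symm
  · constructor
    · rintro rfl
      exact ⟨fun j _ h => h, fun t' _ => ⟨fun h => by omega, fun h => by omega⟩⟩
    · rintro ⟨h, -⟩
      exact (rung_inj (h _ (D.rung_le_N hr) rfl)).symm
  · constructor
    · rintro ⟨h1, h2, -⟩
      exact ⟨fun j _ h => h.elim, fun t'' _ => ⟨fun h => by omega, fun h => by omega⟩⟩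
    · rintro ⟨-, h⟩
      refine ⟨?_, ?_, ht⟩
      · by_cases h0 : t' = 0
        · omega
        · have := (h (t' - 1) (by omega)).2 (by omega)
          exact this
      · by_cases h0 : t' ≤ D.q
        · exact (h t' h0).1 le_rfl
        · omega

theorem pairValid_of_mem (hr : D.Valid r) {v : ℕ ⊕ ℕ} (hv : v ∈ D.cellPairs r) :
    D.PairValid v := by
  rcases v with i | t <;> rcases r with i' | i' | t' | t' | t' <;>
    simp only [cellPairs, Finset.inl_mem_disjSum, Finset.inr_mem_disjSum, Finset.mem_singleton,
      Finset.mem_insert, Finset.notMem_empty, Finset.mem_Ico, Finset.mem_Icc, lt_min_iff,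
      le_min_iff, Valid, PairValid] at hr hv ⊢
  · omega
  · have := whole_bounds hr; omega
  · have := D.rung_le_N hr; omega
  · exact hv.2.2
  · exact hv.2.2
  · omega
  · omega
  · exact hv.2.2

theorem mem_closedCell_iff_mem_cellPairs (hr : D.Valid r) (hp : p ∈ twoSphere) {v : ℕ ⊕ ℕ}
    (hv : D.PairValid v) (h : D.OnPair v p) : p ∈ D.closedCell r ↔ v ∈ D.cellPairs r := by
  rcases v with i | t
  · rw [mem_closedCell_iff_inl hp hv h, mem_cellPairs_inl hr hv]
  · rw [mem_closedCell_iff_inr hp hv h, mem_cellPairs_inr hr hv]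

/-- The number of crossings in the closure of a region. -/
theorem encard_crossings (hr : D.Valid r) :
    {p | p ∈ D.closedCell r ∧ ∃ v, D.PairValid v ∧ D.OnPair v p}.encard =
      ((2 * (D.cellPairs r).card : ℕ) : ℕ∞) := by
  classical
  have hex : ∀ v : ℕ ⊕ ℕ, ∃ s : Finset E3, D.PairValid v →
      s.card = 2 ∧ ∀ p, p ∈ s ↔ p ∈ twoSphere ∧ D.OnPair v p := by
    intro v
    by_cases hv : D.PairValid v
    · exact (exists_pair_points hv).imp fun s h _ => h
    · exact ⟨∅, fun h => (hv h).elim⟩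
  choose s hs using hex
  have e : {p | p ∈ D.closedCell r ∧ ∃ v, D.PairValid v ∧ D.OnPair v p} =
      (((D.cellPairs r).biUnion s : Finset E3) : Set E3) := by
    ext p
    simp only [Finset.coe_biUnion, Set.mem_iUnion, Finset.mem_coe, exists_prop]
    constructor
    · rintro ⟨hp, v, hv, h⟩
      exact ⟨v, (mem_closedCell_iff_mem_cellPairs hr hp.1 hv h).1 hp, ((hs v hv).2 p).2 ⟨hp.1, h⟩⟩
    · rintro ⟨v, hv, h⟩
      have hv' := pairValid_of_mem hr hv
      obtain ⟨h1, h2⟩ := ((hs v hv').2 p).1 h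
      exact ⟨(mem_closedCell_iff_mem_cellPairs hr h1 hv' h2).2 hv, v, hv', h2⟩
  rw [e, Set.encard_coe_eq_coe_finsetCard, Finset.card_biUnion, Finset.sum_congr rfl
    (fun v hv => (hs v (pairValid_of_mem hr hv)).1), Finset.sum_const, smul_eq_mul, mul_comm]
  intro v hv w hw hne
  have hv' := pairValid_of_mem hr hv
  have hw' := pairValid_of_mem hr hw
  rw [Function.onFun, Finset.disjoint_left]
  intro p h1 h2
  rw [(hs v hv').2] at h1
  rw [(hs w hw').2] at h2
  exact hne (eq_of_onPair h1.1 hv' hw' h1.2 h2.2)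

theorem card_lens (i : ℕ) : (D.cellPairs (.lens i)).card = 1 := by
  simp [cellPairs]

theorem card_whole {i : ℕ} (hr : D.Valid (.whole i)) : (D.cellPairs (.whole i)).card = 2 := by
  have := whole_bounds hr
  simp only [cellPairs, Finset.card_disjSum, Finset.card_empty]
  rw [Finset.card_pair (by omega)]

/-- A southern half cap has corners on its circle of latitude and on the preceding cap. For `t = 0`
there is no preceding cap, and truncated subtraction makes the interval empty. -/
theorem card_low {t : ℕ} : (D.cellPairs (.low t)).card = if t = 0 then 1 else 2 := by
  simp only [cellPairs, Finset.card_disjSum, Finset.card_singleton, Nat.card_Ico]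
  split_ifs with h
  · subst h; rw [D.rung_zero]
  · have := rung_lt (D := D) (Nat.pos_of_ne_zero h)
    omega

theorem card_up {t : ℕ} (ht : t ≤ D.q) :
    (D.cellPairs (.up t)).card = if t = D.q then 1 else 2 := by
  simp only [cellPairs, Finset.card_disjSum, Finset.card_singleton, Nat.card_Ico]
  split_ifs with h
  · rw [h, rung_q]; simp
  · have := rung_lt (D := D) (lt_of_le_of_ne ht h)
    rw [rung_q] at this
    omega

/-- In both polar bands the interval of cap crossings is empty and only the crossings on one circle
of latitude remain. -/
theorem card_band_zero : (D.cellPairs (.band 0)).card = 1 := by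
  simp [cellPairs, D.rung_zero]

theorem card_band_last : (D.cellPairs (.band (D.q + 1))).card = 1 := by
  have := rung_lt (D := D) (Nat.lt_succ_self D.q)
  rw [rung_q] at this
  simp only [cellPairs, Finset.card_disjSum, Nat.card_Ico, Nat.card_Icc, Nat.add_sub_cancel,
    rung_q]
  omega

/-- The source of all prong numbers above two: one pair of corners for each overlap of neighbouring
caps between the two circles of latitude, and one pair on each circle. -/
theorem card_band_succ {t : ℕ} (ht : t < D.q) :
    (D.cellPairs (.band (t + 1))).card = D.rung (t + 1) - D.rung t + 2 := by
  have := D.rung_le_N (show t + 1 ≤ D.q from ht)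
  simp only [cellPairs, Finset.card_disjSum, Nat.card_Ico, Nat.card_Icc, Nat.add_sub_cancel]
  omega

end Ladder

/-! ### Collections built from an indexed family of curves -/

/-- The multicurve that consists of the curves with indices in a finite set. -/
noncomputable def Multicurve.ofFinset {ι : Type*} (crv : ι → SimpleClosedCurve) (s : Finset ι)
    (h : ∀ c ∈ s, ∀ c' ∈ s, c ≠ c' → Disjoint (crv c).image (crv c').image) : Multicurve where
  size := s.card
  curve := fun j => crv (s.equivFin.symm j)
  disjoint := fun i j hij => h _ (s.equivFin.symm i).2 _ (s.equivFin.symm j).2 fun e =>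
    hij (s.equivFin.symm.injective (Subtype.ext e))

theorem Multicurve.mem_support_ofFinset {ι : Type*} {crv : ι → SimpleClosedCurve} {s : Finset ι}
    {h : ∀ c ∈ s, ∀ c' ∈ s, c ≠ c' → Disjoint (crv c).image (crv c').image} {p : E3} :
    p ∈ (Multicurve.ofFinset crv s h).support ↔ ∃ c ∈ s, p ∈ (crv c).image := by
  simp only [support, ofFinset, Set.mem_iUnion]
  constructor
  · rintro ⟨j, hj⟩
    exact ⟨_, (s.equivFin.symm j).2, hj⟩
  · rintro ⟨c, hc, hp⟩
    exact ⟨s.equivFin ⟨c, hc⟩, by simpa using hp⟩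

namespace PairCollection

open Classical in
/-- The collection of pairs of multicurves that arises from a finite family of curves, each of
them being of type `a` or `b` and having an index. -/
noncomputable def ofFamily {ι : Type*} [Fintype ι] {k : ℕ} (crv : ι → SimpleClosedCurve)
    (isA : ι → Prop) (idx : ι → Fin k)
    (h : ∀ c c', c ≠ c' → (isA c ↔ isA c') → Disjoint (crv c).image (crv c').image) :
    PairCollection k where
  a := fun j => Multicurve.ofFinset crv {c | isA c ∧ idx c = j} fun c hc c' hc' hne =>
    h c c' hne (iff_of_true (Finset.mem_filter.1 hc).2.1 (Finset.mem_filter.1 hc').2.1)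
  b := fun j => Multicurve.ofFinset crv {c | ¬ isA c ∧ idx c = j} fun c hc c' hc' hne =>
    h c c' hne (iff_of_false (Finset.mem_filter.1 hc).2.1 (Finset.mem_filter.1 hc').2.1)

section

variable {ι : Type*} [Fintype ι] {k : ℕ} {crv : ι → SimpleClosedCurve}
    {isA : ι → Prop} {idx : ι → Fin k}
    {h : ∀ c c', c ≠ c' → (isA c ↔ isA c') → Disjoint (crv c).image (crv c').image} {p : E3}

theorem mem_support_a {j : Fin k} : p ∈ ((ofFamily crv isA idx h).a j).support ↔
    ∃ c, isA c ∧ idx c = j ∧ p ∈ (crv c).image := by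
  simp [ofFamily, Multicurve.mem_support_ofFinset, and_assoc]

theorem mem_support_b {j : Fin k} : p ∈ ((ofFamily crv isA idx h).b j).support ↔
    ∃ c, ¬ isA c ∧ idx c = j ∧ p ∈ (crv c).image := by
  simp [ofFamily, Multicurve.mem_support_ofFinset, and_assoc]

theorem mem_unionA : p ∈ (ofFamily crv isA idx h).unionA ↔ ∃ c, isA c ∧ p ∈ (crv c).image := by
  simp only [unionA, Set.mem_iUnion, mem_support_a]
  constructor
  · rintro ⟨_, c, hc, -, hp⟩; exact ⟨c, hc, hp⟩
  · rintro ⟨c, hc, hp⟩; exact ⟨_, c, hc, rfl, hp⟩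

theorem mem_unionB : p ∈ (ofFamily crv isA idx h).unionB ↔ ∃ c, ¬ isA c ∧ p ∈ (crv c).image := by
  simp only [unionB, Set.mem_iUnion, mem_support_b]
  constructor
  · rintro ⟨_, c, hc, -, hp⟩; exact ⟨c, hc, hp⟩
  · rintro ⟨c, hc, hp⟩; exact ⟨_, c, hc, rfl, hp⟩

theorem mem_union : p ∈ (ofFamily crv isA idx h).unionA ∪ (ofFamily crv isA idx h).unionB ↔
    ∃ c, p ∈ (crv c).image := by
  rw [Set.mem_union, mem_unionA, mem_unionB]
  constructor
  · rintro (⟨c, -, hp⟩ | ⟨c, -, hp⟩) <;> exact ⟨c, hp⟩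
  · rintro ⟨c, hp⟩
    by_cases hc : isA c
    · exact Or.inl ⟨c, hc, hp⟩
    · exact Or.inr ⟨c, hc, hp⟩

theorem exists_curve_a (i : Fin k) (s) : ∃ c, isA c ∧ idx c = i ∧
    ((ofFamily crv isA idx h).a i).curve s = crv c := by
  classical
  have := (Finset.equivFin {c | isA c ∧ idx c = i}).symm s |>.2
  rw [Finset.mem_filter] at this
  exact ⟨_, this.2.1, this.2.2, rfl⟩

theorem exists_curve_b (i : Fin k) (s) : ∃ c, ¬ isA c ∧ idx c = i ∧
    ((ofFamily crv isA idx h).b i).curve s = crv c := by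
  classical
  have := (Finset.equivFin {c | ¬ isA c ∧ idx c = i}).symm s |>.2
  rw [Finset.mem_filter] at this
  exact ⟨_, this.2.1, this.2.2, rfl⟩

theorem exists_index_a {c : ι} (hc : isA c) : ∃ s,
    ((ofFamily crv isA idx h).a (idx c)).curve s = crv c := by
  classical
  have hm : c ∈ ({c' | isA c' ∧ idx c' = idx c} : Finset ι) := by simp [hc]
  refine ⟨Finset.equivFin _ ⟨c, hm⟩, ?_⟩
  simp [ofFamily, Multicurve.ofFinset]

theorem exists_index_b {c : ι} (hc : ¬ isA c) : ∃ s,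
    ((ofFamily crv isA idx h).b (idx c)).curve s = crv c := by
  classical
  have hm : c ∈ ({c' | ¬ isA c' ∧ idx c' = idx c} : Finset ι) := by simp [hc]
  refine ⟨Finset.equivFin _ ⟨c, hm⟩, ?_⟩
  simp [ofFamily, Multicurve.ofFinset]

/-- A family is triangular if its regions are disks, each index occurs for some crossing pair of
curves, and no `a`-curve meets a `b`-curve with a larger index. -/
theorem isTriangular_ofFamily
    (htrans : ∀ c c', isA c → ¬ isA c' → (crv c).Transverse (crv c'))
    (hfills : (ofFamily crv isA idx h).Fills)
    (hlt : ∀ c c', isA c → ¬ isA c' → idx c < idx c' → Disjoint (crv c).image (crv c').image)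
    (hpos : ∀ i, ∃ c c', isA c ∧ ¬ isA c' ∧ idx c = i ∧ idx c' = i ∧
      ¬ Disjoint (crv c).image (crv c').image) :
    (ofFamily crv isA idx h).IsTriangular where
  transverse := fun i j s t => by
    obtain ⟨c, hc, -, e⟩ := exists_curve_a (h := h) i s
    obtain ⟨c', hc', -, e'⟩ := exists_curve_b (h := h) j t
    rw [e, e']
    exact htrans c c' hc hc'
  fills := hfills
  ab_zero := fun i j hij => by
    rw [Multicurve.I, Set.encard_eq_zero, Set.eq_empty_iff_forall_notMem]
    rintro p ⟨hp1, hp2⟩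
    obtain ⟨c, hc, rfl, hp3⟩ := mem_support_a.1 hp1
    obtain ⟨c', hc', rfl, hp4⟩ := mem_support_b.1 hp2
    exact Set.disjoint_left.1 (hlt c c' hc hc' hij) hp3 hp4
  aa_zero := fun i j hij => by
    rw [Multicurve.I, Set.encard_eq_zero, Set.eq_empty_iff_forall_notMem]
    rintro p ⟨hp1, hp2⟩
    obtain ⟨c, hc, rfl, hp3⟩ := mem_support_a.1 hp1
    obtain ⟨c', hc', rfl, hp4⟩ := mem_support_a.1 hp2
    exact Set.disjoint_left.1
      (h c c' (fun e => hij.ne (congrArg idx e)) (iff_of_true hc hc')) hp3 hp4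
  bb_zero := fun i j hij => by
    rw [Multicurve.I, Set.encard_eq_zero, Set.eq_empty_iff_forall_notMem]
    rintro p ⟨hp1, hp2⟩
    obtain ⟨c, hc, rfl, hp3⟩ := mem_support_b.1 hp1
    obtain ⟨c', hc', rfl, hp4⟩ := mem_support_b.1 hp2
    exact Set.disjoint_left.1
      (h c c' (fun e => hij.ne (congrArg idx e)) (iff_of_false hc hc')) hp3 hp4
  ab_pos := fun i => by
    obtain ⟨c, c', hc, hc', e, e', hm⟩ := hpos i
    rw [Multicurve.I, Set.encard_pos]
    obtain ⟨p, hp1, hp2⟩ := Set.not_disjoint_iff.1 hm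
    exact ⟨p, mem_support_a.2 ⟨c, hc, e, hp1⟩, mem_support_b.2 ⟨c', hc', e', hp2⟩⟩

/-- If two curves of different types cross with both signs, the collection is not orientable. -/
theorem not_isOrientable_ofFamily {c c' : ι} (hc : isA c) (hc' : ¬ isA c') {x y x' y' : ℝ}
    (e1 : (crv c).toFun x = (crv c').toFun y) (e2 : (crv c).toFun x' = (crv c').toFun y')
    (hdet : (crv c).crossingDet (crv c') x' y' = -(crv c).crossingDet (crv c') x y) :
    ¬ (ofFamily crv isA idx h).IsOrientable := by
  rintro ⟨εa, εb, H⟩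
  obtain ⟨s, hs⟩ := exists_index_a (h := h) hc
  obtain ⟨t, ht⟩ := exists_index_b (h := h) hc'
  have h1 := H (idx c) s (idx c') t x y (by rw [hs, ht]; exact e1)
  have h2 := H (idx c) s (idx c') t x' y' (by rw [hs, ht]; exact e2)
  rw [hs, ht] at h1 h2
  rw [hdet] at h2
  linarith

end

end PairCollection

/-! ### The curves of the arrangement and their types -/

namespace Ladder

variable (D : Ladder)

/-- The indices of the curves. -/
abbrev Idx : Type := Fin (D.N + 1) ⊕ Fin (D.q + 1)

/-- The curves: the boundaries of the caps of the chain and the circles of latitude. -/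
noncomputable def crv : D.Idx → SimpleClosedCurve
  | .inl i => circleCurve ((4 + 6 * (i : ℕ)) * D.unit) (4 * D.unit) sin_four_ne_zero
  | .inr t => circleCurve (0 * D.unit) ((4 + 6 * D.rung t) * D.unit)
      (sin_rung_ne_zero (Nat.lt_succ_iff.1 t.2))

/-- The name of a curve. -/
def name : D.Idx → ℕ ⊕ ℕ
  | .inl i => .inl i
  | .inr t => .inr t

/-- The functional that vanishes on a curve. -/
noncomputable def curveFun : ℕ ⊕ ℕ → E3 → ℝ
  | .inl i => D.capU i
  | .inr t => D.capL t

/-- The names of the two curves through a pair of crossings. -/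
def ends : ℕ ⊕ ℕ → (ℕ ⊕ ℕ) × (ℕ ⊕ ℕ)
  | .inl i => (.inl i, .inl (i + 1))
  | .inr t => (.inl (D.rung t), .inr t)

/-- The curves of type `a`. -/
def IsTypeA : ℕ ⊕ ℕ → Prop
  | .inl i => Even i
  | .inr t => ¬ Even (D.rung t)

variable {D} {p : E3}

theorem mem_image_crv {c : D.Idx} :
    p ∈ (D.crv c).image ↔ p ∈ twoSphere ∧ D.curveFun (D.name c) p = 0 := by
  rcases c with i | t
  · simp only [crv, image_circleCurve]; rfl
  · simp only [crv, image_circleCurve]; rfl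

theorem exists_name_ends {v : ℕ ⊕ ℕ} (hv : D.PairValid v) :
    ∃ c c', (D.name c, D.name c') = D.ends v := by
  rcases v with i | t
  · simp only [PairValid] at hv
    exact ⟨.inl ⟨i, by omega⟩, .inl ⟨i + 1, by omega⟩, rfl⟩
  · have := D.rung_le_N hv
    simp only [PairValid] at hv
    exact ⟨.inl ⟨D.rung t, by omega⟩, .inr ⟨t, by omega⟩, rfl⟩

theorem onPair_iff {v : ℕ ⊕ ℕ} : D.OnPair v p ↔
    D.curveFun (D.ends v).1 p = 0 ∧ D.curveFun (D.ends v).2 p = 0 := by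
  rcases v with i | t <;> rfl

/-- Types alternate along the chain and a circle of latitude has the type opposite to its cap, a
proper two-colouring of the crossing tree. -/
theorem isTypeA_ends {v : ℕ ⊕ ℕ} : D.IsTypeA (D.ends v).1 ↔ ¬ D.IsTypeA (D.ends v).2 := by
  rcases v with i | t
  · simp only [ends, IsTypeA, Nat.even_add_one, not_not]
  · simp only [ends, IsTypeA, not_not]

/-- Two different curves meet only in a pair of crossings. -/
theorem exists_pair_of_meet {c c' : D.Idx} (hne : c ≠ c') (h : p ∈ (D.crv c).image)
    (h' : p ∈ (D.crv c').image) : ∃ v, D.PairValid v ∧ D.OnPair v p ∧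
      ((D.name c, D.name c') = D.ends v ∨ (D.name c', D.name c) = D.ends v) := by
  rw [mem_image_crv] at h h'
  obtain ⟨hp, h⟩ := h
  replace h' := h'.2
  have mixed : ∀ i t, i ≤ D.N → t ≤ D.q → D.capU i p = 0 → D.capL t p = 0 → i = D.rung t := by
    intro i t hi ht h1 h2
    rcases lt_trichotomy i (D.rung t) with h3 | h3 | h3
    · linarith [capL_pos_of_capU hp h3 ht h1.ge]
    · exact h3
    · linarith [capL_neg_of_capU hp h3 hi h1.ge]
  rcases c with ⟨i, hi⟩ | ⟨t, ht⟩ <;> rcases c' with ⟨i', hi'⟩ | ⟨t', ht'⟩ <;>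
    simp only [name, curveFun] at h h' ⊢
  · have hne' : i ≠ i' := fun e => hne (by subst e; rfl)
    rcases lt_or_gt_of_ne hne' with h1 | h1
    · rcases (show i + 1 < i' ∨ i' = i + 1 by omega) with h2 | rfl
      · linarith [capU_neg_of_lt hp h2 (by omega) h.ge]
      · exact ⟨.inl i, by simp only [PairValid]; omega, ⟨h, h'⟩, Or.inl rfl⟩
    · rcases (show i' + 1 < i ∨ i = i' + 1 by omega) with h2 | rfl
      · linarith [capU_neg_of_lt hp h2 (by omega) h'.ge]
      · exact ⟨.inl i', by simp only [PairValid]; omega, ⟨h', h⟩, Or.inr rfl⟩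
  · have := mixed i t' (by omega) (by omega) h h'
    subst this
    exact ⟨.inr t', by simp only [PairValid]; omega, ⟨h, h'⟩, Or.inl rfl⟩
  · have := mixed i' t (by omega) (by omega) h' h
    subst this
    exact ⟨.inr t, by simp only [PairValid]; omega, ⟨h', h⟩, Or.inr rfl⟩
  · have hne' : t ≠ t' := fun e => hne (by subst e; rfl)
    rcases lt_or_gt_of_ne hne' with h1 | h1
    · linarith [capL_pos_of_capL hp h1 (by omega) h.ge]
    · linarith [capL_pos_of_capL hp h1 (by omega) h'.ge]

theorem disjoint_crv (c c' : D.Idx) (hne : c ≠ c')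
    (h : D.IsTypeA (D.name c) ↔ D.IsTypeA (D.name c')) :
    Disjoint (D.crv c).image (D.crv c').image := by
  rw [Set.disjoint_left]
  intro p h1 h2
  obtain ⟨v, -, -, e | e⟩ := exists_pair_of_meet hne h1 h2
  · have := isTypeA_ends (D := D) (v := v)
    rw [← e] at this
    tauto
  · have := isTypeA_ends (D := D) (v := v)
    rw [← e] at this
    tauto

theorem transverse_symm {c d : SimpleClosedCurve} (h : c.Transverse d) : d.Transverse c := by
  intro s t hst
  have := h t s hst.symm
  rw [LinearIndependent.pair_iff] at this ⊢
  intro x y hxy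
  exact (this y x (by rw [add_comm]; exact hxy)).symm

theorem transverse_ends {c c' : D.Idx} {v : ℕ ⊕ ℕ} (hv : D.PairValid v)
    (e : (D.name c, D.name c') = D.ends v) : (D.crv c).Transverse (D.crv c') := by
  rcases v with i | t <;> rcases c with ⟨j, hj⟩ | ⟨s, hs⟩ <;> rcases c' with ⟨j', hj'⟩ | ⟨s', hs'⟩ <;>
    simp only [name, ends, Prod.mk.injEq, Sum.inl.injEq, Sum.inr.injEq, reduceCtorEq, and_false,
      false_and] at e
  · obtain ⟨rfl, rfl⟩ := e
    exact (arcsCross_capU hv).transverse sin_four_ne_zero sin_four_ne_zero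
  · obtain ⟨rfl, rfl⟩ := e
    exact (arcsCross_capL hv).transverse sin_four_ne_zero (sin_rung_ne_zero hv)

theorem transverse_crv {c c' : D.Idx} (hne : c ≠ c') : (D.crv c).Transverse (D.crv c') := by
  intro s t hst
  obtain ⟨v, hv, -, e | e⟩ := exists_pair_of_meet hne (p := (D.crv c).toFun s) ⟨s, rfl⟩
    ⟨t, hst.symm⟩
  · exact transverse_ends hv e s t hst
  · exact transverse_symm (transverse_ends hv e) s t hst

theorem meet_of_ends {c c' : D.Idx} {v : ℕ ⊕ ℕ} (hv : D.PairValid v)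
    (e : (D.name c, D.name c') = D.ends v) : ¬ Disjoint (D.crv c).image (D.crv c').image := by
  obtain ⟨s, hs, hs'⟩ := exists_pair_points hv
  obtain ⟨p, hp⟩ := Finset.card_pos.1 (by omega : 0 < s.card)
  obtain ⟨hp, h⟩ := (hs' p).1 hp
  rw [onPair_iff, ← e] at h
  exact Set.not_disjoint_iff.2 ⟨p, mem_image_crv.2 ⟨hp, h.1⟩, mem_image_crv.2 ⟨hp, h.2⟩⟩

/-! ### Complementary regions and nonorientability -/

section Regions

variable {k : ℕ} {idx : D.Idx → Fin k}

variable (D idx) in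
/-- The collection of pairs of multicurves with a given distribution of indices. -/
noncomputable def coll : PairCollection k :=
  PairCollection.ofFamily D.crv (fun c => D.IsTypeA (D.name c)) idx disjoint_crv

theorem mem_union_coll : p ∈ (D.coll idx).unionA ∪ (D.coll idx).unionB ↔
    p ∈ twoSphere ∧ ((∃ j ≤ D.N, D.capU j p = 0) ∨ ∃ t ≤ D.q, D.capL t p = 0) := by
  unfold coll
  rw [PairCollection.mem_union]
  simp only [mem_image_crv, Sum.exists, name, curveFun]
  constructor
  · rintro (⟨j, hp, h⟩ | ⟨t, hp, h⟩)
    · exact ⟨hp, Or.inl ⟨j, by omega, h⟩⟩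
    · exact ⟨hp, Or.inr ⟨t, by omega, h⟩⟩
  · rintro ⟨hp, ⟨j, hj, h⟩ | ⟨t, ht, h⟩⟩
    · exact Or.inl ⟨⟨j, by omega⟩, hp, h⟩
    · exact Or.inr ⟨⟨t, by omega⟩, hp, h⟩

theorem mem_complement_coll : p ∈ (D.coll idx).complement ↔
    p ∈ twoSphere ∧ (∀ j ≤ D.N, D.capU j p ≠ 0) ∧ ∀ t ≤ D.q, D.capL t p ≠ 0 := by
  unfold PairCollection.complement
  rw [Set.mem_sdiff, mem_union_coll]
  constructor
  · rintro ⟨hp, h⟩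
    exact ⟨hp, fun j hj h1 => h ⟨hp, Or.inl ⟨j, hj, h1⟩⟩, fun t ht h1 => h ⟨hp, Or.inr ⟨t, ht, h1⟩⟩⟩
  · rintro ⟨hp, h1, h2⟩
    refine ⟨hp, ?_⟩
    rintro ⟨-, ⟨j, hj, h⟩ | ⟨t, ht, h⟩⟩
    · exact h1 j hj h
    · exact h2 t ht h

theorem mem_crossings_coll : p ∈ (D.coll idx).crossings ↔
    p ∈ twoSphere ∧ ∃ v, D.PairValid v ∧ D.OnPair v p := by
  unfold PairCollection.crossings coll
  rw [Set.mem_inter_iff, PairCollection.mem_unionA, PairCollection.mem_unionB]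
  constructor
  · rintro ⟨⟨c, hc, hp⟩, c', hc', hp'⟩
    obtain ⟨v, hv, hv2, -⟩ := exists_pair_of_meet (fun e : c = c' => hc' (by rw [← e]; exact hc)) hp hp'
    exact ⟨(mem_image_crv.1 hp).1, v, hv, hv2⟩
  · rintro ⟨hp, v, hv, h⟩
    obtain ⟨c, c', e⟩ := exists_name_ends hv
    have h2 := isTypeA_ends (D := D) (v := v)
    rw [onPair_iff, ← e] at h
    rw [← e] at h2
    have m1 := mem_image_crv.2 ⟨hp, h.1⟩
    have m2 := mem_image_crv.2 ⟨hp, h.2⟩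
    by_cases hA : D.IsTypeA (D.name c)
    · exact ⟨⟨c, hA, m1⟩, c', h2.1 hA, m2⟩
    · exact ⟨⟨c', not_not.1 fun h3 => hA (h2.2 h3), m2⟩, c, hA, m1⟩

variable {r : Cell}

theorem openCell_subset : D.openCell r ⊆ (D.coll idx).complement := by
  rintro p ⟨hp, h1, h2⟩
  refine mem_complement_coll.2 ⟨hp, fun j hj => ?_, fun t ht => ?_⟩
  · by_cases h : D.InU r j
    · exact ((h1 j hj).1 h).ne'
    · exact ((h1 j hj).2 h).ne
  · by_cases h : D.InL r t
    · exact ((h2 t ht).1 h).ne'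
    · exact ((h2 t ht).2 h).ne

theorem mem_openCell_of_mem_closedCell (h : p ∈ D.closedCell r)
    (h' : p ∈ (D.coll idx).complement) : p ∈ D.openCell r := by
  obtain ⟨hp, h1, h2⟩ := h
  obtain ⟨-, n1, n2⟩ := mem_complement_coll.1 h'
  exact ⟨hp, fun j hj => ⟨fun h => lt_of_le_of_ne ((h1 j hj).1 h) (n1 j hj).symm,
    fun h => lt_of_le_of_ne ((h1 j hj).2 h) (n1 j hj)⟩,
    fun t ht => ⟨fun h => lt_of_le_of_ne ((h2 t ht).1 h) (n2 t ht).symm,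
    fun h => lt_of_le_of_ne ((h2 t ht).2 h) (n2 t ht)⟩⟩

theorem isPreconnected_openCell (hr : D.Valid r) : IsPreconnected (D.openCell r) := by
  obtain ⟨f, h1, -, -, h4⟩ := exists_disk_param hr
  rw [← h4]
  exact (convex_ball _ _).isPreconnected.image f (h1.mono Metric.ball_subset_closedBall)

/-- The complement splits into two disjoint relatively open parts: all signs agree with those of
`r`, or some sign is opposite. A component meeting the first part stays in it. -/
theorem connectedComponentIn_eq (hr : D.Valid r) (hp : p ∈ D.openCell r) :
    connectedComponentIn (D.coll idx).complement p = D.openCell r := by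
  refine Set.Subset.antisymm ?_
    ((isPreconnected_openCell hr).subset_connectedComponentIn hp openCell_subset)
  have hsub := connectedComponentIn_subset (D.coll idx).complement p
  have hF : ∀ c, Continuous fun x : E3 =>
      (D.signData r c).1 * capF (D.signData r c).2.1 (D.signData r c).2.2 x := fun c =>
    continuous_const.mul (continuous_capF _ _)
  have key := isPreconnected_connectedComponentIn.subset_left_of_subset_union
    (s := connectedComponentIn (D.coll idx).complement p)
    (u := {x | ∀ c, 0 < (D.signData r c).1 * capF (D.signData r c).2.1 (D.signData r c).2.2 x})
    (v := {x | ∃ c, (D.signData r c).1 * capF (D.signData r c).2.1 (D.signData r c).2.2 x < 0})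
    (by
      have : {x | ∀ c, 0 < (D.signData r c).1 * capF (D.signData r c).2.1 (D.signData r c).2.2 x} =
          ⋂ c, {x | 0 < (D.signData r c).1 * capF (D.signData r c).2.1 (D.signData r c).2.2 x} := by
        ext; simp
      rw [this]
      exact isOpen_iInter_of_finite fun c => isOpen_lt continuous_const (hF c))
    (by
      have : {x | ∃ c, (D.signData r c).1 * capF (D.signData r c).2.1 (D.signData r c).2.2 x < 0} =
          ⋃ c, {x | (D.signData r c).1 * capF (D.signData r c).2.1 (D.signData r c).2.2 x < 0} := by
        ext; simp
      rw [this]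
      exact isOpen_iUnion fun c => isOpen_lt (hF c) continuous_const)
    (by
      rw [Set.disjoint_left]
      rintro x h1 ⟨c, hc⟩
      exact absurd (h1 c) (not_lt.2 hc.le))
    (fun x hx => by
      by_cases h : ∃ c, (D.signData r c).1 * capF (D.signData r c).2.1 (D.signData r c).2.2 x < 0
      · exact Or.inr h
      · push Not at h
        have hx' := hsub hx
        have := mem_openCell_of_mem_closedCell
          (mem_closedCell_iff.2 ⟨(mem_complement_coll.1 hx').1, h⟩) hx'
        exact Or.inl (mem_openCell_iff.1 this).2)
    ⟨p, mem_connectedComponentIn (openCell_subset hp), (mem_openCell_iff.1 hp).2⟩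
  intro x hx
  exact mem_openCell_iff.2 ⟨(mem_complement_coll.1 (hsub hx)).1, key hx⟩

theorem regions_coll : (D.coll idx).regions = D.openCell '' {r | D.Valid r} := by
  ext S
  constructor
  · rintro ⟨p, hp, rfl⟩
    obtain ⟨h1, h2, h3⟩ := mem_complement_coll.1 hp
    obtain ⟨r, hr, hpr⟩ := exists_mem_openCell h1 h2 h3
    exact ⟨r, hr, (connectedComponentIn_eq hr hpr).symm⟩
  · rintro ⟨r, hr, rfl⟩
    exact ⟨_, openCell_subset (midpoint_mem_openCell hr),
      connectedComponentIn_eq hr (midpoint_mem_openCell hr)⟩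

theorem fills_coll : (D.coll idx).Fills := by
  intro S hS
  rw [regions_coll] at hS
  obtain ⟨r, hr, rfl⟩ := hS
  obtain ⟨f, h1, h2, -, h4⟩ := exists_disk_param hr
  rw [← h4]
  exact nonempty_homeomorph_ball h1 h2

/-- The parametrization is injective on the closed disk, so corners on the boundary circle
correspond one to one to crossings in the closed region; the open region contains none. -/
theorem isProngRegion_openCell (hr : D.Valid r) (hpos : 1 ≤ (D.cellPairs r).card) :
    (D.coll idx).IsProngRegion (D.openCell r) (D.cellPairs r).card := by
  obtain ⟨f, h1, h2, h3, h4⟩ := exists_disk_param hr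
  have hball := Metric.ball_subset_closedBall (x := (0 : ℂ)) (ε := 1)
  have hsph := Metric.sphere_subset_closedBall (x := (0 : ℂ)) (ε := 1)
  have hbd : ∀ z ∈ Metric.sphere (0 : ℂ) 1, f z ∉ D.openCell r := by
    intro z hz hf
    rw [← h4] at hf
    obtain ⟨w, hw, e⟩ := hf
    have := h2 (hball hw) (hsph hz) e
    subst this
    rw [Metric.mem_ball] at hw
    rw [Metric.mem_sphere] at hz
    linarith
  have hcl : ∀ z ∈ Metric.closedBall (0 : ℂ) 1, f z ∈ D.closedCell r := fun z hz =>
    h3 ▸ Set.mem_image_of_mem f hz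
  refine ⟨hpos, f, h1, h2.mono hball, h4, ?_, ?_⟩
  · rintro _ ⟨z, hz, rfl⟩
    by_contra hc
    refine hbd z hz (mem_openCell_of_mem_closedCell (idx := idx) (hcl z (hsph hz)) ?_)
    exact ⟨(hcl z (hsph hz)).1, hc⟩
  · rw [← encard_crossings hr, ← (h2.mono (fun z hz => hsph hz.1 :
      {z : ℂ | z ∈ Metric.sphere (0 : ℂ) 1 ∧ f z ∈ (D.coll idx).crossings} ⊆ _)).encard_image]
    congr 1
    ext p
    constructor
    · rintro ⟨z, ⟨hz, hzc⟩, rfl⟩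
      exact ⟨hcl z (hsph hz), (mem_crossings_coll.1 hzc).2⟩
    · rintro ⟨hp, hv⟩
      have hpc : p ∈ (D.coll idx).crossings := mem_crossings_coll.2 ⟨hp.1, hv⟩
      have hp' := hp
      rw [← h3] at hp'
      obtain ⟨z, hz, rfl⟩ := hp'
      refine ⟨z, ⟨?_, hpc⟩, rfl⟩
      rw [← Metric.ball_union_sphere] at hz
      refine hz.resolve_left fun hb => ?_
      have : f z ∈ D.openCell r := h4 ▸ Set.mem_image_of_mem f hb
      exact (openCell_subset (idx := idx) this).2 (Or.inl hpc.1)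

/-- Cap `0` and its circle of latitude cross at two mirror points. Changing orientations multiplies
both signs by the same factor, so they stay opposite. -/
theorem not_isOrientable_coll : ¬ (D.coll idx).IsOrientable := by
  have hv : D.PairValid (.inr 0) := Nat.zero_le _
  obtain ⟨c, c', e⟩ := exists_name_ends hv
  have hA := isTypeA_ends (D := D) (v := .inr 0)
  rw [← e] at hA
  have hcirc : ∀ c : D.Idx, ∃ a h, ∃ hs : Real.sin h ≠ 0, D.crv c = circleCurve a h hs := by
    rintro (i | t)
    · exact ⟨_, _, sin_four_ne_zero, rfl⟩
    · exact ⟨_, _, sin_rung_ne_zero (Nat.lt_succ_iff.1 t.2), rfl⟩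
  obtain ⟨p, ⟨x, hx⟩, y, hy⟩ := Set.not_disjoint_iff.1 (meet_of_ends hv e)
  have main : ∀ c c' : D.Idx, ∀ x y : ℝ, (D.crv c).toFun x = (D.crv c').toFun y →
      (D.crv c).toFun (-x) = (D.crv c').toFun (-y) ∧
      (D.crv c).crossingDet (D.crv c') (-x) (-y) = -(D.crv c).crossingDet (D.crv c') x y := by
    intro c c' x y hxy
    obtain ⟨a, h, hs, ec⟩ := hcirc c
    obtain ⟨a', h', hs', ec'⟩ := hcirc c'
    rw [ec, ec'] at hxy ⊢
    exact ⟨circleFun_neg_eq hxy, crossingDet_neg hs hs'⟩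
  by_cases h : D.IsTypeA (D.name c)
  · obtain ⟨m1, m2⟩ := main c c' x y (hx.trans hy.symm)
    exact PairCollection.not_isOrientable_ofFamily h (hA.1 h) (hx.trans hy.symm) m1 m2
  · obtain ⟨m1, m2⟩ := main c' c y x (hy.trans hx.symm)
    exact PairCollection.not_isOrientable_ofFamily (not_not.1 fun h3 => h (hA.2 h3)) h
      (hy.trans hx.symm) m1 m2

end Regions

end Ladder

/-! ### Grouping the curves and ordering the groups -/

namespace Ladder

variable (D : Ladder)

/-- The caps `b` and `b + 1` belong to different groups. -/
def Brk (b : ℕ) : Prop := ∃ t, D.rung t ≤ b ∧ b < D.rung (t + 1) ∧ Even (b - D.rung t)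

open Classical in
/-- The number of the group of a cap: from each circle of latitude northwards, the caps are
grouped in pairs, the last cap before the next circle of latitude included. -/
noncomputable def capGroup (i : ℕ) : ℕ := Nat.count D.Brk i

/-- The number of the group of a curve. -/
noncomputable def group : ℕ ⊕ ℕ → ℕ
  | .inl i => D.capGroup i
  | .inr t => D.capGroup (D.rung t)

open Classical in
/-- The height by which the groups are ordered. -/
noncomputable def height (j : ℕ) : ℤ :=
  if ∃ b, D.Brk b ∧ D.capGroup b + 1 = j ∧ Even b then -j else j

variable {D}

theorem natAbs_height (j : ℕ) : (D.height j).natAbs = j := by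
  unfold height
  split_ifs <;> simp

theorem height_injective : Function.Injective D.height := fun i j h => by
  rw [← natAbs_height (D := D) i, h, natAbs_height]

theorem capGroup_succ_of_brk {b : ℕ} (h : D.Brk b) : D.capGroup (b + 1) = D.capGroup b + 1 := by
  classical
  unfold capGroup
  rw [Nat.count_succ, if_pos h]

theorem capGroup_succ_of_not_brk {b : ℕ} (h : ¬ D.Brk b) :
    D.capGroup (b + 1) = D.capGroup b := by
  classical
  unfold capGroup
  rw [Nat.count_succ, if_neg h, add_zero]

theorem capGroup_zero : D.capGroup 0 = 0 := by
  classical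
  unfold capGroup
  exact Nat.count_zero _

theorem capGroup_mono : Monotone D.capGroup := by
  classical
  exact Nat.count_monotone _

/-- The height of group `j` is `±j`, so its order relative to the previous group depends only on its
own sign. For even `b`, cap `b` has type `a` and cap `b + 1` type `b`, so the later group has to be
lower. -/
theorem height_succ_of_even {b : ℕ} (h : D.Brk b) (hb : Even b) :
    D.height (D.capGroup b + 1) < D.height (D.capGroup b) := by
  have h1 : D.height (D.capGroup b + 1) = -((D.capGroup b + 1 : ℕ) : ℤ) := by
    unfold height
    rw [if_pos ⟨b, h, rfl, hb⟩]
  have h2 := natAbs_height (D := D) (D.capGroup b)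
  omega

theorem height_succ_of_odd {b : ℕ} (h : D.Brk b) (hb : ¬ Even b) :
    D.height (D.capGroup b) < D.height (D.capGroup b + 1) := by
  classical
  have h1 : D.height (D.capGroup b + 1) = ((D.capGroup b + 1 : ℕ) : ℤ) := by
    unfold height
    rw [if_neg]
    rintro ⟨b', hb', e, he⟩
    have : b' = b := Nat.count_injective hb' h (by simpa [capGroup] using e)
    exact hb (this ▸ he)
  have h2 := natAbs_height (D := D) (D.capGroup b)
  omega

theorem eq_of_between {t t' b : ℕ} (h1 : D.rung t ≤ b) (h2 : b < D.rung (t + 1))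
    (h1' : D.rung t' ≤ b) (h2' : b < D.rung (t' + 1)) : t = t' := by
  rcases lt_trichotomy t t' with h | h | h
  · have := rung_le (D := D) (show t + 1 ≤ t' from h); omega
  · exact h
  · have := rung_le (D := D) (show t' + 1 ≤ t from h); omega

theorem brk_iff {t b : ℕ} (h1 : D.rung t ≤ b) (h2 : b < D.rung (t + 1)) :
    D.Brk b ↔ Even (b - D.rung t) := by
  constructor
  · rintro ⟨t', h1', h2', h⟩
    rwa [eq_of_between h1 h2 h1' h2']
  · exact fun h => ⟨t, h1, h2, h⟩

/-- Breaks come after the even offsets `0, 2, 4, ...` from a circle of latitude, so `⌈x / 2⌉` of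
them precede offset `x`. -/
theorem capGroup_rung_add (t : ℕ) : ∀ x, x ≤ D.rung (t + 1) - D.rung t →
    D.capGroup (D.rung t + x) = D.capGroup (D.rung t) + (x + 1) / 2 := by
  intro x
  induction x with
  | zero => intro _; simp
  | succ x ih =>
    intro hx
    have hb := brk_iff (D := D) (t := t) (b := D.rung t + x) (by omega) (by omega)
    rw [Nat.add_sub_cancel_left] at hb
    rw [← add_assoc]
    rcases Nat.even_or_odd' x with ⟨c, rfl | rfl⟩
    · rw [capGroup_succ_of_brk (hb.2 (by simp)), ih (by omega)]
      omega
    · rw [capGroup_succ_of_not_brk (fun h => by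
        have := hb.1 h
        rw [Nat.even_add_one] at this
        simp at this), ih (by omega)]
      omega

theorem capGroup_rung_succ (t : ℕ) : D.capGroup (D.rung (t + 1)) =
    D.capGroup (D.rung t) + (D.rung (t + 1) - D.rung t + 1) / 2 := by
  have h := rung_lt (D := D) (Nat.lt_succ_self t)
  have := capGroup_rung_add (D := D) t _ le_rfl
  rwa [Nat.add_sub_cancel' h.le] at this

/-- Group numbers rise by at most one from cap to cap, so each value first occurs at cap `0` or
directly after a break. -/
theorem exists_first_of_group (n : ℕ) : ∀ j ≤ D.capGroup n,
    ∃ i ≤ n, D.capGroup i = j ∧ (i = 0 ∨ ∃ b, i = b + 1 ∧ D.Brk b) := by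
  induction n with
  | zero =>
    intro j hj
    rw [capGroup_zero] at hj
    exact ⟨0, le_rfl, by rw [capGroup_zero]; omega, Or.inl rfl⟩
  | succ n ih =>
    intro j hj
    by_cases h : j ≤ D.capGroup n
    · obtain ⟨i, hi, h2⟩ := ih j h
      exact ⟨i, by omega, h2⟩
    · by_cases hb : D.Brk n
      · rw [capGroup_succ_of_brk hb] at hj
        exact ⟨n + 1, le_rfl, by rw [capGroup_succ_of_brk hb]; omega, Or.inr ⟨n, rfl, hb⟩⟩
      · rw [capGroup_succ_of_not_brk hb] at hj
        omega

/-- Every group contains two curves that cross. -/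
theorem exists_pair_in_group {j : ℕ} (hj : j ≤ D.capGroup D.N) :
    ∃ v, D.PairValid v ∧ D.group (D.ends v).1 = j ∧ D.group (D.ends v).2 = j := by
  obtain ⟨i, hi, rfl, h⟩ := exists_first_of_group D.N j hj
  rcases h with rfl | ⟨b, rfl, hb⟩
  · exact ⟨.inr 0, Nat.zero_le _, by simp [ends, group, D.rung_zero],
      by simp [ends, group, D.rung_zero]⟩
  · obtain ⟨t, h1, h2, h3⟩ := hb
    -- A break before a cap of the chain lies below some later circle of latitude; breaks coming
    -- from `t ≥ q` start only at `N`.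
    have htq : t + 1 ≤ D.q := by
      by_contra hc
      have := rung_le (D := D) (show D.q ≤ t by omega)
      rw [rung_q] at this
      omega
    by_cases h4 : b + 1 = D.rung (t + 1)
    · exact ⟨.inr (t + 1), htq, by simp [ends, group, h4], by simp [ends, group, h4]⟩
    -- The first cap of the group carries no circle of latitude; the next cap still belongs to the
    -- group, since the offset is now odd.
    · have h5 := D.rung_le_N htq
      have hnb : ¬ D.Brk (b + 1) := by
        rw [brk_iff (t := t) (by omega) (by omega), show b + 1 - D.rung t = b - D.rung t + 1 by omega,
          Nat.even_add_one]
        simpa using h3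
      refine ⟨.inl (b + 1), ?_, rfl, capGroup_succ_of_not_brk hnb⟩
      simp only [PairValid]
      omega

/-- The index of a curve is the rank of the height of its group. Heights are distinct, so the ranks
exhaust `Fin`. -/
theorem exists_idx : ∃ idx : D.Idx → Fin (D.capGroup D.N + 1),
    (∀ c c', idx c < idx c' ↔ D.height (D.group (D.name c)) < D.height (D.group (D.name c'))) ∧
    ∀ j, ∃ g ≤ D.capGroup D.N, ∀ c, D.group (D.name c) = g → idx c = j := by
  classical
  set H : Finset ℤ := (Finset.range (D.capGroup D.N + 1)).image D.height with hH
  have hcard : H.card = D.capGroup D.N + 1 := by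
    rw [hH, Finset.card_image_of_injective _ height_injective, Finset.card_range]
  have hmem : ∀ c, D.height (D.group (D.name c)) ∈ H := by
    intro c
    refine Finset.mem_image_of_mem _ (Finset.mem_range.2 (Nat.lt_succ_of_le ?_))
    rcases c with i | t
    · exact capGroup_mono (Nat.lt_succ_iff.1 i.2)
    · exact capGroup_mono (D.rung_le_N (Nat.lt_succ_iff.1 t.2))
  let e := H.orderIsoOfFin hcard
  refine ⟨fun c => e.symm ⟨_, hmem c⟩, fun c c' => ?_, fun j => ?_⟩
  · rw [OrderIso.lt_iff_lt]
    exact Iff.rfl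
  · obtain ⟨g, hg, hg2⟩ := Finset.mem_image.1 (e j).2
    refine ⟨g, Nat.lt_succ_iff.1 (Finset.mem_range.1 hg), fun c hc => ?_⟩
    rw [OrderIso.symm_apply_eq]
    exact Subtype.ext ((congrArg D.height hc).trans hg2)

/-- No curve of type `a` meets a curve of type `b` whose group is higher. -/
theorem disjoint_of_height_lt {c c' : D.Idx} (hc : D.IsTypeA (D.name c))
    (hc' : ¬ D.IsTypeA (D.name c'))
    (h : D.height (D.group (D.name c)) < D.height (D.group (D.name c'))) :
    Disjoint (D.crv c).image (D.crv c').image := by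
  rw [Set.disjoint_left]
  intro p h1 h2
  obtain ⟨v, hv, -, e⟩ := exists_pair_of_meet (fun e : c = c' => hc' (by rw [← e]; exact hc)) h1 h2
  rcases v with i | t
  · rcases e with e | e
    -- Cap `i` has type `a`, so `i` is even; at a break the height drops, and without one both caps
    -- share a group.
    · simp only [ends, Prod.mk.injEq] at e
      rw [e.1] at hc
      rw [e.1, e.2] at h
      simp only [group, IsTypeA] at h hc
      by_cases hb : D.Brk i
      · rw [capGroup_succ_of_brk hb] at h
        exact absurd (height_succ_of_even hb hc) (not_lt.2 h.le)
      · rw [capGroup_succ_of_not_brk hb] at h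
        exact lt_irrefl _ h
    · simp only [ends, Prod.mk.injEq] at e
      rw [e.1] at hc'
      rw [e.1, e.2] at h
      simp only [group, IsTypeA] at h hc'
      by_cases hb : D.Brk i
      · rw [capGroup_succ_of_brk hb] at h
        exact absurd (height_succ_of_odd hb hc') (not_lt.2 h.le)
      · rw [capGroup_succ_of_not_brk hb] at h
        exact lt_irrefl _ h
  -- A circle of latitude lies in the group of the only cap that it meets.
  · rcases e with e | e <;> simp only [ends, Prod.mk.injEq] at e <;> rw [e.1, e.2] at h <;>
      exact lt_irrefl _ h

theorem isTriangular_coll {idx : D.Idx → Fin (D.capGroup D.N + 1)}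
    (h1 : ∀ c c', idx c < idx c' ↔
      D.height (D.group (D.name c)) < D.height (D.group (D.name c')))
    (h2 : ∀ j, ∃ g ≤ D.capGroup D.N, ∀ c, D.group (D.name c) = g → idx c = j) :
    (D.coll idx).IsTriangular := by
  refine PairCollection.isTriangular_ofFamily
    (fun c c' hc hc' => transverse_crv (fun e : c = c' => hc' (by rw [← e]; exact hc)))
    fills_coll (fun c c' hc hc' hlt => disjoint_of_height_lt hc hc' ((h1 c c').1 hlt)) fun j => ?_
  obtain ⟨g, hg, hj⟩ := h2 j
  obtain ⟨v, hv, g1, g2⟩ := exists_pair_in_group hg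
  obtain ⟨c, c', e⟩ := exists_name_ends hv
  have hA := isTypeA_ends (D := D) (v := v)
  have hm := meet_of_ends hv e
  rw [← e] at hA g1 g2
  by_cases h : D.IsTypeA (D.name c)
  · exact ⟨c, c', h, hA.1 h, hj c g1, hj c' g2, hm⟩
  · exact ⟨c', c, not_not.1 fun h3 => h (hA.2 h3), h, hj c' g2, hj c g1,
      fun hd => hm hd.symm⟩

/-! ### The list of prong numbers -/

section Prongs

variable (D) in
/-- The indices of the regions. -/
abbrev CellIdx : Type :=
  Fin D.N ⊕ {i : Fin (D.N + 1) // ∀ t ≤ D.q, D.rung t ≠ i} ⊕ Fin (D.q + 1) ⊕ Fin (D.q + 1) ⊕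
    Fin (D.q + 2)

/-- The name of a region. -/
def toCell : D.CellIdx → Cell
  | .inl i => .lens i
  | .inr (.inl i) => .whole i.1
  | .inr (.inr (.inl t)) => .low t
  | .inr (.inr (.inr (.inl t))) => .up t
  | .inr (.inr (.inr (.inr t))) => .band t

theorem toCell_valid (x : D.CellIdx) : D.Valid (toCell x) := by
  rcases x with i | i | t | t | t
  · exact i.2
  · exact ⟨Nat.lt_succ_iff.1 i.1.2, i.2⟩
  · exact Nat.lt_succ_iff.1 t.2
  · exact Nat.lt_succ_iff.1 t.2
  · exact Nat.lt_succ_iff.1 t.2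

theorem toCell_injective : Function.Injective (toCell (D := D)) := by
  rintro (i | i | t | t | t) (i' | i' | t' | t' | t') h <;>
    simp only [toCell, Cell.lens.injEq, Cell.whole.injEq, Cell.low.injEq, Cell.up.injEq,
      Cell.band.injEq, reduceCtorEq] at h
  · rw [Fin.ext h]
  · rw [Subtype.ext (Fin.ext h)]
  · rw [Fin.ext h]
  · rw [Fin.ext h]
  · rw [Fin.ext h]

theorem exists_toCell_eq {r : Cell} (hr : D.Valid r) : ∃ x, toCell (D := D) x = r := by
  rcases r with i | i | t | t | t
  · exact ⟨.inl ⟨i, hr⟩, rfl⟩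
  · exact ⟨.inr (.inl ⟨⟨i, Nat.lt_succ_of_le hr.1⟩, hr.2⟩), rfl⟩
  · exact ⟨.inr (.inr (.inl ⟨t, Nat.lt_succ_of_le hr⟩)), rfl⟩
  · exact ⟨.inr (.inr (.inr (.inl ⟨t, Nat.lt_succ_of_le hr⟩))), rfl⟩
  · exact ⟨.inr (.inr (.inr (.inr ⟨t, Nat.lt_succ_of_le hr⟩))), rfl⟩

theorem openCell_toCell_injective :
    Function.Injective fun x : D.CellIdx => D.openCell (toCell x) := by
  intro x y h
  refine toCell_injective (eq_of_mem_openCell (toCell_valid x) (toCell_valid y)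
    (midpoint_mem_openCell (toCell_valid x)) ?_)
  have h' : D.openCell (toCell x) = D.openCell (toCell y) := h
  rw [← h']
  exact midpoint_mem_openCell (toCell_valid x)

theorem card_pos (x : D.CellIdx) : 1 ≤ (D.cellPairs (toCell x)).card := by
  rcases x with i | i | t | t | t
  · rw [toCell, card_lens]
  · rw [toCell, card_whole (toCell_valid (.inr (.inl i)))]; norm_num
  · rw [toCell, card_low]; split_ifs <;> norm_num
  · rw [toCell, card_up (Nat.lt_succ_iff.1 t.2)]; split_ifs <;> norm_num
  · obtain ⟨t, ht⟩ := t
    simp only [toCell]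
    rcases Nat.eq_zero_or_pos t with rfl | h
    · rw [card_band_zero]
    obtain ⟨t, rfl⟩ := Nat.exists_eq_succ_of_ne_zero h.ne'
    rcases (show t < D.q ∨ t = D.q by omega) with h | rfl
    · rw [card_band_succ h]; omega
    · rw [card_band_last]

theorem hasProngs_coll {k : ℕ} {idx : D.Idx → Fin k} : ∃ F : Fintype D.CellIdx,
    (D.coll idx).HasProngs
      ((@Finset.univ _ F).val.map fun x => (D.cellPairs (toCell x)).card) := by
  classical
  refine ⟨inferInstance, ?_⟩
  refine ⟨Finset.univ.map ⟨fun x : D.CellIdx => D.openCell (toCell x), openCell_toCell_injective⟩,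
    Function.extend (fun x : D.CellIdx => D.openCell (toCell x))
      (fun x => (D.cellPairs (toCell x)).card) 0, ?_, ?_, ?_⟩
  · rw [regions_coll]
    ext S
    simp only [Finset.coe_map, Function.Embedding.coeFn_mk, Finset.coe_univ, Set.image_univ,
      Set.mem_range, Set.mem_image, Set.mem_ofPred_eq]
    constructor
    · rintro ⟨x, rfl⟩
      exact ⟨_, toCell_valid x, rfl⟩
    · rintro ⟨r, hr, rfl⟩
      obtain ⟨x, rfl⟩ := exists_toCell_eq hr
      exact ⟨x, rfl⟩
  · intro S hS
    obtain ⟨x, -, rfl⟩ := Finset.mem_map.1 hS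
    simp only [Function.Embedding.coeFn_mk]
    rw [openCell_toCell_injective.extend_apply]
    exact isProngRegion_openCell (toCell_valid x) (card_pos x)
  · rw [Finset.map_val, Multiset.map_map]
    refine Multiset.map_congr rfl fun x _ => ?_
    exact openCell_toCell_injective.extend_apply _ _ x

theorem univ_sum_map {α β γ : Type*} [Fintype α] [Fintype β] (f : α ⊕ β → γ) :
    (Finset.univ : Finset (α ⊕ β)).val.map f =
      Finset.univ.val.map (f ∘ Sum.inl) + Finset.univ.val.map (f ∘ Sum.inr) := by
  rw [← Finset.univ_disjSum_univ, Finset.val_disjSum, Multiset.disjSum, Multiset.map_add,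
    Multiset.map_map, Multiset.map_map]

variable (D) in
/-- The numbers of prongs of the inner bands. -/
def innerProngs : Multiset ℕ :=
  (List.ofFn fun t : Fin D.q => D.rung (t + 1) - D.rung t + 2 : List ℕ)

/-- The ones are the `N` lenses, the southern half of the first cap, the northern half of the last
and the two polar bands. Only the inner bands contribute numbers above two; the number `n` of 2's is
irrelevant for the signature. -/
theorem prongs_eq (F : Fintype D.CellIdx) : ∃ n, (@Finset.univ _ F).val.map
    (fun x => (D.cellPairs (toCell x)).card) =
      Multiset.replicate (D.N + 4) 1 + Multiset.replicate n 2 + D.innerProngs := by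
  classical
  rw [Subsingleton.elim F (instFintypeSum _ _)]
  have h1 : (Finset.univ : Finset (Fin D.N)).val.map
      ((fun x : D.CellIdx => (D.cellPairs (toCell x)).card) ∘ Sum.inl) =
        Multiset.replicate D.N 1 := by
    have : ((fun x : D.CellIdx => (D.cellPairs (toCell x)).card) ∘ Sum.inl) = fun _ => 1 := by
      funext i; simp [toCell, card_lens]
    rw [this, Multiset.map_const']
    simp
  have h2 : (Finset.univ : Finset {i : Fin (D.N + 1) // ∀ t ≤ D.q, D.rung t ≠ i}).val.map
      ((fun x : D.CellIdx => (D.cellPairs (toCell x)).card) ∘ Sum.inr ∘ Sum.inl) =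
        Multiset.replicate (Fintype.card {i : Fin (D.N + 1) // ∀ t ≤ D.q, D.rung t ≠ i}) 2 := by
    have : ((fun x : D.CellIdx => (D.cellPairs (toCell x)).card) ∘ Sum.inr ∘ Sum.inl) =
        fun _ => 2 := by
      funext i
      simp only [toCell, Function.comp]
      exact card_whole (toCell_valid (.inr (.inl i)))
    rw [this, Multiset.map_const']
    simp
  have h3 : (Finset.univ : Finset (Fin (D.q + 1))).val.map
      ((fun x : D.CellIdx => (D.cellPairs (toCell x)).card) ∘ Sum.inr ∘ Sum.inr ∘ Sum.inl) =
        1 ::ₘ Multiset.replicate D.q 2 := by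
    rw [Fin.univ_val_map, List.ofFn_succ]
    have : (fun i : Fin D.q => ((fun x : D.CellIdx => (D.cellPairs (toCell x)).card) ∘ Sum.inr ∘
        Sum.inr ∘ Sum.inl) i.succ) = fun _ => 2 := by
      funext i; simp [toCell, card_low]
    rw [this, List.ofFn_const]
    simp only [toCell, Function.comp, card_low]
    rfl
  have h4 : (Finset.univ : Finset (Fin (D.q + 1))).val.map
      ((fun x : D.CellIdx => (D.cellPairs (toCell x)).card) ∘ Sum.inr ∘ Sum.inr ∘ Sum.inr ∘
        Sum.inl) = 1 ::ₘ Multiset.replicate D.q 2 := by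
    rw [Fin.univ_val_map, List.ofFn_succ']
    have : (fun i : Fin D.q => ((fun x : D.CellIdx => (D.cellPairs (toCell x)).card) ∘ Sum.inr ∘
        Sum.inr ∘ Sum.inr ∘ Sum.inl) i.castSucc) = fun _ => 2 := by
      funext i
      simp only [toCell, Function.comp]
      rw [card_up (by simp [i.2.le]), if_neg (by simpa using i.2.ne)]
    have e1 : (D.cellPairs (.up ((Fin.last D.q : Fin (D.q + 1)) : ℕ))).card = 1 := by
      rw [card_up (by simp)]; simp
    rw [this, List.ofFn_const, List.concat_eq_append, ← Multiset.coe_add]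
    simp only [toCell, Function.comp, e1]
    rw [Multiset.coe_singleton, Multiset.add_comm, Multiset.singleton_add]
    rfl
  have h5 : (Finset.univ : Finset (Fin (D.q + 2))).val.map
      ((fun x : D.CellIdx => (D.cellPairs (toCell x)).card) ∘ Sum.inr ∘ Sum.inr ∘ Sum.inr ∘
        Sum.inr) = 1 ::ₘ 1 ::ₘ D.innerProngs := by
    rw [Fin.univ_val_map, List.ofFn_succ, List.ofFn_succ']
    have : (fun i : Fin D.q => ((fun x : D.CellIdx => (D.cellPairs (toCell x)).card) ∘ Sum.inr ∘
        Sum.inr ∘ Sum.inr ∘ Sum.inr) i.castSucc.succ) =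
          fun t : Fin D.q => D.rung (t + 1) - D.rung t + 2 := by
      funext i
      simp only [toCell, Function.comp]
      exact card_band_succ i.2
    have e1 : (D.cellPairs (.band ((0 : Fin (D.q + 2)) : ℕ))).card = 1 := card_band_zero
    have e2 : (D.cellPairs (.band ((Fin.last D.q).succ : ℕ))).card = 1 := card_band_last
    rw [this, List.concat_eq_append, ← Multiset.cons_coe, ← Multiset.coe_add]
    simp only [toCell, Function.comp, e1, e2]
    rw [Multiset.coe_singleton, Multiset.add_comm (Multiset.ofList _), Multiset.singleton_add]
    rfl
  refine ⟨Fintype.card {i : Fin (D.N + 1) // ∀ t ≤ D.q, D.rung t ≠ i} + (D.q + D.q), ?_⟩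
  rw [univ_sum_map, univ_sum_map, univ_sum_map, univ_sum_map]
  simp only [Function.comp_assoc]
  rw [h1, h2, h3, h4, h5]
  simp only [Multiset.replicate_add, ← Multiset.singleton_add]
  rw [show Multiset.replicate 4 1 = ({1} + ({1} + ({1} + {1})) : Multiset ℕ) from rfl]
  abel

end Prongs

end Ladder

/-! ### The arrangement for a given signature -/

/-- The partial sums of a list continued by ones. -/
def rungOfList (l : List ℕ) (t : ℕ) : ℕ := ∑ j ∈ Finset.range t, l.getD j 1

/-- The ladder whose inner bands have the given widths. -/
def Ladder.ofWidths (l : List ℕ) (h : ∀ d ∈ l, 1 ≤ d) : Ladder where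
  rung := rungOfList l
  q := l.length
  strictMono := strictMono_nat_of_lt_succ fun n => by
    -- The default width `1` beyond the list keeps the sums strictly increasing on all of `ℕ`; the
    -- values past `q` name no curve.
    unfold rungOfList
    rw [Finset.sum_range_succ]
    have : 1 ≤ l.getD n 1 := by
      rcases lt_or_ge n l.length with hn | hn
      · rw [List.getD_eq_getElem _ _ hn]
        exact h _ (List.getElem_mem hn)
      · rw [List.getD_eq_default _ _ hn]
    omega
  rung_zero := by simp [rungOfList]

namespace Ladder

variable {l : List ℕ} {h : ∀ d ∈ l, 1 ≤ d}

theorem rung_ofWidths_succ {t : ℕ} (ht : t < l.length) :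
    (ofWidths l h).rung (t + 1) = (ofWidths l h).rung t + l[t] := by
  change rungOfList l (t + 1) = rungOfList l t + _
  rw [rungOfList, Finset.sum_range_succ, List.getD_eq_getElem _ _ ht]
  rfl

theorem innerProngs_ofWidths : (ofWidths l h).innerProngs = l.map (· + 2) := by
  unfold innerProngs
  congr 1
  apply List.ext_getElem
  · simp [ofWidths]
  · intro t h1 h2
    have ht : t < l.length := by simpa using h2
    have := rung_ofWidths_succ (h := h) ht
    simp only [List.getElem_ofFn, List.getElem_map]
    omega

theorem sum_take_succ {t : ℕ} (ht : t < l.length) (f : ℕ → ℕ) :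
    ((l.take (t + 1)).map f).sum = ((l.take t).map f).sum + f l[t] := by
  rw [List.take_succ_eq_append_getElem ht, List.map_append, List.sum_append, List.map_singleton,
    List.sum_singleton]

theorem rung_ofWidths (t : ℕ) (ht : t ≤ l.length) :
    (ofWidths l h).rung t = (l.take t).sum ∧
      (ofWidths l h).capGroup ((ofWidths l h).rung t) =
        ((l.take t).map fun d => (d + 1) / 2).sum := by
  induction t with
  | zero => simp [rung_zero, capGroup_zero]
  | succ t ih =>
    obtain ⟨h1, h2⟩ := ih (by omega)
    have h3 := rung_ofWidths_succ (h := h) (show t < l.length from ht)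
    refine ⟨?_, ?_⟩
    · have := sum_take_succ (show t < l.length from ht) id
      simp only [List.map_id, id] at this
      rw [h3, h1, this]
    · rw [capGroup_rung_succ, h2, h3, Nat.add_sub_cancel_left,
        sum_take_succ (show t < l.length from ht)]

theorem N_ofWidths : (ofWidths l h).N = l.sum ∧
    (ofWidths l h).capGroup (ofWidths l h).N = (l.map fun d => (d + 1) / 2).sum := by
  have := rung_ofWidths (h := h) l.length le_rfl
  rw [List.take_length] at this
  exact this

end Ladder

/-- Rounding `d / 2` up costs one half exactly for odd `d`, that is for odd `d + 2`. This matches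
the number of groups with the number of odd regions. -/
theorem two_mul_sum_half_succ (l : List ℕ) :
    2 * (l.map fun d => (d + 1) / 2).sum = l.sum + (l.map (· + 2)).countP (fun m => Odd m) := by
  induction l with
  | nil => rfl
  | cons d l ih =>
    simp only [List.map_cons, List.sum_cons, List.countP_cons, decide_eq_true_eq]
    rcases Nat.even_or_odd' d with ⟨c, rfl | rfl⟩
    · rw [if_neg (by simp [Nat.odd_add])]; omega
    · rw [if_pos (by simp [Nat.odd_add])]; omega

theorem sum_widths (l : List ℕ) :
    ((l.map (· + 2)).map fun m : ℕ => ((2 : ℚ) - (m : ℚ)) / 2).sum = -((l.sum : ℕ) : ℚ) / 2 := by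
  induction l with
  | nil => simp
  | cons d l ih =>
    rw [List.map_cons, List.map_cons, List.sum_cons, ih, List.sum_cons]
    push_cast
    ring

/-- A list of positive numbers, none of them `2`, with total curvature `2`. -/
theorem exists_widths {R : Multiset ℕ} (hpos : ∀ m ∈ R, 1 ≤ m) (htwo : 2 ∉ R)
    (heuler : (R.map (fun m : ℕ => ((2 : ℚ) - (m : ℚ)) / 2)).sum = 2) :
    ∃ l : List ℕ, (∀ d ∈ l, 1 ≤ d) ∧
      R = Multiset.replicate (l.sum + 4) 1 + ((l.map (· + 2) : List ℕ) : Multiset ℕ) := by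
  set l : List ℕ := (R.filter fun m => m ≠ 1).toList.map (· - 2) with hl
  have hmem : ∀ m ∈ R.filter (fun m => m ≠ 1), 3 ≤ m := by
    intro m hm
    obtain ⟨h1, h2⟩ := Multiset.mem_filter.1 hm
    have := hpos m h1
    have : m ≠ 2 := fun h => htwo (h ▸ h1)
    omega
  have hl2 : ((l.map (· + 2) : List ℕ) : Multiset ℕ) = R.filter fun m => m ≠ 1 := by
    rw [hl, List.map_map]
    conv_rhs => rw [← Multiset.coe_toList (R.filter fun m => m ≠ 1)]
    congr 1
    conv_rhs => rw [← List.map_id (R.filter fun m => m ≠ 1).toList]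
    refine List.map_congr_left fun m hm => ?_
    have := hmem m (Multiset.mem_toList.1 hm)
    simp only [Function.comp, id]
    omega
  have hR : R = Multiset.replicate (R.count 1) 1 + ((l.map (· + 2) : List ℕ) : Multiset ℕ) := by
    rw [hl2, ← Multiset.filter_eq' R 1]
    exact (Multiset.filter_add_not _ R).symm
  refine ⟨l, fun d hd => ?_, ?_⟩
  · obtain ⟨m, hm, rfl⟩ := List.mem_map.1 hd
    have := hmem m (Multiset.mem_toList.1 hm)
    omega
  · have hs := heuler
    rw [hR, Multiset.map_add, Multiset.sum_add, Multiset.map_coe, Multiset.sum_coe, sum_widths,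
      Multiset.map_replicate, Multiset.sum_replicate, nsmul_eq_mul] at hs
    -- Each one contributes `1 / 2` to the curvature and each `d + 2` contributes `-d / 2`; the
    -- total is `2`.
    have : R.count 1 = l.sum + 4 := by
      have h2 : ((R.count 1 : ℕ) : ℚ) = ((l.sum + 4 : ℕ) : ℚ) := by
        push_cast at hs ⊢
        linarith
      exact_mod_cast h2
    rw [← this]
    exact hR

theorem mainTheorem5 (R : Multiset ℕ) (s : SignatureSign)
    (hpos : ∀ m ∈ R, 1 ≤ m) (htwo : 2 ∉ R)
    (heuler : (R.map (fun m : ℕ => ((2 : ℚ) - (m : ℚ)) / 2)).sum = 2)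
    (hsign : (∃ m ∈ R, Odd m) → s = SignatureSign.minus) :
    ∃ (k : ℕ) (C : PairCollection k),
      C.IsTriangular ∧ C.HasSignature R s ∧ C.IsOptimal := by
  obtain ⟨l, hl, hR⟩ := exists_widths hpos htwo heuler
  have hs : s = SignatureSign.minus :=
    hsign ⟨1, by rw [hR]; exact Multiset.mem_add.2 (Or.inl (by simp)), odd_one⟩
  obtain ⟨idx, h1, h2⟩ := (Ladder.ofWidths l hl).exists_idx
  obtain ⟨F, hF⟩ := Ladder.hasProngs_coll (idx := idx)
  obtain ⟨n, hn⟩ := Ladder.prongs_eq F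
  obtain ⟨e1, e2⟩ := Ladder.N_ofWidths (h := hl)
  rw [e1] at hn
  rw [hn, Ladder.innerProngs_ofWidths] at hF
  refine ⟨_, _, Ladder.isTriangular_coll h1 h2, ⟨⟨_, hF, ?_⟩, ?_⟩, _, hF, fun _ => ?_, fun h => ?_⟩
  · have h3 : Multiset.filter (fun m => m ≠ 2) (Multiset.replicate n 2) = 0 :=
      Multiset.filter_eq_nil.2 fun m hm => by simp [Multiset.eq_of_mem_replicate hm]
    have h4 : R.filter (fun m => m ≠ 2) = R :=
      Multiset.filter_eq_self.2 fun m hm h => htwo (h ▸ hm)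
    conv_rhs => rw [← h4, hR]
    rw [Multiset.filter_add, Multiset.filter_add, Multiset.filter_add, h3, add_zero]
  · rw [hs]
    exact ⟨fun h => absurd h Ladder.not_isOrientable_coll, nofun⟩
  -- The claim is `∑ ⌈d / 2⌉ + 1 = -1 + n_odd / 2`, where `n_odd` consists of the `∑ d + 4` ones and
  -- the odd inner bands.
  · have h5 := two_mul_sum_half_succ l
    rw [e2, Multiset.countP_add, Multiset.countP_add, Multiset.coe_countP]
    have h6 : (Multiset.replicate (l.sum + 4) 1).countP (fun m => Odd m) = l.sum + 4 := by
      rw [Multiset.countP_eq_card.2 fun m hm => by simp [Multiset.eq_of_mem_replicate hm],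
        Multiset.card_replicate]
    have h7 : (Multiset.replicate n 2).countP (fun m => Odd m) = 0 :=
      Multiset.countP_eq_zero.2 fun m hm => by
        rw [Multiset.eq_of_mem_replicate hm]; decide
    rw [h6, h7]
    have h8 : (2 : ℚ) * ((l.map fun d => (d + 1) / 2).sum : ℕ) =
        (l.sum : ℕ) + ((l.map (· + 2)).countP (fun m => Odd m) : ℕ) := by exact_mod_cast h5
    push_cast at h8 ⊢
    linarith
  · exact absurd h Ladder.not_isOrientable_coll
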